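/- A real rational knot of degree $d$ in $\mathbb{RP}^3$ is the image of an injective immersion $k:\mathbb{RP}^1\to\mathbb{RP}^3$, $k([s:t])=[p_0(s,t):p_1(s,t):p_2(s,t):p_3(s,t)]$, where the $p_i$ are real homogeneous polynomials of degree $d$ without common real zero in $\mathbb{RP}^1$. Equip $\mathbb{RP}^3=S^3/\{\pm1\}$ with the round metric and $\mathbb{RP}^1$ with the parameter $\theta\mapsto[\cos\theta:\sin\theta]$. For an immersed curve $k$, the normal disc of radius $r$ at $k(\theta)=[u]$ ($u$ a unit vector) is the set of points $[u+y]$ with $y\in\mathbb{R}^4$, $|y|<r$, orthogonal to the two-dimensional subspace of $\mathbb R^4$ that represents the tangent line of $k$ at $\theta$. When $r$ is small, these discs are the disjoint fibres of a tubular neighbourhood of $k$; $r$ is then called a tubular radius of $k$. **Theorem.** Let $k_1$, $k_2$ be real rational knots of degrees $d_1$, $d_2$ that intersect in exactly one point $p$ and have different tangent lines at $p$. Then there are points $q_1\in k_1\setminus\{p\}$ and $q_2\in k_2\setminus\{p\}$ (at given parameters) such that, for every open neighbourhood $W$ of $p$ and all real numbers $r_0>0$ and $\rho>0$, there is a real rational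 knot $k$ of degree $d_1+d_2$ with the following properties. There is an open neighbourhood $U\subseteq W$ of $p$ such that: 1. Outside $U$, the knot $k$ is a section of a tubular neighbourhood of $k_1\cup k_2$ of some radius $r<r_0$. That is, $r$ is a tubular radius of $k_1$ and of $k_2$, and there are open sets $J_1,J_2\subseteq\mathbb{RP}^1$ with $k_i^{-1}(\mathbb{RP}^3\setminus U)\subseteq J_i$ such that the unions $T_i$ of the normal discs of radius $r$ of $k_i$ over $J_i$ satisfy $T_1\cap T_2=\emptyset$ and $k\setminus U\subseteq T_1\cup T_2$, and $k$ meets each of the discs that make up $T_1$ and $T_2$ in exactly one point, which depends smoothly on the parameter in $J_i$. 2. There are smooth coordinates $(x,y,z)$ on $U$, identifying $U$ with the cube $(-1,1)^3$ and $p$ with the origin, in which $k_1\cap U=\{y=z=0\}$, $k_2\cap U=\{x=z=0\}$ and $k\cap U=\{xy=\delta,\ z=0\}$ for some $\delta$ with $0<|\delta|<1$. Moreover: 3. The knot $k$ passes through $q_1$ and $q_2$, and at $q_i$ it has the same tangent line as $k_i$. More precisely, for a suitable parameter value of $k$ at $q_i$, the velocity vector of $k$ there equals $c_i>0$ times the velocity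 vector of $k_i$, and $c_1/c_2=\rho$. In particular ($\rho=1$), the ratios of the magnitudes of the velocities of the new curve and of the original curves at the two points can be chosen to be equal. Finally, if for both $k_1$ and $k_2$ the defining polynomials have no common zero in $\mathbb{CP}^1$ either, then the defining polynomials of $k$ have no common zero in $\mathbb{CP}^1$. -/

import Mathlib

open scoped ContDiff LinearAlgebra.Projectivization

/-- `ℝ⁴` with its Euclidean structure. -/
abbrev E4 : Type := EuclideanSpace ℝ (Fin 4)

/-- The real projective line. -/
abbrev RP1 : Type := ℙ ℝ (Fin 2 → ℝ)

/-- The real projective space of dimension three. -/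
abbrev RP3 : Type := ℙ ℝ E4

/-- Openness in `ℝP³` (quotient topology): the cone of nonzero vectors over `W` is open. -/
def RP3.IsOpenSet (W : Set RP3) : Prop :=
  IsOpen {v : E4 | ∃ hv : v ≠ 0, Projectivization.mk ℝ v hv ∈ W}

/-- The point `[cos θ : sin θ]` of the projective line. -/
noncomputable def circlePt (θ : ℝ) : RP1 :=
  Projectivization.mk ℝ ![Real.cos θ, Real.sin θ] (by
    intro h
    have h0 : Real.cos θ = 0 := by simpa using congrFun h 0
    have h1 : Real.sin θ = 0 := by simpa using congrFun h 1
    have h2 := Real.sin_sq_add_cos_sq θ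
    rw [h0, h1] at h2
    norm_num at h2)

/-- A rational map `[s : t] ↦ [p₀(s,t) : p₁(s,t) : p₂(s,t) : p₃(s,t)]` from the real projective
line to `ℝP³`, given by four real forms of the same degree `d` without common real zero. -/
structure RationalParam (d : ℕ) where
  poly : Fin 4 → MvPolynomial (Fin 2) ℝ
  homogeneous : ∀ i, (poly i).IsHomogeneous d
  no_common_zero : ∀ v : Fin 2 → ℝ, v ≠ 0 → ∃ i, MvPolynomial.eval v (poly i) ≠ 0

namespace RationalParam

variable {d : ℕ} (k : RationalParam d)

/-- The vector `(p₀(v), …, p₃(v))`. -/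
noncomputable def evalVec (v : Fin 2 → ℝ) : E4 :=
  WithLp.toLp 2 (fun i => MvPolynomial.eval v (k.poly i))

theorem evalVec_ne_zero {v : Fin 2 → ℝ} (hv : v ≠ 0) : k.evalVec v ≠ 0 := by
  obtain ⟨i, hi⟩ := k.no_common_zero v hv
  intro h
  exact hi (by simpa [evalVec] using congrArg (fun x : E4 => x i) h)

theorem evalVec_smul (t : ℝ) (v : Fin 2 → ℝ) : k.evalVec (t • v) = t ^ d • k.evalVec v := by
  ext i
  simp only [evalVec, PiLp.smul_apply, smul_eq_mul]
  rw [MvPolynomial.eval_eq, MvPolynomial.eval_eq, Finset.mul_sum]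
  refine Finset.sum_congr rfl fun m hm => ?_
  have hd : m.degree = d := by
    have := k.homogeneous i (MvPolynomial.mem_support_iff.mp hm)
    rw [Finsupp.degree_eq_weight_one]
    exact this
  have hprod : ∏ j ∈ m.support, (t • v) j ^ m j = t ^ d * ∏ j ∈ m.support, v j ^ m j := by
    simp only [Pi.smul_apply, smul_eq_mul, mul_pow, Finset.prod_mul_distrib]
    rw [Finset.prod_pow_eq_pow_sum, ← hd, Finsupp.degree_apply]
  rw [hprod]
  ring

/-- The induced map from the projective line to projective space. -/
noncomputable def map : RP1 → RP3 :=
  Projectivization.lift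
    (fun v => Projectivization.mk ℝ (k.evalVec v.1) (k.evalVec_ne_zero v.2))
    (by
      intro a b t hab
      rw [Projectivization.mk_eq_mk_iff']
      exact ⟨t ^ d, by rw [hab, evalVec_smul]⟩)

/-- The image of the map, a subset of `ℝP³`. -/
def image : Set RP3 := Set.range k.map

/-- The image of the point `[cos θ : sin θ]`. -/
noncomputable def pt (θ : ℝ) : RP3 := k.map (circlePt θ)

/-- The curve `θ ↦ (p₀, …, p₃)(cos θ, sin θ)` in `ℝ⁴ ∖ {0}`; it lifts `θ ↦ k.pt θ`. -/
noncomputable def lift (θ : ℝ) : E4 := k.evalVec ![Real.cos θ, Real.sin θ]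

/-- The lift of the curve to the unit sphere of `ℝ⁴`. As `ℝP³` is the quotient of the sphere by
`±1`, the derivative of `unitLift` represents, up to a common sign with `unitLift` itself, the
velocity of the curve for the standard parameter `θ` (period `π`) of the projective line. -/
noncomputable def unitLift (θ : ℝ) : E4 := ‖k.lift θ‖⁻¹ • k.lift θ

/-- The two-dimensional subspace of `ℝ⁴` whose projectivization is the tangent line of the curve
at parameter `θ` (for an immersed curve). -/
noncomputable def tangentLine (θ : ℝ) : Submodule ℝ E4 :=
  Submodule.span ℝ {k.lift θ, deriv k.lift θ}

/-- The vectors of `ℝ⁴` orthogonal to the tangent line at `θ`, i.e. the normal plane. -/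
noncomputable def normalSpace (θ : ℝ) : Submodule ℝ E4 := (k.tangentLine θ)ᗮ

/-- The open normal disc of radius `r` at the point `k.pt θ`: all points `[u + y]`, where `u` is
the unit lift and `y` is a normal vector with `‖y‖ < r`. -/
def normalDisc (r θ : ℝ) : Set RP3 :=
  {q | ∃ y ∈ k.normalSpace θ, ‖y‖ < r ∧ q.submodule = Submodule.span ℝ {k.unitLift θ + y}}

/-- `r` is the radius of a tubular neighbourhood of the curve: normal discs of radius `r` at
different points are disjoint, and the map `(θ, y) ↦ [u(θ) + y]` on the normal disc bundle is
everywhere a local diffeomorphism. For the latter, if `n` is a normal field with `n(θ) = y`, then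
`⟪u' + n', u'⟫ = ‖u'‖² - ⟪y, u''⟫`, so that the differential is invertible at `(θ, y)` exactly if
this number is not zero. -/
def IsTubularRadius (r : ℝ) : Prop :=
  0 < r ∧
  (∀ θ θ' : ℝ, circlePt θ ≠ circlePt θ' → Disjoint (k.normalDisc r θ) (k.normalDisc r θ')) ∧
  ∀ θ : ℝ, ∀ y ∈ k.normalSpace θ, ‖y‖ < r →
    inner ℝ y (deriv (deriv k.unitLift) θ) ≠ ‖deriv k.unitLift θ‖ ^ 2

/-- The part, over the parameters in `J`, of the tube of radius `r` around the curve. -/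
def tube (r : ℝ) (J : Set ℝ) : Set RP3 := ⋃ θ ∈ J, k.normalDisc r θ

/-- Over the parameters in `J` the set `S` is a smooth section of the tube of radius `r`: it meets
each normal disc in exactly one point, which depends smoothly on the parameter. -/
def IsSection (r : ℝ) (J : Set ℝ) (S : Set RP3) : Prop :=
  ∃ σ : ℝ → E4, ContDiffOn ℝ ∞ σ J ∧
    ∀ θ ∈ J, σ θ ∈ k.normalSpace θ ∧ ‖σ θ‖ < r ∧
      ∀ q : RP3, (q ∈ S ∧ q ∈ k.normalDisc r θ) ↔
        q.submodule = Submodule.span ℝ {k.unitLift θ + σ θ}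

/-- The forms defining the map have no common zero over the complex numbers either, i.e. they have
no common factor. -/
def NoComplexZero : Prop :=
  ∀ z : Fin 2 → ℂ, z ≠ 0 → ∃ i, MvPolynomial.aeval z (k.poly i) ≠ 0

end RationalParam

/-- A real rational knot of degree `d` in `ℝP³`, with its parametrization: a rational map of
degree `d` that is injective and an immersion. -/
structure RealRationalKnot (d : ℕ) extends RationalParam d where
  injective : Function.Injective toRationalParam.map
  immersion : ∀ θ : ℝ,
    LinearIndependent ℝ ![toRationalParam.lift θ, deriv toRationalParam.lift θ]

/-- The open cube `(-1, 1)³`. -/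
def openCube : Set (Fin 3 → ℝ) := {z | ∀ i, |z i| < 1}

/-- `χ`, a lift to `ℝ⁴ ∖ {0}` of a map `(-1, 1)³ → ℝP³`, is the inverse of a smooth coordinate
system on the open set `U` of `ℝP³`: modulo scalars it is an injective smooth map with image `U`
whose differential is everywhere invertible. -/
def IsCoordinateCube (U : Set RP3) (χ : (Fin 3 → ℝ) → E4) : Prop :=
  ContDiffOn ℝ ∞ χ openCube ∧
  (∀ z ∈ openCube, ∀ (c : ℝ) (h : Fin 3 → ℝ), c • χ z + fderiv ℝ χ z h = 0 → c = 0 ∧ h = 0) ∧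
  (∀ z ∈ openCube, ∀ w ∈ openCube,
    Submodule.span ℝ {χ z} = Submodule.span ℝ {χ w} → z = w) ∧
  U = {q | ∃ z ∈ openCube, q.submodule = Submodule.span ℝ {χ z}}

/-- Outside `U` the set `S` is a section of a tubular neighbourhood, of radius `r`, of the union
of the curves `k₁` and `k₂`. -/
def IsSectionOfUnionOutside {d₁ d₂ : ℕ} (k₁ : RationalParam d₁) (k₂ : RationalParam d₂)
    (r : ℝ) (U S : Set RP3) : Prop :=
  k₁.IsTubularRadius r ∧ k₂.IsTubularRadius r ∧
  ∃ J₁ J₂ : Set ℝ, IsOpen J₁ ∧ IsOpen J₂ ∧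
    (∀ θ, k₁.pt θ ∉ U → θ ∈ J₁) ∧ (∀ θ, k₂.pt θ ∉ U → θ ∈ J₂) ∧
    Disjoint (k₁.tube r J₁) (k₂.tube r J₂) ∧
    S \ U ⊆ k₁.tube r J₁ ∪ k₂.tube r J₂ ∧
    k₁.IsSection r J₁ S ∧ k₂.IsSection r J₂ S

/-- In suitable coordinates of `U`, with `p` as origin, the sets `S₁` and `S₂` are two coordinate
axes and `S` is a hyperbola `x₀ x₁ = δ`, `x₂ = 0`, both of whose branches meet the cube. -/
def IsHyperbolaSmoothing (p : RP3) (U S₁ S₂ S : Set RP3) : Prop :=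
  ∃ χ : (Fin 3 → ℝ) → E4, IsCoordinateCube U χ ∧
    p.submodule = Submodule.span ℝ {χ 0} ∧
    ∃ δ : ℝ, δ ≠ 0 ∧ |δ| < 1 ∧
      ∀ z ∈ openCube, ∀ q : RP3, q.submodule = Submodule.span ℝ {χ z} →
        (q ∈ S₁ ↔ z 1 = 0 ∧ z 2 = 0) ∧
        (q ∈ S₂ ↔ z 0 = 0 ∧ z 2 = 0) ∧
        (q ∈ S ↔ z 0 * z 1 = δ ∧ z 2 = 0)

/-- The curves `k` at parameter `ψ` and `k'` at parameter `φ` pass through the same point with the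
same tangent line, and the velocity vector of `k` there is `c` times that of `k'`. -/
def HasVelocityRatio {d d' : ℕ} (k : RationalParam d) (ψ : ℝ) (k' : RationalParam d') (φ : ℝ)
    (c : ℝ) : Prop :=
  k.pt ψ = k'.pt φ ∧ k.tangentLine ψ = k'.tangentLine φ ∧
  ∃ s : ℝ, (s = 1 ∨ s = -1) ∧ k.unitLift ψ = s • k'.unitLift φ ∧
    deriv k.unitLift ψ = s • c • deriv k'.unitLift φ

/-! ### The projective line, unit lifts and changes of parameter. -/

section
open Filter Topology Set

/-! Choose homogeneous coordinates [s : t] on both projective lines so that p is the image of [1 :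
0], and scale the resulting forms P, Q of degrees m, n so that P(1, 0) = Q(1, 0) = e. The form
`glue`, that is s^m Q(t, as) + t^n (P(s, bt) - s^m e), has degree m + n. Put ε = ab. Up to scalar
factors, which do not matter in projective space, it has three descriptions.

In the coordinate w = s/(bt) it is `perturb`, P(w, 1) + w^m (Q(1, εw) - e), which tends to the first
curve on bounded sets of w as ε → 0. In the coordinate t/(as) the same holds with the two curves
exchanged. In x = bt/s and y = as/t it is `neck`, P(1, x) + Q(1, y) - e, restricted to the hyperbola
xy = ε. Since the tangent lines at p differ, `neck` parametrizes a smooth surface near p that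
contains both curves there, and a transverse direction completes (x, y) to a chart (`cubeMap`). In
this chart the smoothing is visible.

Absence of common zeros, injectivity, immersivity and the section property follow from open
conditions at ε = 0. They persist for small ε by compactness of the intervals |w| ≤ M and of the
neck; see `eventually_glue_ne_zero`, `eventually_isGoodSide`, `glueArm_injective` and
`gluedParam_immersion`. All of them depend on a and b only through ε.

The perturbation vanishes to second order at w = 0. So the new curve is tangent to the old ones at
the points w = 0, with velocity factors 1/b and 1/a. As only ab has to be small, the ratio a/b is
free and can be set to ρ. -/

theorem span_pair_reparam {V : Type*} [AddCommGroup V] [Module ℝ V] (m m' : V) {c d g : ℝ}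
    (hc : c ≠ 0) (hg : g ≠ 0) :
    Submodule.span ℝ {c • m, d • m + g • m'} = Submodule.span ℝ {m, m'} := by
  apply le_antisymm
  · rw [Submodule.span_le]
    rintro x (rfl | rfl)
    · exact Submodule.mem_span_pair.2 ⟨c, 0, by simp⟩
    · exact Submodule.mem_span_pair.2 ⟨d, g, rfl⟩
  · rw [Submodule.span_le]
    rintro x (rfl | rfl)
    · exact Submodule.mem_span_pair.2 ⟨c⁻¹, 0, by simp [smul_smul, hc]⟩
    · refine Submodule.mem_span_pair.2 ⟨-(g⁻¹ * d * c⁻¹), g⁻¹, ?_⟩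
      rw [smul_add, smul_smul, smul_smul, smul_smul, inv_mul_cancel₀ hg, one_smul, ← add_assoc,
        ← add_smul]
      have : -(g⁻¹ * d * c⁻¹) * c + g⁻¹ * d = 0 := by field_simp; ring
      rw [this, zero_smul, zero_add]

theorem linearIndependent_pair_reparam {V : Type*} [AddCommGroup V] [Module ℝ V] {m m' : V}
    {c d g : ℝ} (h : LinearIndependent ℝ ![m, m']) (hc : c ≠ 0) (hg : g ≠ 0) :
    LinearIndependent ℝ ![c • m, d • m + g • m'] := by
  rw [LinearIndependent.pair_iff] at h ⊢
  intro s t hst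
  have h1 : (s * c + t * d) • m + (t * g) • m' = 0 := by
    rw [← hst]; module
  obtain ⟨h2, h3⟩ := h _ _ h1
  have ht : t = 0 := by simpa [hg] using h3
  subst ht
  simpa [hc] using h2

/-- A change of lift and of parameter acts on the pair (value, derivative) by a triangular matrix.
With the two preceding lemmas, tangent lines and immersivity can be computed in any affine chart. -/
theorem hasDerivAt_smul_comp {V : Type*} [NormedAddCommGroup V] [NormedSpace ℝ V]
    {M : ℝ → V} {M' : V} {c g : ℝ → ℝ} {c' g' x : ℝ}
    (hM : HasDerivAt M M' (g x)) (hc : HasDerivAt c c' x) (hg : HasDerivAt g g' x) :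
    HasDerivAt (fun t => c t • M (g t)) (c' • M (g x) + (c x * g') • M') x := by
  have := hc.smul (hM.scomp x hg)
  rw [add_comm, mul_smul]
  exact this

theorem circlePt_eq_iff {θ θ' : ℝ} : circlePt θ = circlePt θ' ↔ Real.sin (θ - θ') = 0 := by
  rw [circlePt, circlePt, Projectivization.mk_eq_mk_iff']
  constructor
  · rintro ⟨a, ha⟩
    have h0 : a * Real.cos θ' = Real.cos θ := by simpa using congrFun ha 0
    have h1 : a * Real.sin θ' = Real.sin θ := by simpa using congrFun ha 1
    rw [Real.sin_sub, ← h0, ← h1]; ring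
  · intro h
    have hs := Real.sin_sq_add_cos_sq (θ - θ')
    -- The angles differ by a multiple of π, and the factor is the corresponding sign.
    refine ⟨Real.cos (θ - θ'), ?_⟩
    have e : θ = (θ - θ') + θ' := by ring
    have e1 : Real.cos θ = Real.cos (θ - θ') * Real.cos θ' := by
      conv_lhs => rw [e, Real.cos_add, h]
      ring
    have e2 : Real.sin θ = Real.cos (θ - θ') * Real.sin θ' := by
      conv_lhs => rw [e, Real.sin_add, h]
      ring
    ext i; fin_cases i
    · simp [e1]
    · simp [e2]

theorem exists_int_of_circlePt_eq {θ θ' : ℝ} (h : circlePt θ = circlePt θ') :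
    ∃ n : ℤ, θ = θ' + n * Real.pi := by
  rw [circlePt_eq_iff, Real.sin_eq_zero_iff] at h
  obtain ⟨n, hn⟩ := h
  exact ⟨n, by linarith⟩

theorem circlePt_add_int_mul_pi (θ : ℝ) (n : ℤ) : circlePt (θ + n * Real.pi) = circlePt θ := by
  rw [circlePt_eq_iff, add_sub_cancel_left, Real.sin_int_mul_pi]

theorem exists_polar {s t : ℝ} (h : ¬ (s = 0 ∧ t = 0)) :
    ∃ R θ : ℝ, R ≠ 0 ∧ s = R * Real.cos θ ∧ t = R * Real.sin θ := by
  have hz : (⟨s, t⟩ : ℂ) ≠ 0 := by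
    intro hz
    exact h ⟨by simpa using congrArg Complex.re hz, by simpa using congrArg Complex.im hz⟩
  refine ⟨‖(⟨s, t⟩ : ℂ)‖, Complex.arg ⟨s, t⟩, norm_ne_zero_iff.2 hz, ?_, ?_⟩
  · rw [Complex.norm_mul_cos_arg]
  · rw [Complex.norm_mul_sin_arg]

theorem circlePt_surjective : Function.Surjective circlePt := by
  intro q
  induction q using Projectivization.ind with
  | h v hv =>
    obtain ⟨R, θ, hR, h0, h1⟩ := exists_polar (s := v 0) (t := v 1) (by
      rintro ⟨h0, h1⟩
      exact hv (by ext i; fin_cases i <;> simp [h0, h1]))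
    refine ⟨θ, ?_⟩
    rw [circlePt, Projectivization.mk_eq_mk_iff']
    refine ⟨R⁻¹, ?_⟩
    ext i; fin_cases i
    · simp [h0, hR]
    · simp [h1, hR]

namespace RationalParam

variable {d : ℕ} (k : RationalParam d)

/-- Smoothness is kept at order ω throughout: differentiation does not lower it, and being of class
ω at a point is an open condition, which fails for ∞. -/
theorem contDiff_evalVec : ContDiff ℝ ω k.evalVec := by
  unfold evalVec
  refine (contDiff_piLp' (p := 2) ?_)
  intro i
  rw [contDiff_omega_iff_analyticOnNhd]
  have := AnalyticOnNhd.eval_continuousLinearMap (𝕜 := ℝ) (σ := Fin 2) (B := ℝ)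
    (ContinuousLinearMap.id ℝ (Fin 2 → ℝ)) (k.poly i)
  simpa using this

theorem contDiff_lift : ContDiff ℝ ω k.lift := by
  unfold lift
  refine k.contDiff_evalVec.comp ?_
  rw [contDiff_pi]
  intro i
  fin_cases i
  · exact Real.contDiff_cos
  · exact Real.contDiff_sin

theorem cos_sin_ne_zero (θ : ℝ) : (![Real.cos θ, Real.sin θ] : Fin 2 → ℝ) ≠ 0 := by
  intro h
  have h0 : Real.cos θ = 0 := by simpa using congrFun h 0
  have h1 : Real.sin θ = 0 := by simpa using congrFun h 1
  have h2 := Real.sin_sq_add_cos_sq θ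
  rw [h0, h1] at h2
  norm_num at h2

theorem lift_ne_zero (θ : ℝ) : k.lift θ ≠ 0 := k.evalVec_ne_zero (cos_sin_ne_zero θ)

theorem norm_lift_ne_zero (θ : ℝ) : ‖k.lift θ‖ ≠ 0 := norm_ne_zero_iff.2 (k.lift_ne_zero θ)

theorem contDiff_unitLift : ContDiff ℝ ω k.unitLift := by
  rw [contDiff_iff_contDiffAt]
  intro θ
  unfold unitLift
  exact ((k.contDiff_lift.contDiffAt.norm ℝ (k.lift_ne_zero θ)).inv
    (k.norm_lift_ne_zero θ)).smul k.contDiff_lift.contDiffAt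

theorem contDiff_deriv_unitLift : ContDiff ℝ ω (deriv k.unitLift) :=
  (contDiff_succ_iff_deriv (n := ω)).1 (by simpa using k.contDiff_unitLift) |>.2.2

theorem contDiff_deriv_deriv_unitLift : ContDiff ℝ ω (deriv (deriv k.unitLift)) :=
  (contDiff_succ_iff_deriv (n := ω)).1 (by simpa using k.contDiff_deriv_unitLift) |>.2.2

theorem hasDerivAt_lift (θ : ℝ) : HasDerivAt k.lift (deriv k.lift θ) θ :=
  (k.contDiff_lift.differentiable (by simp) θ).hasDerivAt

theorem hasDerivAt_unitLift (θ : ℝ) : HasDerivAt k.unitLift (deriv k.unitLift θ) θ :=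
  (k.contDiff_unitLift.differentiable (by simp) θ).hasDerivAt

theorem hasDerivAt_deriv_unitLift (θ : ℝ) :
    HasDerivAt (deriv k.unitLift) (deriv (deriv k.unitLift) θ) θ :=
  (k.contDiff_deriv_unitLift.differentiable (by simp) θ).hasDerivAt

theorem norm_unitLift (θ : ℝ) : ‖k.unitLift θ‖ = 1 := by
  rw [unitLift, norm_smul, norm_inv, norm_norm, inv_mul_cancel₀ (k.norm_lift_ne_zero θ)]

theorem inner_unitLift_self (θ : ℝ) : inner ℝ (k.unitLift θ) (k.unitLift θ) = 1 := by
  rw [real_inner_self_eq_norm_sq, norm_unitLift, one_pow]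

theorem unitLift_ne_zero (θ : ℝ) : k.unitLift θ ≠ 0 := by
  rw [← norm_ne_zero_iff, norm_unitLift]; exact one_ne_zero

theorem inner_unitLift_deriv (θ : ℝ) :
    inner ℝ (k.unitLift θ) (deriv k.unitLift θ) = 0 := by
  have h := (k.hasDerivAt_unitLift θ).inner ℝ (k.hasDerivAt_unitLift θ)
  have h2 : (fun t => inner ℝ (k.unitLift t) (k.unitLift t)) = fun _ => (1 : ℝ) :=
    funext k.inner_unitLift_self
  rw [h2] at h
  have := h.unique (hasDerivAt_const θ 1)
  rw [real_inner_comm (k.unitLift θ) (deriv k.unitLift θ)] at this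
  linarith [real_inner_comm (k.unitLift θ) (deriv k.unitLift θ)]

/-- Differentiate ⟨u, u'⟩ = 0. For an immersion this value is nonzero, which makes the equation for
the foot of a perpendicular solvable in `exists_foot`. -/
theorem inner_unitLift_deriv_deriv (θ : ℝ) :
    inner ℝ (k.unitLift θ) (deriv (deriv k.unitLift) θ) = -‖deriv k.unitLift θ‖ ^ 2 := by
  have h := (k.hasDerivAt_unitLift θ).inner ℝ (k.hasDerivAt_deriv_unitLift θ)
  have h2 : (fun t => inner ℝ (k.unitLift t) (deriv k.unitLift t)) = fun _ => (0 : ℝ) :=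
    funext k.inner_unitLift_deriv
  rw [h2] at h
  have := h.unique (hasDerivAt_const θ 0)
  rw [real_inner_self_eq_norm_sq] at this
  linarith

theorem hasDerivAt_norm_lift (θ : ℝ) : ∃ c, HasDerivAt (fun t => ‖k.lift t‖) c θ :=
  ⟨_, ((k.contDiff_lift.contDiffAt.norm ℝ (k.lift_ne_zero θ)).differentiableAt
    (n := ω) (by simp)).hasDerivAt⟩

theorem lift_eq_norm_smul (θ : ℝ) : k.lift θ = ‖k.lift θ‖ • k.unitLift θ := by
  rw [unitLift, smul_smul, mul_inv_cancel₀ (k.norm_lift_ne_zero θ), one_smul]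

theorem exists_deriv_lift (θ : ℝ) :
    ∃ c : ℝ, deriv k.lift θ = c • k.unitLift θ + ‖k.lift θ‖ • deriv k.unitLift θ := by
  obtain ⟨c, hc⟩ := k.hasDerivAt_norm_lift θ
  refine ⟨c, ?_⟩
  have h := hc.smul (k.hasDerivAt_unitLift θ)
  have h2 : (fun t => ‖k.lift t‖ • k.unitLift t) = k.lift :=
    funext fun t => (k.lift_eq_norm_smul t).symm
  change HasDerivAt (fun t => ‖k.lift t‖ • k.unitLift t) _ θ at h
  rw [h2] at h
  rw [h.deriv, add_comm]

theorem tangentLine_eq_span_unitLift (θ : ℝ) :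
    k.tangentLine θ = Submodule.span ℝ {k.unitLift θ, deriv k.unitLift θ} := by
  obtain ⟨c, hc⟩ := k.exists_deriv_lift θ
  rw [tangentLine, hc]
  nth_rw 1 [k.lift_eq_norm_smul θ]
  exact span_pair_reparam _ _ (k.norm_lift_ne_zero θ) (k.norm_lift_ne_zero θ)

theorem mem_normalSpace_iff {θ : ℝ} {y : E4} :
    y ∈ k.normalSpace θ ↔
      inner ℝ (k.unitLift θ) y = 0 ∧ inner ℝ (deriv k.unitLift θ) y = 0 := by
  rw [normalSpace, tangentLine_eq_span_unitLift, Submodule.mem_orthogonal]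
  constructor
  · intro h
    exact ⟨h _ (Submodule.subset_span (by simp)), h _ (Submodule.subset_span (by simp))⟩
  · rintro ⟨h1, h2⟩ x hx
    obtain ⟨a, b, rfl⟩ := Submodule.mem_span_pair.1 hx
    rw [inner_add_left, real_inner_smul_left, real_inner_smul_left, h1, h2]
    simp

theorem pt_eq_mk (θ : ℝ) : k.pt θ = Projectivization.mk ℝ (k.lift θ) (k.lift_ne_zero θ) := rfl

theorem submodule_pt (θ : ℝ) : (k.pt θ).submodule = Submodule.span ℝ {k.lift θ} := by
  rw [pt_eq_mk, Projectivization.submodule_mk]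

theorem image_eq_range_pt : k.image = Set.range k.pt := by
  ext q
  constructor
  · rintro ⟨v, rfl⟩
    obtain ⟨θ, rfl⟩ := circlePt_surjective v
    exact ⟨θ, rfl⟩
  · rintro ⟨θ, rfl⟩
    exact ⟨_, rfl⟩

/-- Passing once around the projective line multiplies the lift by a sign. This allows parameters to
be moved to the compact interval [0, π]. -/
theorem exists_lift_add_int_mul_pi (n : ℤ) :
    ∃ s : ℝ, (s = 1 ∨ s = -1) ∧ ∀ θ, k.lift (θ + n * Real.pi) = s • k.lift θ := by
  have hc : ∃ s : ℝ, (s = 1 ∨ s = -1) ∧ ∀ θ : ℝ,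
      Real.cos (θ + n * Real.pi) = s * Real.cos θ ∧ Real.sin (θ + n * Real.pi) = s * Real.sin θ := by
    refine ⟨(-1) ^ n, ?_, fun θ => ⟨Real.cos_add_int_mul_pi θ n, Real.sin_add_int_mul_pi θ n⟩⟩
    rcases Int.even_or_odd n with h | h
    · left; exact h.neg_one_zpow
    · right; exact h.neg_one_zpow
  obtain ⟨s, hs, h⟩ := hc
  refine ⟨s ^ d, ?_, fun θ => ?_⟩
  · rcases hs with rfl | rfl
    · left; simp
    · exact neg_one_pow_eq_or ℝ d
  · rw [lift, (h θ).1, (h θ).2, lift, ← k.evalVec_smul]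
    congr 1
    ext i; fin_cases i <;> simp

theorem exists_unitLift_add_int_mul_pi (n : ℤ) :
    ∃ s : ℝ, (s = 1 ∨ s = -1) ∧ (∀ θ, k.unitLift (θ + n * Real.pi) = s • k.unitLift θ) ∧
      (∀ θ, deriv k.unitLift (θ + n * Real.pi) = s • deriv k.unitLift θ) ∧
      ∀ θ, deriv (deriv k.unitLift) (θ + n * Real.pi) = s • deriv (deriv k.unitLift) θ := by
  obtain ⟨s, hs, h⟩ := k.exists_lift_add_int_mul_pi n
  have h0 : ∀ θ, k.unitLift (θ + n * Real.pi) = s • k.unitLift θ := by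
    intro θ
    rw [unitLift, unitLift, h, norm_smul, smul_comm s]
    rcases hs with rfl | rfl <;> simp
  have h1 : ∀ θ, deriv k.unitLift (θ + n * Real.pi) = s • deriv k.unitLift θ := by
    intro θ
    have e1 := deriv_comp_add_const k.unitLift (n * Real.pi) θ
    rw [← e1, funext h0]
    exact deriv_const_smul s (k.hasDerivAt_unitLift θ).differentiableAt
  refine ⟨s, hs, h0, h1, ?_⟩
  intro θ
  have e1 := deriv_comp_add_const (deriv k.unitLift) (n * Real.pi) θ
  rw [← e1, funext h1]
  exact deriv_const_smul s (k.hasDerivAt_deriv_unitLift θ).differentiableAt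

end RationalParam

namespace RealRationalKnot

variable {d : ℕ} (k : RealRationalKnot d)

theorem pt_eq_iff {θ θ' : ℝ} : k.pt θ = k.pt θ' ↔ circlePt θ = circlePt θ' :=
  ⟨fun h => k.injective h, fun h => congrArg k.map h⟩

theorem deriv_unitLift_ne_zero (θ : ℝ) : deriv k.unitLift θ ≠ 0 := by
  intro h
  obtain ⟨c, hc⟩ := k.exists_deriv_lift θ
  have hl := k.immersion θ
  rw [LinearIndependent.pair_iff] at hl
  have := hl (-c) ‖k.lift θ‖ (by
    rw [hc, h, smul_zero, add_zero, RationalParam.unitLift, smul_smul, smul_smul, mul_right_comm,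
      mul_inv_cancel₀ (k.norm_lift_ne_zero θ), one_mul, ← add_smul,
      neg_add_cancel, zero_smul])
  exact k.norm_lift_ne_zero θ this.2

/-- A form of degree zero is constant, against injectivity. Positive degree makes the factor w^m of
the perturbation vanish at w = 0. -/
theorem degree_ne_zero (k : RealRationalKnot d) : d ≠ 0 := by
  rintro rfl
  have h : ∀ v, k.evalVec v = k.evalVec 0 := by
    intro v
    have := k.evalVec_smul 0 v
    simpa using this.symm
  have : k.pt 0 = k.pt (Real.pi / 2) := by
    rw [RationalParam.pt_eq_mk, RationalParam.pt_eq_mk, Projectivization.mk_eq_mk_iff']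
    refine ⟨1, ?_⟩
    rw [one_smul, RationalParam.lift, RationalParam.lift, h, h ![_, _]]
  rw [pt_eq_iff, circlePt_eq_iff] at this
  simp at this

end RealRationalKnot

end

/-! ### Normal discs and the existence of tubular radii. -/

section
open Filter Topology Set

theorem exists_implicit_real {E : Type*} [NormedAddCommGroup E] [NormedSpace ℝ E] [CompleteSpace E]
    {f : E × ℝ → ℝ} {x₀ : E} {t₀ f' : ℝ} (hf : ContDiffAt ℝ ω f (x₀, t₀)) (h₀ : f (x₀, t₀) = 0)
    (hd : HasDerivAt (fun t => f (x₀, t)) f' t₀) (hne : f' ≠ 0) :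
    ∃ g : E → ℝ, g x₀ = t₀ ∧ ContDiffAt ℝ ω g x₀ ∧ (∀ᶠ x in 𝓝 x₀, f (x, g x) = 0) ∧
      ∀ᶠ v in 𝓝 (x₀, t₀), f v = 0 → v.2 = g v.1 := by
  have hn : (ω : WithTop ℕ∞) ≠ 0 := by simp
  have hdf := (hf.differentiableAt hn).hasFDerivAt
  have hd2 : HasDerivAt (fun t => f (x₀, t)) (fderiv ℝ f (x₀, t₀) (0, 1)) t₀ :=
    hdf.comp_hasDerivAt t₀ ((hasDerivAt_const t₀ x₀).prodMk (hasDerivAt_id t₀))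
  have hf' : fderiv ℝ f (x₀, t₀) (0, 1) = f' := hd2.unique hd
  have hinv : (fderiv ℝ f (x₀, t₀) ∘L .inr ℝ E ℝ).IsInvertible := by
    refine ⟨ContinuousLinearEquiv.unitsEquivAut ℝ (Units.mk0 f' hne), ?_⟩
    ext
    simp [hf']
  refine ⟨hf.implicitFunction hn hinv, hf.implicitFunction_apply_self hn hinv,
    hf.contDiffAt_implicitFunction hn hinv, ?_, ?_⟩
  · filter_upwards [hf.eventually_apply_implicitFunction hn hinv] with x hx
    rw [hx, h₀]
  · filter_upwards [hf.eventually_apply_eq_iff_implicitFunction hn hinv] with v hv h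
    exact ((hv.1 (h.trans h₀.symm))).symm

theorem span_singleton_eq_iff {V : Type*} [AddCommGroup V] [Module ℝ V] {v w : V} :
    Submodule.span ℝ {v} = Submodule.span ℝ {w} ↔ ∃ c : ℝ, c ≠ 0 ∧ c • w = v := by
  rw [eq_comm, Submodule.span_singleton_eq_span_singleton]
  constructor
  · rintro ⟨z, hz⟩
    exact ⟨z, z.ne_zero, hz⟩
  · rintro ⟨c, hc, h⟩
    exact ⟨Units.mk0 c hc, h⟩

theorem span_singleton_smul {V : Type*} [AddCommGroup V] [Module ℝ V] {c : ℝ} (hc : c ≠ 0)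
    (v : V) : Submodule.span ℝ {c • v} = Submodule.span ℝ {v} :=
  span_singleton_eq_iff.2 ⟨c, hc, rfl⟩

theorem linearIndependent_pair_iff_span_ne {V : Type*} [AddCommGroup V] [Module ℝ V] {v w : V}
    (hv : v ≠ 0) (hw : w ≠ 0) :
    LinearIndependent ℝ ![v, w] ↔ Submodule.span ℝ {v} ≠ Submodule.span ℝ {w} := by
  rw [Ne, span_singleton_eq_iff, LinearIndependent.pair_iff' hv]
  constructor
  · rintro h ⟨c, hc, rfl⟩
    exact h c⁻¹ (by rw [smul_smul, inv_mul_cancel₀ hc, one_smul])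
  · rintro h a rfl
    have ha : a ≠ 0 := by rintro rfl; simp at hw
    exact h ⟨a⁻¹, inv_ne_zero ha, by rw [smul_smul, inv_mul_cancel₀ ha, one_smul]⟩

/-- Two vectors represent different points exactly if they are independent, an open condition.
Combined with compactness this makes separation of points uniform. -/
theorem eventually_linearIndependent_pair {X : Type*} [TopologicalSpace X] {f g : X → E4} {x : X}
    (hf : ContinuousAt f x) (hg : ContinuousAt g x) (h : LinearIndependent ℝ ![f x, g x]) :
    ∀ᶠ y in 𝓝 x, LinearIndependent ℝ ![f y, g y] := by
  have hc : ContinuousAt (fun y => (![f y, g y] : Fin 2 → E4)) x := by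
    rw [continuousAt_pi]
    intro i
    fin_cases i
    · exact hf
    · exact hg
  exact hc.eventually h.eventually

namespace RationalParam

variable {d : ℕ} (k : RationalParam d)

/-- The vector `v` represents a point of the open normal disc of radius `r` at `θ`. -/
def InDisc (r θ : ℝ) (v : E4) : Prop :=
  inner ℝ (deriv k.unitLift θ) v = 0 ∧
    ‖v - inner ℝ (k.unitLift θ) v • k.unitLift θ‖ < r * |inner ℝ (k.unitLift θ) v|

/-- The vector `v` represents a point of the closed normal disc of radius `r` at `θ`. -/
def InClosedDisc (r θ : ℝ) (v : E4) : Prop :=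
  inner ℝ (deriv k.unitLift θ) v = 0 ∧
    ‖v - inner ℝ (k.unitLift θ) v • k.unitLift θ‖ ≤ r * |inner ℝ (k.unitLift θ) v|

variable {k} in
theorem InDisc.inClosedDisc {r θ : ℝ} {v : E4} (h : k.InDisc r θ v) : k.InClosedDisc r θ v :=
  ⟨h.1, h.2.le⟩

variable {k} in
theorem InDisc.inner_ne_zero {r θ : ℝ} {v : E4} (h : k.InDisc r θ v) :
    inner ℝ (k.unitLift θ) v ≠ 0 := by
  intro h0
  have := h.2
  rw [h0] at this
  simp at this
  exact absurd this (not_lt.2 (norm_nonneg _))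

variable {k} in
-- Compactness arguments need the closed condition for r, while disjointness is known for open discs
-- of a larger radius; hence the two radii r < R below.
theorem InClosedDisc.inDisc {r r' θ : ℝ} {v : E4} (h : k.InClosedDisc r θ v) (hv : v ≠ 0)
    (hr : r < r') : k.InDisc r' θ v := by
  refine ⟨h.1, h.2.trans_lt ?_⟩
  refine mul_lt_mul_of_pos_right hr (abs_pos.2 fun h0 => hv ?_)
  have := h.2
  rw [h0] at this
  simpa using this

theorem inDisc_unitLift_add_iff {r θ : ℝ} {y : E4} (hy : y ∈ k.normalSpace θ) :
    k.InDisc r θ (k.unitLift θ + y) ↔ ‖y‖ < r := by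
  rw [mem_normalSpace_iff] at hy
  have h1 : inner ℝ (k.unitLift θ) (k.unitLift θ + y) = 1 := by
    rw [inner_add_right, hy.1, inner_unitLift_self, add_zero]
  have h2 : inner ℝ (deriv k.unitLift θ) (k.unitLift θ + y) = 0 := by
    rw [inner_add_right, hy.2, real_inner_comm, inner_unitLift_deriv, add_zero]
  rw [InDisc, h1, h2]
  simp

theorem inDisc_smul_iff {r θ c : ℝ} {v : E4} (hc : c ≠ 0) :
    k.InDisc r θ (c • v) ↔ k.InDisc r θ v := by
  simp only [InDisc, real_inner_smul_right]
  rw [mul_smul, ← smul_sub, norm_smul, abs_mul, Real.norm_eq_abs, mul_left_comm r,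
    mul_lt_mul_iff_right₀ (abs_pos.2 hc)]
  simp [hc]

/-- The normal vector `y` with `v` a multiple of `u(θ) + y`. -/
noncomputable def normalPart (θ : ℝ) (v : E4) : E4 :=
  (inner ℝ (k.unitLift θ) v)⁻¹ • v - k.unitLift θ

variable {k} in
theorem InDisc.normalPart_mem {r θ : ℝ} {v : E4} (h : k.InDisc r θ v) :
    k.normalPart θ v ∈ k.normalSpace θ := by
  rw [mem_normalSpace_iff, normalPart, inner_sub_right, inner_sub_right, real_inner_smul_right,
    real_inner_smul_right, h.1, inner_unitLift_self, inv_mul_cancel₀ h.inner_ne_zero,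
    real_inner_comm (k.unitLift θ), inner_unitLift_deriv]
  simp

variable {k} in
theorem InDisc.span_eq {r θ : ℝ} {v : E4} (h : k.InDisc r θ v) :
    Submodule.span ℝ {v} = Submodule.span ℝ {k.unitLift θ + k.normalPart θ v} := by
  rw [span_singleton_eq_iff]
  refine ⟨_, h.inner_ne_zero, ?_⟩
  rw [normalPart, add_sub_cancel, smul_smul, mul_inv_cancel₀ h.inner_ne_zero, one_smul]

variable {k} in
theorem InDisc.norm_normalPart_lt {r θ : ℝ} {v : E4} (h : k.InDisc r θ v) :
    ‖k.normalPart θ v‖ < r := by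
  rw [← k.inDisc_unitLift_add_iff h.normalPart_mem]
  obtain ⟨c, hc, hcv⟩ := span_singleton_eq_iff.1 h.span_eq
  rw [← k.inDisc_smul_iff hc, hcv]
  exact h

/-- The right-hand side is an explicit homogeneous condition on a representing vector, suited to
continuity arguments that are awkward in the quotient. -/
theorem mem_normalDisc_iff {r θ : ℝ} {v : E4} {q : RP3}
    (hq : q.submodule = Submodule.span ℝ {v}) : q ∈ k.normalDisc r θ ↔ k.InDisc r θ v := by
  constructor
  · rintro ⟨y, hy, hyr, h⟩
    rw [hq] at h
    obtain ⟨c, hc, rfl⟩ := span_singleton_eq_iff.1 h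
    rw [inDisc_smul_iff _ hc, inDisc_unitLift_add_iff _ hy]
    exact hyr
  · intro h
    exact ⟨k.normalPart θ v, h.normalPart_mem, h.norm_normalPart_lt, hq.trans h.span_eq⟩

theorem isClosed_inClosedDisc (r : ℝ) :
    IsClosed {p : ℝ × E4 | k.InClosedDisc r p.1 p.2} := by
  have h1 := k.contDiff_unitLift.continuous
  have h2 := k.contDiff_deriv_unitLift.continuous
  have h3 : IsClosed {p : ℝ × E4 | inner ℝ (deriv k.unitLift p.1) p.2 = (0 : ℝ)} :=
    isClosed_eq (by fun_prop) continuous_const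
  have h4 : IsClosed {p : ℝ × E4 | ‖p.2 - inner ℝ (k.unitLift p.1) p.2 • k.unitLift p.1‖ ≤
      r * |inner ℝ (k.unitLift p.1) p.2|} := isClosed_le (by fun_prop) (by fun_prop)
  exact h3.inter h4

/-- Locally there is exactly one parameter `θ` for which a given vector `v` is orthogonal to the
velocity. -/
theorem exists_foot {θ₀ c : ℝ} (hne : deriv k.unitLift θ₀ ≠ 0) (hc : c ≠ 0) :
    ∃ g : E4 → ℝ, g (c • k.unitLift θ₀) = θ₀ ∧ ContinuousAt g (c • k.unitLift θ₀) ∧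
      (∀ᶠ v in 𝓝 (c • k.unitLift θ₀), inner ℝ (deriv k.unitLift (g v)) v = 0) ∧
      ∀ᶠ p in 𝓝 (c • k.unitLift θ₀, θ₀), inner ℝ (deriv k.unitLift p.2) p.1 = 0 → p.2 = g p.1 := by
  have hf : ContDiffAt ℝ ω (fun p : E4 × ℝ => inner ℝ (deriv k.unitLift p.2) p.1)
      (c • k.unitLift θ₀, θ₀) :=
    ((k.contDiff_deriv_unitLift.comp contDiff_snd).inner ℝ contDiff_fst).contDiffAt
  obtain ⟨g, h1, h2, h3, h4⟩ := exists_implicit_real hf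
    (by simp only [real_inner_smul_right]
        rw [real_inner_comm, inner_unitLift_deriv, mul_zero])
    -- The derivative of θ ↦ ⟨u'(θ), c u(θ₀)⟩ at θ₀ is c⟨u'', u⟩ = -c‖u'‖², which is not zero.
    ((k.hasDerivAt_deriv_unitLift θ₀).inner ℝ (hasDerivAt_const θ₀ (c • k.unitLift θ₀)))
    (by rw [inner_zero_right, zero_add, real_inner_smul_right, real_inner_comm,
          inner_unitLift_deriv_deriv]
        simpa [hc] using hne)
  exact ⟨g, h1, h2.continuousAt, h3, h4⟩

/-- The foot of the perpendicular depends continuously on the vector, and the strict inequality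
defining the disc persists. -/
theorem eventually_exists_inDisc {θ₀ c r : ℝ} (hne : deriv k.unitLift θ₀ ≠ 0) (hc : c ≠ 0)
    (hr : 0 < r) {N : Set ℝ} (hN : N ∈ 𝓝 θ₀) :
    ∀ᶠ v in 𝓝 (c • k.unitLift θ₀), ∃ θ ∈ N, k.InDisc r θ v := by
  obtain ⟨g, h1, h2, h3, -⟩ := k.exists_foot hne hc
  have hu := k.contDiff_unitLift.continuous
  have h4 : ∀ᶠ v in 𝓝 (c • k.unitLift θ₀),
      ‖v - inner ℝ (k.unitLift (g v)) v • k.unitLift (g v)‖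
        < r * |inner ℝ (k.unitLift (g v)) v| := by
    have hug : ContinuousAt (fun v => k.unitLift (g v)) (c • k.unitLift θ₀) :=
      hu.continuousAt.comp h2
    refine ContinuousAt.eventually_lt (by fun_prop) (by fun_prop) ?_
    rw [h1, real_inner_smul_right, inner_unitLift_self]
    simpa [hr] using hc
  have h5 : ∀ᶠ v in 𝓝 (c • k.unitLift θ₀), g v ∈ N := h2.eventually_mem (by rwa [h1])
  filter_upwards [h3, h4, h5] with v h3 h4 h5
  exact ⟨g v, h5, h3, h4⟩

end RationalParam

namespace RealRationalKnot

variable {d : ℕ} (k : RealRationalKnot d)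

theorem exists_mem_Icc_add_int_mul_pi (θ : ℝ) :
    ∃ θ' ∈ Icc 0 Real.pi, ∃ n : ℤ, θ = θ' + n * Real.pi := by
  obtain ⟨n, hn, -⟩ := existsUnique_sub_zsmul_mem_Ico Real.pi_pos θ 0
  refine ⟨θ - n • Real.pi, ⟨hn.1, by simpa using hn.2.le⟩, n, ?_⟩
  rw [zsmul_eq_mul]; ring

theorem span_unitLift_eq_iff {θ θ' : ℝ} :
    Submodule.span ℝ {k.unitLift θ} = Submodule.span ℝ {k.unitLift θ'} ↔
      circlePt θ = circlePt θ' := by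
  rw [← k.pt_eq_iff, ← Projectivization.submodule_injective.eq_iff, RationalParam.submodule_pt,
    RationalParam.submodule_pt, RationalParam.unitLift, RationalParam.unitLift,
    span_singleton_smul (inv_ne_zero (k.norm_lift_ne_zero θ)),
    span_singleton_smul (inv_ne_zero (k.norm_lift_ne_zero θ'))]

/-- For parameters of the same point, use local uniqueness of the foot; for parameters of different
points, independence of the unit lifts. Compactness of [0, π]² makes the bound on the normal vectors
uniform. -/
theorem eventually_disjoint_discs :
    ∀ᶠ y : E4 × E4 in 𝓝 (0, 0), ∀ p ∈ Icc 0 Real.pi ×ˢ Icc 0 Real.pi,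
      y.1 ∈ k.normalSpace p.1 → y.2 ∈ k.normalSpace p.2 →
      Submodule.span ℝ {k.unitLift p.1 + y.1} = Submodule.span ℝ {k.unitLift p.2 + y.2} →
      circlePt p.1 = circlePt p.2 := by
  refine (isCompact_Icc.prod isCompact_Icc).eventually_forall_of_forall_eventually ?_
  rintro ⟨θ, θ'⟩ -
  have hu := k.contDiff_unitLift.continuous
  by_cases h : circlePt θ' = circlePt θ
  · obtain ⟨n, rfl⟩ := exists_int_of_circlePt_eq h
    obtain ⟨g, -, -, -, hg⟩ := k.exists_foot (k.deriv_unitLift_ne_zero θ) one_ne_zero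
    rw [one_smul] at hg
    obtain ⟨s, hs, -, hs2, -⟩ := k.exists_unitLift_add_int_mul_pi n
    have hs0 : s ≠ 0 := by rcases hs with rfl | rfl <;> norm_num
    have h1 : Tendsto (fun z : (E4 × E4) × (ℝ × ℝ) => (k.unitLift z.2.1 + z.1.1, z.2.1))
        (𝓝 ((0, 0), (θ, θ + n * Real.pi))) (𝓝 (k.unitLift θ, θ)) := by
      have : Continuous (fun z : (E4 × E4) × (ℝ × ℝ) => (k.unitLift z.2.1 + z.1.1, z.2.1)) := by
        fun_prop
      convert this.tendsto _ using 2
      simp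
    have h2 : Tendsto (fun z : (E4 × E4) × (ℝ × ℝ) =>
        (k.unitLift z.2.1 + z.1.1, z.2.2 - n * Real.pi))
        (𝓝 ((0, 0), (θ, θ + n * Real.pi))) (𝓝 (k.unitLift θ, θ)) := by
      have : Continuous (fun z : (E4 × E4) × (ℝ × ℝ) =>
        (k.unitLift z.2.1 + z.1.1, z.2.2 - n * Real.pi)) := by
        fun_prop
      convert this.tendsto _ using 2
      simp
    filter_upwards [h1.eventually hg, h2.eventually hg] with z hz1 hz2 hy1 hy2 hspan
    rw [RationalParam.mem_normalSpace_iff] at hy1 hy2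
    have e1 := hz1 (by
      simp only [inner_add_right]
      rw [real_inner_comm, k.inner_unitLift_deriv, hy1.2, add_zero])
    have e2 := hz2 (by
      obtain ⟨c, hc, hcv⟩ := span_singleton_eq_iff.1 hspan
      have h3 : inner ℝ (deriv k.unitLift z.2.2) (k.unitLift z.2.1 + z.1.1) = 0 := by
        rw [← hcv, real_inner_smul_right, inner_add_right, real_inner_comm,
          k.inner_unitLift_deriv, hy2.2]
        simp
      have h4 := hs2 (z.2.2 - n * Real.pi)
      rw [sub_add_cancel] at h4
      rw [h4, real_inner_smul_left] at h3
      simpa [hs0] using h3)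
    -- Both parameters, the second one shifted by nπ, are the foot of the same vector.
    have e3 : z.2.2 = z.2.1 + n * Real.pi := by
      have := e2.trans e1.symm
      linarith
    rw [e3, circlePt_add_int_mul_pi]
  · have h1 : LinearIndependent ℝ ![k.unitLift θ + 0, k.unitLift θ' + 0] := by
      rw [add_zero, add_zero, linearIndependent_pair_iff_span_ne (k.unitLift_ne_zero _)
        (k.unitLift_ne_zero _), Ne, k.span_unitLift_eq_iff]
      exact fun h' => h h'.symm
    have h2 := eventually_linearIndependent_pair (X := (E4 × E4) × (ℝ × ℝ))
      (x := ((0, 0), (θ, θ'))) (f := fun z => k.unitLift z.2.1 + z.1.1)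
      (g := fun z => k.unitLift z.2.2 + z.1.2) (by fun_prop) (by fun_prop) h1
    filter_upwards [h2] with z hz _ _ hspan
    exact absurd hspan ((linearIndependent_pair_iff_span_ne (hz.ne_zero 0) (hz.ne_zero 1)).1 hz)

theorem eventually_regular :
    ∀ᶠ y : E4 in 𝓝 0, ∀ θ ∈ Icc 0 Real.pi,
      inner ℝ y (deriv (deriv k.unitLift) θ) ≠ ‖deriv k.unitLift θ‖ ^ 2 := by
  refine isCompact_Icc.eventually_forall_of_forall_eventually fun θ _ => ?_
  have h1 := k.contDiff_deriv_unitLift.continuous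
  have h2 := k.contDiff_deriv_deriv_unitLift.continuous
  have hc : ContinuousAt (fun z : E4 × ℝ => inner ℝ z.1 (deriv (deriv k.unitLift) z.2) -
      ‖deriv k.unitLift z.2‖ ^ 2) (0, θ) := by fun_prop
  have h0 : inner ℝ (0 : E4) (deriv (deriv k.unitLift) θ) - ‖deriv k.unitLift θ‖ ^ 2 ≠ 0 := by
    simpa using k.deriv_unitLift_ne_zero θ
  filter_upwards [hc.eventually_ne h0] with z hz
  exact sub_ne_zero.1 hz

theorem exists_isTubularRadius : ∃ R, k.IsTubularRadius R := by
  obtain ⟨R₁, hR₁, h₁⟩ := Metric.eventually_nhds_iff.1 k.eventually_disjoint_discs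
  obtain ⟨R₂, hR₂, h₂⟩ := Metric.eventually_nhds_iff.1 k.eventually_regular
  refine ⟨min R₁ R₂, lt_min hR₁ hR₂, ?_, ?_⟩
  · intro θ θ' hne
    rw [Set.disjoint_left]
    rintro q ⟨y, hy, hyr, hq⟩ ⟨y', hy', hyr', hq'⟩
    apply hne
    obtain ⟨θ₁, hθ₁, n, rfl⟩ := exists_mem_Icc_add_int_mul_pi θ
    obtain ⟨θ₁', hθ₁', n', rfl⟩ := exists_mem_Icc_add_int_mul_pi θ'
    obtain ⟨s, hs, hs0, hs1, -⟩ := k.exists_unitLift_add_int_mul_pi n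
    obtain ⟨s', hs', hs0', hs1', -⟩ := k.exists_unitLift_add_int_mul_pi n'
    -- Shifting the parameter by nπ multiplies u by a sign s, and the same point is represented with
    -- sy in place of y.
    have key : ∀ {s θ : ℝ} {n : ℤ} {y : E4}, (s = 1 ∨ s = -1) →
        k.unitLift (θ + n * Real.pi) = s • k.unitLift θ →
        deriv k.unitLift (θ + n * Real.pi) = s • deriv k.unitLift θ →
        y ∈ k.normalSpace (θ + n * Real.pi) → s • y ∈ k.normalSpace θ ∧ ‖s • y‖ = ‖y‖ ∧
          Submodule.span ℝ {k.unitLift (θ + n * Real.pi) + y} =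
            Submodule.span ℝ {k.unitLift θ + s • y} := by
      intro s θ n y hs h0 h1 hy
      rw [RationalParam.mem_normalSpace_iff, h0, h1] at hy
      rw [RationalParam.mem_normalSpace_iff, h0]
      rcases hs with rfl | rfl
      · simpa using hy
      · refine ⟨by simpa using hy, by simp, ?_⟩
        exact span_singleton_eq_iff.2 ⟨-1, by norm_num, by module⟩
    obtain ⟨a1, a2, a3⟩ := key hs (hs0 _) (hs1 _) hy
    obtain ⟨b1, b2, b3⟩ := key hs' (hs0' _) (hs1' _) hy'
    rw [circlePt_add_int_mul_pi, circlePt_add_int_mul_pi]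
    refine h₁ (y := (s • y, s' • y')) ?_ (θ₁, θ₁') ⟨hθ₁, hθ₁'⟩ a1 b1 ?_
    · rw [Prod.dist_eq, max_lt_iff, dist_zero_right, dist_zero_right, a2, b2]
      exact ⟨hyr.trans_le (min_le_left _ _), hyr'.trans_le (min_le_left _ _)⟩
    · rw [← a3, ← b3, ← hq, ← hq']
  · intro θ y hy hyr
    obtain ⟨θ₁, hθ₁, n, rfl⟩ := exists_mem_Icc_add_int_mul_pi θ
    obtain ⟨s, hs, -, hs1, hs2⟩ := k.exists_unitLift_add_int_mul_pi n
    rw [hs1, hs2, real_inner_smul_right, ← real_inner_smul_left]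
    have hn : ‖s • deriv k.unitLift θ₁‖ = ‖deriv k.unitLift θ₁‖ := by
      rcases hs with rfl | rfl <;> simp
    have hy : ‖s • y‖ = ‖y‖ := by
      rcases hs with rfl | rfl <;> simp
    rw [hn]
    refine h₂ ?_ θ₁ hθ₁
    rw [dist_zero_right, hy]
    exact hyr.trans_le (min_le_right _ _)

end RealRationalKnot

theorem RationalParam.normalDisc_mono {d : ℕ} (k : RationalParam d) {r R : ℝ} (h : r ≤ R) (θ : ℝ) :
    k.normalDisc r θ ⊆ k.normalDisc R θ :=
  fun _ ⟨y, hy, hyr, hq⟩ => ⟨y, hy, hyr.trans_le h, hq⟩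

theorem RationalParam.IsTubularRadius.mono {d : ℕ} {k : RationalParam d} {r R : ℝ}
    (hR : k.IsTubularRadius R) (hr : 0 < r) (h : r ≤ R) : k.IsTubularRadius r :=
  ⟨hr, fun θ θ' hne => (hR.2.1 θ θ' hne).mono (k.normalDisc_mono h θ) (k.normalDisc_mono h θ'),
    fun θ y hy hyr => hR.2.2 θ y hy (hyr.trans_le h)⟩

end

/-! ### Gluing of binary forms, and affine charts of a curve centred at a point. -/

section
open Filter Topology Set

section Gluing

variable {𝕜 V : Type*}

/-- Binary forms `P`, `Q` of degrees `m`, `n` with `P(1, 0) = Q(1, 0) = e` are glued to a form of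
degree `m + n`, which is close to `P` where `s` is of the order of `b` and close to `Q` where `t` is
of the order of `a`. -/
def glue [Field 𝕜] [AddCommGroup V] [Module 𝕜 V] (P Q : 𝕜 → 𝕜 → V) (e : V) (m n : ℕ)
    (a b s t : 𝕜) : V :=
  s ^ m • Q t (a * s) + t ^ n • (P s (b * t) - s ^ m • e)

/-- The affine curve `w ↦ P(w, 1)`, perturbed by a curve `Q`. -/
def perturb [Field 𝕜] [AddCommGroup V] [Module 𝕜 V] (P Q : 𝕜 → 𝕜 → V) (e : V) (m : ℕ)
    (ε w : 𝕜) : V :=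
  P w 1 + w ^ m • (Q 1 (ε * w) - e)

/-- The surface that contains both of the affine curves `P(1, x)` and `Q(1, y)`. -/
def neck [Field 𝕜] [AddCommGroup V] [Module 𝕜 V] (P Q : 𝕜 → 𝕜 → V) (e : V) (x y : 𝕜) : V :=
  P 1 x + Q 1 y - e

section Algebra

variable [Field 𝕜] [AddCommGroup V] [Module 𝕜 V] {P Q : 𝕜 → 𝕜 → V} {e : V} {m n : ℕ}

theorem glue_swap (a b s t : 𝕜) : glue P Q e m n a b s t = glue Q P e n m b a t s := by
  simp only [glue]
  module

/-- Homogeneity extracts bt from P and t from Q. The remaining argument of Q is as/t = abw, so the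
curve in this chart depends only on ab. -/
theorem glue_eq_smul_perturb (hP : ∀ c s t, P (c * s) (c * t) = c ^ m • P s t)
    (hQ : ∀ c s t, Q (c * s) (c * t) = c ^ n • Q s t) {a b t : 𝕜} (hb : b ≠ 0) (ht : t ≠ 0)
    (s : 𝕜) :
    glue P Q e m n a b s t =
      (t ^ n * (b * t) ^ m) • perturb P Q e m (a * b) (s / (b * t)) := by
  have hbt : b * t ≠ 0 := mul_ne_zero hb ht
  have h1 : P s (b * t) = (b * t) ^ m • P (s / (b * t)) 1 := by
    rw [← hP, mul_div_cancel₀ _ hbt, mul_one]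
  have h2 : Q t (a * s) = t ^ n • Q 1 (a * b * (s / (b * t))) := by
    rw [← hQ, mul_one]
    congr 1
    field_simp
  have h3 : s ^ m = (b * t) ^ m * (s / (b * t)) ^ m := by
    rw [← mul_pow, mul_div_cancel₀ _ hbt]
  simp only [glue, perturb]
  rw [h1, h2, h3]
  module

/-- The two neck coordinates have product ab: the glued curve is the image of a hyperbola in a
surface that does not depend on a and b. -/
theorem glue_eq_smul_neck (hP : ∀ c s t, P (c * s) (c * t) = c ^ m • P s t)
    (hQ : ∀ c s t, Q (c * s) (c * t) = c ^ n • Q s t) {a b s t : 𝕜} (hs : s ≠ 0) (ht : t ≠ 0) :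
    glue P Q e m n a b s t = (s ^ m * t ^ n) • neck P Q e (b * t / s) (a * s / t) := by
  have h1 : P s (b * t) = s ^ m • P 1 (b * t / s) := by
    rw [← hP, mul_div_cancel₀ _ hs, mul_one]
  have h2 : Q t (a * s) = t ^ n • Q 1 (a * s / t) := by
    rw [← hQ, mul_div_cancel₀ _ ht, mul_one]
  simp only [glue, neck]
  rw [h1, h2]
  module

theorem glue_eq_smul_perturb' (hP : ∀ c s t, P (c * s) (c * t) = c ^ m • P s t)
    (hQ : ∀ c s t, Q (c * s) (c * t) = c ^ n • Q s t) {a b s : 𝕜} (ha : a ≠ 0) (hs : s ≠ 0)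
    (t : 𝕜) :
    glue P Q e m n a b s t =
      (s ^ m * (a * s) ^ n) • perturb Q P e n (a * b) (t / (a * s)) := by
  rw [glue_swap, glue_eq_smul_perturb hQ hP ha hs, mul_comm b]

theorem glue_smul (hP : ∀ c s t, P (c * s) (c * t) = c ^ m • P s t)
    (hQ : ∀ c s t, Q (c * s) (c * t) = c ^ n • Q s t) (a b c s t : 𝕜) :
    glue P Q e m n a b (c * s) (c * t) = c ^ (m + n) • glue P Q e m n a b s t := by
  simp only [glue]
  rw [mul_left_comm a, mul_left_comm b, hP, hQ, mul_pow, mul_pow]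
  module

theorem perturb_zero (hQ : Q 1 0 = e) (w : 𝕜) : perturb P Q e m 0 w = P w 1 := by
  simp [perturb, hQ]

theorem neck_zero_right (hQ : Q 1 0 = e) (x : 𝕜) : neck P Q e x 0 = P 1 x := by
  simp [neck, hQ]

theorem neck_zero_left (hP : P 1 0 = e) (y : 𝕜) : neck P Q e 0 y = Q 1 y := by
  simp [neck, hP]

theorem neck_swap (x y : 𝕜) : neck P Q e x y = neck Q P e y x := by
  simp only [neck]
  abel

end Algebra

section Norm

variable [NormedField 𝕜]

/-- The neck coordinates are the inverses of the arm coordinates. Where neither arm coordinate is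
bounded by M, both neck coordinates are therefore below M⁻¹. -/
theorem gluing_regions {s t : 𝕜} (a b : 𝕜) (h : ¬ (s = 0 ∧ t = 0)) (M : ℝ)
    (hM : 0 < M) :
    (t ≠ 0 ∧ ‖s / (b * t)‖ ≤ M) ∨ (s ≠ 0 ∧ ‖t / (a * s)‖ ≤ M) ∨
      (s ≠ 0 ∧ t ≠ 0 ∧ ‖b * t / s‖ < M⁻¹ ∧ ‖a * s / t‖ < M⁻¹) := by
  by_cases ht : t = 0
  · subst ht
    right; left
    exact ⟨fun hs => h ⟨hs, rfl⟩, by simpa using hM.le⟩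
  by_cases hs : s = 0
  · subst hs
    left
    exact ⟨ht, by simpa using hM.le⟩
  by_cases h1 : ‖s / (b * t)‖ ≤ M
  · exact Or.inl ⟨ht, h1⟩
  by_cases h2 : ‖t / (a * s)‖ ≤ M
  · exact Or.inr (Or.inl ⟨hs, h2⟩)
  right; right
  refine ⟨hs, ht, ?_, ?_⟩
  · rw [← inv_div, norm_inv]
    exact inv_strictAnti₀ hM (not_le.1 h1)
  · rw [← inv_div, norm_inv]
    exact inv_strictAnti₀ hM (not_le.1 h2)

variable [NormedAddCommGroup V] [NormedSpace 𝕜 V] {P Q : 𝕜 → 𝕜 → V} {e : V} {m n : ℕ}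

theorem continuous_perturb (hP : Continuous fun p : 𝕜 × 𝕜 => P p.1 p.2)
    (hQ : Continuous fun p : 𝕜 × 𝕜 => Q p.1 p.2) :
    Continuous fun p : 𝕜 × 𝕜 => perturb P Q e m p.1 p.2 := by
  have h1 : Continuous fun p : 𝕜 × 𝕜 => P p.2 1 :=
    hP.comp (continuous_snd.prodMk continuous_const)
  have h2 : Continuous fun p : 𝕜 × 𝕜 => Q 1 (p.1 * p.2) :=
    hQ.comp (continuous_const.prodMk (continuous_fst.mul continuous_snd))
  exact h1.add ((continuous_snd.pow m).smul (h2.sub continuous_const))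

theorem continuous_neck (hP : Continuous fun p : 𝕜 × 𝕜 => P p.1 p.2)
    (hQ : Continuous fun p : 𝕜 × 𝕜 => Q p.1 p.2) :
    Continuous fun p : 𝕜 × 𝕜 => neck P Q e p.1 p.2 := by
  have h1 : Continuous fun p : 𝕜 × 𝕜 => P 1 p.1 :=
    hP.comp (continuous_const.prodMk continuous_fst)
  have h2 : Continuous fun p : 𝕜 × 𝕜 => Q 1 p.2 :=
    hQ.comp (continuous_const.prodMk continuous_snd)
  exact (h1.add h2).sub continuous_const

theorem eventually_perturb_ne_zero [ProperSpace 𝕜]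
    (hP : Continuous fun p : 𝕜 × 𝕜 => P p.1 p.2)
    (hQ : Continuous fun p : 𝕜 × 𝕜 => Q p.1 p.2)
    (hP₀ : ∀ s t, ¬ (s = 0 ∧ t = 0) → P s t ≠ 0) (hQe : Q 1 0 = e) (M : ℝ) :
    ∀ᶠ ε in 𝓝 (0 : 𝕜), ∀ w ∈ Metric.closedBall (0 : 𝕜) M, perturb P Q e m ε w ≠ 0 := by
  refine (isCompact_closedBall 0 M).eventually_forall_of_forall_eventually fun w _ => ?_
  refine (continuous_perturb hP hQ).continuousAt.eventually_ne ?_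
  rw [perturb_zero hQe]
  exact hP₀ _ _ (by simp)

/-- Near (0, 0) the neck is close to e ≠ 0, which fixes the cut-off δ⁻¹. On the arms up to this
cut-off the glued form is close to P or Q. The field is general because the argument is needed over
ℝ for the map to be defined and over ℂ for the last claim of the theorem. -/
theorem eventually_glue_ne_zero [ProperSpace 𝕜]
    (hP : Continuous fun p : 𝕜 × 𝕜 => P p.1 p.2)
    (hQ : Continuous fun p : 𝕜 × 𝕜 => Q p.1 p.2)
    (hPm : ∀ c s t, P (c * s) (c * t) = c ^ m • P s t)
    (hQn : ∀ c s t, Q (c * s) (c * t) = c ^ n • Q s t)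
    (hP₀ : ∀ s t, ¬ (s = 0 ∧ t = 0) → P s t ≠ 0) (hQ₀ : ∀ s t, ¬ (s = 0 ∧ t = 0) → Q s t ≠ 0)
    (hPe : P 1 0 = e) (hQe : Q 1 0 = e) :
    ∀ᶠ ε in 𝓝 (0 : 𝕜), ∀ a b : 𝕜, a ≠ 0 → b ≠ 0 → a * b = ε →
      ∀ s t, ¬ (s = 0 ∧ t = 0) → glue P Q e m n a b s t ≠ 0 := by
  have hneck : ∀ᶠ p : 𝕜 × 𝕜 in 𝓝 (0, 0), neck P Q e p.1 p.2 ≠ 0 := by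
    refine (continuous_neck hP hQ).continuousAt.eventually_ne ?_
    rw [neck_zero_left hPe]
    exact hQ₀ _ _ (by simp)
  obtain ⟨δ, hδ, hneck⟩ := Metric.eventually_nhds_iff.1 hneck
  filter_upwards [eventually_perturb_ne_zero (m := m) hP hQ hP₀ hQe δ⁻¹,
    eventually_perturb_ne_zero (m := n) hQ hP hQ₀ hPe δ⁻¹] with ε h1 h2 a b ha hb hab s t hst
  rcases gluing_regions a b hst δ⁻¹ (inv_pos.2 hδ) with ⟨ht, h⟩ | ⟨hs, h⟩ | ⟨hs, ht, hx, hy⟩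
  · rw [glue_eq_smul_perturb hPm hQn hb ht, hab]
    exact smul_ne_zero (by simp [hb, ht]) (h1 _ (by simpa using h))
  · rw [glue_eq_smul_perturb' hPm hQn ha hs, hab]
    exact smul_ne_zero (by simp [ha, hs]) (h2 _ (by simpa using h))
  · rw [glue_eq_smul_neck hPm hQn hs ht]
    refine smul_ne_zero (by simp [hs, ht]) (hneck (y := (_, _)) ?_)
    rw [inv_inv] at hx hy
    rw [Prod.dist_eq, max_lt_iff, dist_zero_right, dist_zero_right]
    exact ⟨hx, hy⟩

end Norm

end Gluing

/-- The point of a curve around which a frame is taken, the direction and the scale. -/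
structure ArmFrame where
  base : ℝ
  sign : ℝ
  scale : ℝ
  sign_eq : sign = 1 ∨ sign = -1
  scale_ne : scale ≠ 0

namespace ArmFrame

variable (f : ArmFrame)

theorem sign_mul_self : f.sign * f.sign = 1 := by
  rcases f.sign_eq with h | h <;> rw [h] <;> norm_num

theorem sign_ne : f.sign ≠ 0 := by
  rcases f.sign_eq with h | h <;> rw [h] <;> norm_num

/-- The angle with cotangent `sign * w`, seen from the base point. -/
noncomputable def angle (w : ℝ) : ℝ := f.base + f.sign * (Real.pi / 2 - Real.arctan w)

theorem sin_sign_mul (x : ℝ) : Real.sin (f.sign * x) = f.sign * Real.sin x := by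
  rcases f.sign_eq with h | h <;> simp [h]

theorem cos_sign_mul (x : ℝ) : Real.cos (f.sign * x) = Real.cos x := by
  rcases f.sign_eq with h | h <;> simp [h]

theorem hasDerivAt_angle (w : ℝ) : HasDerivAt f.angle (-f.sign / (1 + w ^ 2)) w := by
  have := (((Real.hasDerivAt_arctan w).const_sub (Real.pi / 2)).const_mul f.sign).const_add f.base
  refine this.congr_deriv ?_
  ring

theorem continuous_angle : Continuous f.angle := by
  unfold angle
  have := Real.continuous_arctan
  fun_prop

theorem circlePt_angle_ne_base (w : ℝ) : circlePt (f.angle w) ≠ circlePt f.base := by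
  rw [Ne, circlePt_eq_iff, angle, add_sub_cancel_left, sin_sign_mul, Real.sin_pi_div_two_sub]
  exact mul_ne_zero f.sign_ne (Real.cos_arctan_pos w).ne'

theorem exists_circlePt_eq_angle {θ M : ℝ}
    (h : |Real.cos (θ - f.base)| < M * |Real.sin (θ - f.base)|) :
    ∃ w, |w| < M ∧ circlePt θ = circlePt (f.angle w) := by
  have hs : Real.sin (θ - f.base) ≠ 0 := by
    intro h0
    rw [h0, abs_zero, mul_zero] at h
    exact absurd h (not_lt.2 (abs_nonneg _))
  refine ⟨f.sign * (Real.cos (θ - f.base) / Real.sin (θ - f.base)), ?_, ?_⟩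
  · rw [abs_mul, abs_div]
    have : |f.sign| = 1 := by rcases f.sign_eq with h | h <;> simp [h]
    rw [this, one_mul, div_lt_iff₀ (abs_pos.2 hs)]
    exact h
  · set w := f.sign * (Real.cos (θ - f.base) / Real.sin (θ - f.base)) with hw
    rw [circlePt_eq_iff, angle, ← sub_sub, Real.sin_sub, cos_sign_mul, sin_sign_mul,
      Real.cos_pi_div_two_sub, Real.sin_pi_div_two_sub, Real.sin_arctan, Real.cos_arctan, hw]
    have : Real.sqrt (1 + w ^ 2) ≠ 0 := by positivity
    field_simp
    ring

end ArmFrame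

namespace RationalParam

variable {d : ℕ} (k : RationalParam d) (f : ArmFrame)

/-- The form `(s, t) ↦ k(s n + t m)`, up to the scale, where `n` is the base point of the frame and
`m` is orthogonal to it. -/
noncomputable def arm (s t : ℝ) : E4 :=
  f.scale • k.evalVec ![s * Real.cos f.base - f.sign * t * Real.sin f.base,
    s * Real.sin f.base + f.sign * t * Real.cos f.base]

theorem arm_mul (c s t : ℝ) : k.arm f (c * s) (c * t) = c ^ d • k.arm f s t := by
  rw [arm, arm, smul_comm, ← evalVec_smul]
  congr 2
  ext i; fin_cases i
  · simp; ring
  · simp; ring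

theorem contDiff_arm : ContDiff ℝ ω fun p : ℝ × ℝ => k.arm f p.1 p.2 := by
  unfold arm
  have h : ContDiff ℝ ω fun p : ℝ × ℝ => (![p.1 * Real.cos f.base - f.sign * p.2 * Real.sin f.base,
      p.1 * Real.sin f.base + f.sign * p.2 * Real.cos f.base] : Fin 2 → ℝ) := ?_
  · exact (k.contDiff_evalVec.comp h).const_smul f.scale
  rw [contDiff_pi]
  intro i
  fin_cases i <;> simp <;> fun_prop

theorem arm_cos_sin (β : ℝ) :
    k.arm f (Real.cos β) (f.sign * Real.sin β) = f.scale • k.lift (f.base + β) := by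
  rw [arm, lift, Real.cos_add, Real.sin_add, ← mul_assoc, f.sign_mul_self, one_mul]
  congr 2
  ext i; fin_cases i
  · simp; ring
  · simp; ring

theorem exists_arm_eq {s t : ℝ} (h : ¬ (s = 0 ∧ t = 0)) :
    ∃ R β : ℝ, R ≠ 0 ∧ s = R * Real.cos β ∧ t = R * (f.sign * Real.sin β) ∧
      k.arm f s t = (R ^ d * f.scale) • k.lift (f.base + β) := by
  obtain ⟨R, β, hR, rfl, rfl⟩ := exists_polar h
  refine ⟨R, f.sign * β, hR, by rw [f.cos_sign_mul], ?_, ?_⟩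
  · rw [f.sin_sign_mul, ← mul_assoc f.sign, f.sign_mul_self, one_mul]
  · rw [arm_mul, mul_smul, ← arm_cos_sin, f.cos_sign_mul, f.sin_sign_mul, ← mul_assoc f.sign,
      f.sign_mul_self, one_mul]

theorem arm_ne_zero {s t : ℝ} (h : ¬ (s = 0 ∧ t = 0)) : k.arm f s t ≠ 0 := by
  obtain ⟨R, β, hR, -, -, h⟩ := k.exists_arm_eq f h
  rw [h]
  exact smul_ne_zero (mul_ne_zero (pow_ne_zero _ hR) f.scale_ne) (k.lift_ne_zero _)

theorem arm_one_right (w : ℝ) :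
    k.arm f w 1 = (f.scale * √(1 + w ^ 2) ^ d) • k.lift (f.angle w) := by
  have h0 : √(1 + w ^ 2) ≠ 0 := by positivity
  have h1 := k.arm_cos_sin f (f.sign * (Real.pi / 2 - Real.arctan w))
  rw [f.cos_sign_mul, f.sin_sign_mul, ← mul_assoc, f.sign_mul_self, one_mul,
    Real.cos_pi_div_two_sub, Real.sin_pi_div_two_sub, Real.sin_arctan, Real.cos_arctan] at h1
  rw [ArmFrame.angle, mul_comm, mul_smul, ← h1, ← arm_mul, mul_div_cancel₀ _ h0,
    mul_div_cancel₀ _ h0]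

theorem arm_one_left (x : ℝ) :
    k.arm f 1 x = (f.scale * √(1 + x ^ 2) ^ d) • k.lift (f.base + f.sign * Real.arctan x) := by
  have h0 : √(1 + x ^ 2) ≠ 0 := by positivity
  have h1 := k.arm_cos_sin f (f.sign * Real.arctan x)
  rw [f.cos_sign_mul, f.sin_sign_mul, ← mul_assoc, f.sign_mul_self, one_mul,
    Real.sin_arctan, Real.cos_arctan] at h1
  rw [mul_comm, mul_smul, ← h1, ← arm_mul, mul_div_cancel₀ _ h0, mul_div_cancel₀ _ h0]

theorem exists_hasDerivAt_scale (w : ℝ) :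
    ∃ c', HasDerivAt (fun w => f.scale * √(1 + w ^ 2) ^ d) c' w := by
  have h : DifferentiableAt ℝ (fun w => f.scale * √(1 + w ^ 2) ^ d) w := by
    refine DifferentiableAt.const_mul (DifferentiableAt.pow (DifferentiableAt.sqrt ?_ ?_) d) _
    · fun_prop
    · positivity
  exact ⟨_, h.hasDerivAt⟩

theorem scale_pow_ne_zero (w : ℝ) : f.scale * √(1 + w ^ 2) ^ d ≠ 0 :=
  mul_ne_zero f.scale_ne (pow_ne_zero _ (by positivity))

theorem exists_hasDerivAt_arm_one_right (w : ℝ) :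
    ∃ c' : ℝ, HasDerivAt (fun w => k.arm f w 1) (c' • k.lift (f.angle w) +
      (f.scale * √(1 + w ^ 2) ^ d * (-f.sign / (1 + w ^ 2))) • deriv k.lift (f.angle w)) w := by
  obtain ⟨c', hc'⟩ := exists_hasDerivAt_scale (d := d) f w
  refine ⟨c', ?_⟩
  rw [funext (k.arm_one_right f)]
  exact hasDerivAt_smul_comp (k.hasDerivAt_lift _) hc' (f.hasDerivAt_angle w)

theorem exists_hasDerivAt_arm_one_left (x : ℝ) :
    ∃ c' : ℝ, HasDerivAt (fun x => k.arm f 1 x) (c' • k.lift (f.base + f.sign * Real.arctan x) +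
      (f.scale * √(1 + x ^ 2) ^ d * (f.sign * (1 / (1 + x ^ 2)))) •
        deriv k.lift (f.base + f.sign * Real.arctan x)) x := by
  obtain ⟨c', hc'⟩ := exists_hasDerivAt_scale (d := d) f x
  refine ⟨c', ?_⟩
  rw [funext (k.arm_one_left f)]
  exact hasDerivAt_smul_comp (k.hasDerivAt_lift _) hc'
    (((Real.hasDerivAt_arctan x).const_mul f.sign).const_add f.base)

theorem submodule_pt_angle (w : ℝ) :
    (k.pt (f.angle w)).submodule = Submodule.span ℝ {k.arm f w 1} := by
  rw [submodule_pt, arm_one_right, span_singleton_smul (scale_pow_ne_zero f w)]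

theorem span_arm_one_left_zero :
    Submodule.span ℝ {k.arm f 1 0, deriv (fun x => k.arm f 1 x) 0} = k.tangentLine f.base := by
  obtain ⟨c', hc'⟩ := k.exists_hasDerivAt_arm_one_left f 0
  rw [hc'.deriv, arm_one_left]
  simp only [Real.arctan_zero, mul_zero, add_zero]
  exact span_pair_reparam _ _ (by simpa using f.scale_ne) (by simpa using ⟨f.scale_ne, f.sign_ne⟩)

/-- The analogue of `gluing_regions` for a single curve: points with w beyond the cut-off are
described by x = 1/w near p. -/
theorem exists_of_mem_image {q : RP3} (hq : q ∈ k.image) {M : ℝ} (hM : 0 < M) :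
    (∃ w, |w| ≤ M ∧ q.submodule = Submodule.span ℝ {k.arm f w 1}) ∨
      ∃ x, |x| < M⁻¹ ∧ q.submodule = Submodule.span ℝ {k.arm f 1 x} := by
  rw [image_eq_range_pt] at hq
  obtain ⟨θ, rfl⟩ := hq
  have h1 := k.arm_cos_sin f (θ - f.base)
  rw [add_sub_cancel] at h1
  rw [submodule_pt, ← span_singleton_smul f.scale_ne (k.lift θ), ← h1]
  set s := Real.cos (θ - f.base)
  set t := f.sign * Real.sin (θ - f.base)
  by_cases h : t ≠ 0 ∧ |s / t| ≤ M
  · left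
    refine ⟨s / t, h.2, ?_⟩
    rw [← span_singleton_smul (pow_ne_zero d h.1) (k.arm f _ 1), ← arm_mul, mul_one,
      mul_div_cancel₀ _ h.1]
  · right
    have hs : s ≠ 0 := by
      intro hs
      by_cases ht : t = 0
      · have ht : Real.sin (θ - f.base) = 0 := by simpa [t, f.sign_ne] using ht
        have := Real.sin_sq_add_cos_sq (θ - f.base)
        rw [ht, show Real.cos (θ - f.base) = 0 from hs] at this
        norm_num at this
      · exact h ⟨ht, by rw [hs]; simpa using hM.le⟩
    refine ⟨t / s, ?_, ?_⟩
    · by_cases ht : t = 0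
      · rw [ht]; simpa using hM
      · rw [← inv_div, abs_inv]
        exact inv_strictAnti₀ hM (not_le.1 fun h' => h ⟨ht, h'⟩)
    · rw [← span_singleton_smul (pow_ne_zero d hs) (k.arm f 1 _), ← arm_mul, mul_one,
        mul_div_cancel₀ _ hs]

theorem mem_image_of_arm {q : RP3} {s t : ℝ} (h : ¬ (s = 0 ∧ t = 0))
    (hq : q.submodule = Submodule.span ℝ {k.arm f s t}) : q ∈ k.image := by
  obtain ⟨R, β, hR, -, -, h⟩ := k.exists_arm_eq f h
  rw [image_eq_range_pt]
  refine ⟨f.base + β, ?_⟩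
  rw [← Projectivization.submodule_injective.eq_iff, hq, h, submodule_pt,
    span_singleton_smul (mul_ne_zero (pow_ne_zero _ hR) f.scale_ne)]

theorem exists_arm_of_not_lt {θ M : ℝ} (hM : 0 < M)
    (h : ¬ |Real.cos (θ - f.base)| < M * |Real.sin (θ - f.base)|) :
    ∃ x, |x| ≤ M⁻¹ ∧ (k.pt θ).submodule = Submodule.span ℝ {k.arm f 1 x} := by
  have hc : Real.cos (θ - f.base) ≠ 0 := by
    intro h0
    have h1 := Real.sin_sq_add_cos_sq (θ - f.base)
    rw [h0, abs_zero, not_lt] at h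
    have h2 : Real.sin (θ - f.base) = 0 := by
      rw [← abs_eq_zero]
      have := abs_nonneg (Real.sin (θ - f.base))
      nlinarith
    rw [h0, h2] at h1
    norm_num at h1
  refine ⟨f.sign * (Real.sin (θ - f.base) / Real.cos (θ - f.base)), ?_, ?_⟩
  · rw [abs_mul, abs_div]
    have : |f.sign| = 1 := by rcases f.sign_eq with h | h <;> simp [h]
    rw [this, one_mul, div_le_iff₀ (abs_pos.2 hc), inv_mul_eq_div, le_div_iff₀ hM, mul_comm]
    exact not_lt.1 h
  · have h1 := k.arm_cos_sin f (θ - f.base)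
    have h2 : k.arm f (Real.cos (θ - f.base)) (f.sign * Real.sin (θ - f.base)) =
        Real.cos (θ - f.base) ^ d •
          k.arm f 1 (f.sign * (Real.sin (θ - f.base) / Real.cos (θ - f.base))) := by
      rw [← arm_mul, mul_one]
      congr 1
      field_simp
    rw [submodule_pt, ← span_singleton_smul (pow_ne_zero d hc) (k.arm f 1 _), ← h2, h1,
      add_sub_cancel, span_singleton_smul f.scale_ne]

end RationalParam

namespace RealRationalKnot

variable {d : ℕ} (k : RealRationalKnot d) (f : ArmFrame)

theorem linearIndependent_arm_one_right (w : ℝ) :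
    LinearIndependent ℝ ![k.arm f w 1, deriv (fun w => k.arm f w 1) w] := by
  obtain ⟨c', hc'⟩ := k.exists_hasDerivAt_arm_one_right f w
  rw [hc'.deriv, RationalParam.arm_one_right]
  refine linearIndependent_pair_reparam (k.immersion _) (RationalParam.scale_pow_ne_zero f w)
    (mul_ne_zero (RationalParam.scale_pow_ne_zero f w) (div_ne_zero (neg_ne_zero.2 f.sign_ne) ?_))
  positivity

theorem linearIndependent_arm_one_left (x : ℝ) :
    LinearIndependent ℝ ![k.arm f 1 x, deriv (fun x => k.arm f 1 x) x] := by
  obtain ⟨c', hc'⟩ := k.exists_hasDerivAt_arm_one_left f x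
  rw [hc'.deriv, RationalParam.arm_one_left]
  refine linearIndependent_pair_reparam (k.immersion _) (RationalParam.scale_pow_ne_zero f x)
    (mul_ne_zero (RationalParam.scale_pow_ne_zero f x) (mul_ne_zero f.sign_ne ?_))
  positivity

end RealRationalKnot

end

/-! ### Perturbed curves as sections of the tube. -/

section
open Filter Topology Set

namespace RationalParam

variable {d : ℕ} (k : RationalParam d) (f : ArmFrame)

theorem inDisc_add_int_mul_pi (r θ : ℝ) (n : ℤ) (v : E4) :
    k.InDisc r (θ + n * Real.pi) v ↔ k.InDisc r θ v := by
  obtain ⟨s, hs, h0, h1, -⟩ := k.exists_unitLift_add_int_mul_pi n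
  rw [InDisc, InDisc, h0, h1]
  rcases hs with rfl | rfl <;> simp

theorem normalDisc_congr {θ θ' : ℝ} (h : circlePt θ = circlePt θ') (r : ℝ) :
    k.normalDisc r θ = k.normalDisc r θ' := by
  obtain ⟨n, rfl⟩ := exists_int_of_circlePt_eq h
  ext q
  rw [k.mem_normalDisc_iff q.submodule_eq, k.mem_normalDisc_iff q.submodule_eq,
    inDisc_add_int_mul_pi]

theorem inDisc_congr {θ θ' : ℝ} (h : circlePt θ = circlePt θ') (r : ℝ) (v : E4) :
    k.InDisc r θ v ↔ k.InDisc r θ' v := by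
  obtain ⟨n, rfl⟩ := exists_int_of_circlePt_eq h
  rw [inDisc_add_int_mul_pi]

theorem exists_arm_eq_smul_unitLift (w : ℝ) :
    ∃ c : ℝ, c ≠ 0 ∧ k.arm f w 1 = c • k.unitLift (f.angle w) := by
  refine ⟨f.scale * √(1 + w ^ 2) ^ d * ‖k.lift (f.angle w)‖,
    mul_ne_zero (scale_pow_ne_zero f w) (k.norm_lift_ne_zero _), ?_⟩
  rw [arm_one_right, ← smul_smul _ ‖k.lift (f.angle w)‖, ← lift_eq_norm_smul]

theorem inDisc_arm_self {r : ℝ} (hr : 0 < r) (w : ℝ) :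
    k.InDisc r (f.angle w) (k.arm f w 1) := by
  obtain ⟨c, hc, h⟩ := k.exists_arm_eq_smul_unitLift f w
  rw [h, k.inDisc_smul_iff hc, ← add_zero (k.unitLift _),
    k.inDisc_unitLift_add_iff (Submodule.zero_mem _), norm_zero]
  exact hr

theorem pt_mem_normalDisc {r : ℝ} (hr : 0 < r) (θ : ℝ) : k.pt θ ∈ k.normalDisc r θ := by
  rw [k.mem_normalDisc_iff (k.submodule_pt θ), lift_eq_norm_smul,
    k.inDisc_smul_iff (k.norm_lift_ne_zero θ), ← add_zero (k.unitLift _),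
    k.inDisc_unitLift_add_iff (Submodule.zero_mem _), norm_zero]
  exact hr

theorem not_inClosedDisc_of_disjoint {r R θ : ℝ} {D : Set RP3}
    (h : Disjoint (k.normalDisc R θ) D) {q : RP3} (hq : q ∈ D) {v : E4} (hv : v ≠ 0)
    (hqv : q.submodule = Submodule.span ℝ {v}) (hr : r < R) : ¬ k.InClosedDisc r θ v :=
  fun hc => Set.disjoint_left.1 h ((k.mem_normalDisc_iff hqv).2 (hc.inDisc hv hr)) hq

/-- The parameters that are far from the base point of the frame. -/
def farSet (f : ArmFrame) (M : ℝ) : Set ℝ :=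
  {θ : ℝ | |Real.cos (θ - f.base)| < M * |Real.sin (θ - f.base)|}

theorem isOpen_farSet (M : ℝ) : IsOpen (farSet f M) :=
  isOpen_lt (by fun_prop) (by fun_prop)

theorem angle_mem_farSet {w M : ℝ} (h : |w| < M) : f.angle w ∈ farSet f M := by
  have h0 : 0 < √(1 + w ^ 2) := by positivity
  have h1 : |f.sign| = 1 := by rcases f.sign_eq with h | h <;> simp [h]
  rw [farSet, mem_ofPred_eq, ArmFrame.angle, add_sub_cancel_left, f.sin_sign_mul, f.cos_sign_mul,
    Real.cos_pi_div_two_sub, Real.sin_pi_div_two_sub, Real.sin_arctan, Real.cos_arctan, abs_mul,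
    h1, one_mul, abs_div, abs_div, abs_one, abs_of_pos h0, mul_one_div]
  exact div_lt_div_of_pos_right h h0

theorem circlePt_angle_injective {w w' : ℝ} (h : circlePt (f.angle w) = circlePt (f.angle w')) :
    w = w' := by
  rw [circlePt_eq_iff, ArmFrame.angle, ArmFrame.angle, add_sub_add_left_eq_sub, ← mul_sub,
    f.sin_sign_mul, sub_sub_sub_cancel_left, mul_eq_zero, or_iff_right f.sign_ne,
    Real.sin_eq_zero_iff_of_lt_of_lt] at h
  · exact Real.arctan_injective (by linarith)
  · linarith [Real.arctan_lt_pi_div_two w, Real.neg_pi_div_two_lt_arctan w']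
  · linarith [Real.arctan_lt_pi_div_two w', Real.neg_pi_div_two_lt_arctan w]

/-- Near `θ` the curve `w ↦ φ w`, `|w| ≤ M`, meets each normal disc in exactly one point, with
exactly one parameter, and this point depends smoothly on the disc. -/
def IsSectionAt (r M : ℝ) (φ : ℝ → E4) (θ : ℝ) : Prop :=
  ∃ σ : ℝ → E4, ContDiffAt ℝ ω σ θ ∧ ∀ᶠ θ' in 𝓝 θ, ∃ w, |w| ≤ M ∧ k.InDisc r θ' (φ w) ∧
    σ θ' = k.normalPart θ' (φ w) ∧ ∀ w', |w'| ≤ M → k.InDisc r θ' (φ w') → w' = w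

theorem normalPart_add_int_mul_pi {n : ℤ} {s : ℝ} (hs : s = 1 ∨ s = -1) {θ : ℝ}
    (h : k.unitLift (θ + n * Real.pi) = s • k.unitLift θ) (v : E4) :
    k.normalPart (θ + n * Real.pi) v = s • k.normalPart θ v := by
  rw [normalPart, normalPart, h, real_inner_smul_left]
  rcases hs with rfl | rfl
  · simp
  · rw [neg_one_mul, inv_neg]
    module

variable {k} in
-- The discs over θ and θ + nπ agree, and the normal vectors differ by a sign that does not depend
-- on θ, so smoothness carries over.
theorem IsSectionAt.add_int_mul_pi {r M : ℝ} {φ : ℝ → E4} {θ : ℝ} (h : k.IsSectionAt r M φ θ)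
    (n : ℤ) : k.IsSectionAt r M φ (θ + n * Real.pi) := by
  obtain ⟨σ, hσ, h⟩ := h
  obtain ⟨s, hs, h0, -, -⟩ := k.exists_unitLift_add_int_mul_pi n
  have hsub : θ + n * Real.pi - n * Real.pi = θ := add_sub_cancel_right _ _
  refine ⟨fun θ' => s • σ (θ' - n * Real.pi), ?_, ?_⟩
  · refine ContDiffAt.const_smul s (ContDiffAt.comp _ ?_ (by fun_prop))
    rwa [hsub]
  · have ht : Tendsto (fun θ' => θ' - n * Real.pi) (𝓝 (θ + n * Real.pi)) (𝓝 θ) := by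
      have : Continuous fun θ' : ℝ => θ' - n * Real.pi := by fun_prop
      simpa using this.tendsto (θ + n * Real.pi)
    filter_upwards [ht.eventually h] with θ' h'
    have e : θ' = θ' - n * Real.pi + n * Real.pi := by ring
    obtain ⟨w, hw, h1, h2, h3⟩ := h'
    refine ⟨w, hw, ?_, ?_, ?_⟩
    · rw [e, k.inDisc_add_int_mul_pi]; exact h1
    · rw [h2]
      conv_rhs => rw [e]
      rw [k.normalPart_add_int_mul_pi hs (h0 _)]
    · intro w' hw' h'
      rw [e, k.inDisc_add_int_mul_pi] at h'
      exact h3 w' hw' h'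

theorem isSection_of_isSectionAt {r M : ℝ} {φ : ℝ → E4} {J : Set ℝ} (hJ : IsOpen J) {S : Set RP3}
    (h : ∀ θ ∈ J, k.IsSectionAt r M φ θ)
    (hS : ∀ θ ∈ J, ∀ q : RP3, (q ∈ S ∧ q ∈ k.normalDisc r θ) ↔
      ∃ w, |w| ≤ M ∧ k.InDisc r θ (φ w) ∧ q.submodule = Submodule.span ℝ {φ w}) :
    k.IsSection r J S := by
  -- The unique parameter is chosen for every θ; the value 0 outside J is never used. Uniqueness
  -- makes the choice agree with each local smooth section.
  have hw : ∀ θ, ∃ w, θ ∈ J → |w| ≤ M ∧ k.InDisc r θ (φ w) ∧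
      ∀ w', |w'| ≤ M → k.InDisc r θ (φ w') → w' = w := by
    intro θ
    by_cases hθ : θ ∈ J
    · obtain ⟨σ, -, hσ⟩ := h θ hθ
      obtain ⟨w, h1, h2, -, h3⟩ := hσ.self_of_nhds
      exact ⟨w, fun _ => ⟨h1, h2, h3⟩⟩
    · exact ⟨0, fun h => absurd h hθ⟩
  choose w hw using hw
  refine ⟨fun θ => k.normalPart θ (φ (w θ)), ?_, ?_⟩
  · intro θ hθ
    obtain ⟨σ, hσ, hev⟩ := h θ hθ
    have : (fun θ => k.normalPart θ (φ (w θ))) =ᶠ[𝓝 θ] σ := by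
      filter_upwards [hev, hJ.mem_nhds hθ] with θ' h1 hθ'
      obtain ⟨w', hw', h2, h3, h4⟩ := h1
      rw [h3, h4 _ (hw θ' hθ').1 (hw θ' hθ').2.1]
    exact ((hσ.congr_of_eventuallyEq this).of_le le_top).contDiffWithinAt
  · intro θ hθ
    obtain ⟨h1, h2, h3⟩ := hw θ hθ
    refine ⟨h2.normalPart_mem, h2.norm_normalPart_lt, fun q => ?_⟩
    rw [hS θ hθ, ← h2.span_eq]
    constructor
    · rintro ⟨w', hw', h4, h5⟩
      rw [h5, h3 w' hw' h4]
    · exact fun hq => ⟨w θ, h1, h2, hq⟩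

/-- The closed set D carries the constraint linking y to ε, such as xy = ε on the neck. By
compactness in y and w, only the limit ε = 0 has to be examined. -/
theorem eventually_not_inDisc {T : Type*} [TopologicalSpace T] {Y : Set T} (hY : IsCompact Y)
    {v : ℝ × T → E4} (hv : Continuous v) {D : Set (ℝ × T)} (hD : IsClosed D) {r M : ℝ}
    (h : ∀ y ∈ Y, (0, y) ∈ D → ∀ w ∈ Icc (-M) M, ¬ k.InClosedDisc r (f.angle w) (v (0, y))) :
    ∀ᶠ ε in 𝓝 (0 : ℝ), ∀ y ∈ Y, (ε, y) ∈ D → ∀ θ ∈ farSet f M, ¬ k.InDisc r θ (v (ε, y)) := by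
  have h1 : ∀ᶠ ε in 𝓝 (0 : ℝ), ∀ p ∈ Y ×ˢ Icc (-M) M, (ε, p.1) ∈ D →
      ¬ k.InClosedDisc r (f.angle p.2) (v (ε, p.1)) := by
    refine (hY.prod isCompact_Icc).eventually_forall_of_forall_eventually ?_
    rintro ⟨y, w⟩ ⟨hy, hw⟩
    have hc : Continuous fun z : ℝ × (T × ℝ) => (z.1, z.2.1) := by fun_prop
    have hc' : Continuous fun z : ℝ × (T × ℝ) => (f.angle z.2.2, v (z.1, z.2.1)) :=
      (f.continuous_angle.comp (continuous_snd.comp continuous_snd)).prodMk (hv.comp hc)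
    have hcl : IsClosed {z : ℝ × (T × ℝ) | (z.1, z.2.1) ∈ D ∧
        k.InClosedDisc r (f.angle z.2.2) (v (z.1, z.2.1))} :=
      (hD.preimage hc).inter ((k.isClosed_inClosedDisc r).preimage hc')
    filter_upwards [hcl.isOpen_compl.mem_nhds (x := (0, (y, w)))
      (fun hz => h y hy hz.1 w hw hz.2)] with z hz hzD hzd
    exact hz ⟨hzD, hzd⟩
  filter_upwards [h1] with ε h1 y hy hD θ hθ hd
  obtain ⟨w, hw, hwθ⟩ := f.exists_circlePt_eq_angle hθ
  rw [k.inDisc_congr hwθ] at hd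
  exact h1 (y, w) ⟨hy, abs_le.1 hw.le⟩ hD hd.inClosedDisc

end RationalParam

namespace RealRationalKnot

variable {d : ℕ} (k : RealRationalKnot d) (f : ArmFrame)

/-- Modulo the point itself, the derivative of the arm is a nonzero multiple of u'. Thus the arm
crosses its normal discs transversally. -/
theorem inner_deriv_arm_ne_zero (w : ℝ) :
    inner ℝ (deriv k.unitLift (f.angle w)) (deriv (fun w => k.arm f w 1) w) ≠ 0 := by
  obtain ⟨c', hc'⟩ := k.exists_hasDerivAt_arm_one_right f w
  obtain ⟨c, hc⟩ := k.exists_deriv_lift (f.angle w)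
  rw [hc'.deriv, hc, k.lift_eq_norm_smul (f.angle w)]
  simp only [inner_add_right, real_inner_smul_right]
  rw [real_inner_comm, k.inner_unitLift_deriv, real_inner_self_eq_norm_sq]
  have h1 := RationalParam.scale_pow_ne_zero (d := d) f w
  have h2 := k.norm_lift_ne_zero (f.angle w)
  have h3 := k.deriv_unitLift_ne_zero (f.angle w)
  have h4 : (1 + w ^ 2) ≠ 0 := by positivity
  have h5 : ‖‖k.lift (f.angle w)‖ • k.unitLift (f.angle w)‖ = ‖k.lift (f.angle w)‖ := by
    rw [← k.lift_eq_norm_smul]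
  simp only [h5, mul_zero, zero_add]
  refine mul_ne_zero (mul_ne_zero h1 (div_ne_zero (neg_ne_zero.2 f.sign_ne) h4)) ?_
  exact mul_ne_zero h2 (pow_ne_zero _ (norm_ne_zero_iff.2 h3))

variable {Φ : ℝ → ℝ → E4} (hΦ : ContDiff ℝ ω fun p : ℝ × ℝ => Φ p.1 p.2)
  (hΦ₀ : ∀ w, Φ 0 w = k.arm f w 1)

include hΦ hΦ₀

/-- By transversality, the implicit function theorem gives the parameter of the intersection with
the disc as an analytic function of (ε, θ). -/
theorem eventually_isSectionAt_angle {R r M w₀ : ℝ} (hR : k.IsTubularRadius R) (hr : 0 < r)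
    (hrR : r < R) (hw₀ : |w₀| < M) :
    ∀ᶠ z : ℝ × ℝ in 𝓝 (0, f.angle w₀), k.IsSectionAt r M (Φ z.1) z.2 := by
  have hu := k.contDiff_unitLift.continuous
  have hu' := k.contDiff_deriv_unitLift
  have hΦc := hΦ.continuous
  have hΦ3 : ContDiff ℝ ω fun p : (ℝ × ℝ) × ℝ => Φ p.1.1 p.2 :=
    hΦ.comp ((contDiff_fst.comp contDiff_fst).prodMk contDiff_snd)
  have hH : ContDiff ℝ ω fun p : (ℝ × ℝ) × ℝ => inner ℝ (deriv k.unitLift p.1.2) (Φ p.1.1 p.2) :=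
    (hu'.comp (contDiff_snd.comp contDiff_fst)).inner ℝ hΦ3
  obtain ⟨g, hg0, hg1, hg2, hg3⟩ := exists_implicit_real (x₀ := ((0, f.angle w₀) : ℝ × ℝ))
    (t₀ := w₀) (f' := inner ℝ (deriv k.unitLift (f.angle w₀)) (deriv (fun w => k.arm f w 1) w₀))
    hH.contDiffAt (by
      simp only [hΦ₀]
      exact (k.inDisc_arm_self f hr w₀).1) (by
      simp only [hΦ₀]
      have h1 := ((k.exists_hasDerivAt_arm_one_right f w₀).choose_spec).differentiableAt.hasDerivAt
      simpa using (hasDerivAt_const w₀ (deriv k.unitLift (f.angle w₀))).inner ℝ h1)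
    (k.inner_deriv_arm_ne_zero f w₀)
  have hgc := hg1.continuousAt
  have hΦg : ContinuousAt (fun z : ℝ × ℝ => Φ z.1 (g z)) (0, f.angle w₀) :=
    hΦc.continuousAt.comp (x := ((0, f.angle w₀) : ℝ × ℝ)) (f := fun z : ℝ × ℝ => (z.1, g z))
      (continuousAt_fst.prodMk hgc)
  have e1 : ∀ᶠ z : ℝ × ℝ in 𝓝 (0, f.angle w₀),
      ‖Φ z.1 (g z) - inner ℝ (k.unitLift z.2) (Φ z.1 (g z)) • k.unitLift z.2‖ <
        r * |inner ℝ (k.unitLift z.2) (Φ z.1 (g z))| := by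
    refine ContinuousAt.eventually_lt (by fun_prop) (by fun_prop) ?_
    simp only [hg0, hΦ₀]
    exact (k.inDisc_arm_self f hr w₀).2
  have e2 : ∀ᶠ z : ℝ × ℝ in 𝓝 (0, f.angle w₀), |g z| < M :=
    hgc.abs.eventually_lt continuousAt_const (by rwa [hg0])
  -- Near w₀ uniqueness comes from the implicit function. Elsewhere on [-M, M] it holds because
  -- discs of the larger radius R at different points are disjoint.
  have e3 : ∀ᶠ z : ℝ × ℝ in 𝓝 (0, f.angle w₀), ∀ w ∈ Icc (-M) M,
      k.InDisc r z.2 (Φ z.1 w) → w = g z := by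
    refine isCompact_Icc.eventually_forall_of_forall_eventually fun w _ => ?_
    by_cases hw : w = w₀
    · rw [hw]
      filter_upwards [hg3] with z hz hd using hz hd.1
    · have hcl : IsClosed {z : (ℝ × ℝ) × ℝ | k.InClosedDisc r z.1.2 (Φ z.1.1 z.2)} := by
        have : Continuous fun z : (ℝ × ℝ) × ℝ => (z.1.2, Φ z.1.1 z.2) :=
          (continuous_snd.comp continuous_fst).prodMk hΦ3.continuous
        exact (k.isClosed_inClosedDisc r).preimage this
      have hne : ¬ k.InClosedDisc r (f.angle w₀) (Φ 0 w) := by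
        rw [hΦ₀]
        refine k.not_inClosedDisc_of_disjoint (hR.2.1 (f.angle w₀) (f.angle w) fun h => hw ?_)
          (k.pt_mem_normalDisc (hr.trans hrR) (f.angle w)) (k.arm_ne_zero f (by simp))
          (k.submodule_pt_angle f w) hrR
        exact (RationalParam.circlePt_angle_injective f h).symm
      filter_upwards [hcl.isOpen_compl.mem_nhds (x := ((0, f.angle w₀), w)) hne] with z hz hd
      exact absurd hd.inClosedDisc hz
  have hall : ∀ᶠ z : ℝ × ℝ in 𝓝 (0, f.angle w₀), |g z| ≤ M ∧ k.InDisc r z.2 (Φ z.1 (g z)) ∧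
      ∀ w, |w| ≤ M → k.InDisc r z.2 (Φ z.1 w) → w = g z := by
    filter_upwards [hg2, e1, e2, e3] with z h1 h2 h3 h4
    exact ⟨h3.le, ⟨h1, h2⟩, fun w hw => h4 w (abs_le.1 hw)⟩
  -- The property is required on a neighbourhood of z, because ε is then fixed and a section over a
  -- whole interval of θ is needed.
  filter_upwards [hall.eventually_nhds, hg1.eventually (by simp)] with z hz hgz
  refine ⟨fun θ => k.normalPart θ (Φ z.1 (g (z.1, θ))), ?_, ?_⟩
  · have hgz' : ContDiffAt ℝ ω (fun θ => g (z.1, θ)) z.2 :=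
      hgz.comp (x := z.2) (f := fun θ : ℝ => (z.1, θ)) (contDiffAt_const.prodMk contDiffAt_id)
    have h1 : ContDiffAt ℝ ω (fun θ => Φ z.1 (g (z.1, θ))) z.2 :=
      hΦ.contDiffAt.comp (x := z.2) (f := fun θ : ℝ => (z.1, g (z.1, θ)))
        (contDiffAt_const.prodMk hgz')
    have h2 := k.contDiff_unitLift.contDiffAt (x := z.2)
    exact (((h2.inner ℝ h1).inv hz.self_of_nhds.2.1.inner_ne_zero).smul h1).sub h2
  · have ht : Tendsto (fun θ : ℝ => (z.1, θ)) (𝓝 z.2) (𝓝 z) :=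
      (continuous_const.prodMk continuous_id).tendsto z.2
    filter_upwards [ht.eventually hz] with θ hθ
    exact ⟨g (z.1, θ), hθ.1, hθ.2.1, rfl, hθ.2.2⟩

theorem eventually_isSectionAt {R r M M' : ℝ} (hR : k.IsTubularRadius R) (hr : 0 < r)
    (hrR : r < R) (hM : M' < M) :
    ∀ᶠ ε in 𝓝 (0 : ℝ), ∀ θ ∈ RationalParam.farSet f M', k.IsSectionAt r M (Φ ε) θ := by
  have h : ∀ᶠ ε in 𝓝 (0 : ℝ), ∀ w ∈ Icc (-M') M', k.IsSectionAt r M (Φ ε) (f.angle w) := by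
    refine isCompact_Icc.eventually_forall_of_forall_eventually fun w hw => ?_
    have ht : Tendsto (fun z : ℝ × ℝ => (z.1, f.angle z.2)) (𝓝 (0, w)) (𝓝 (0, f.angle w)) :=
      (continuous_fst.prodMk (f.continuous_angle.comp continuous_snd)).tendsto (0, w)
    exact ht.eventually (k.eventually_isSectionAt_angle f hΦ hΦ₀ hR hr hrR
      ((abs_le.2 hw).trans_lt hM))
  filter_upwards [h] with ε h θ hθ
  obtain ⟨w, hw, hwθ⟩ := f.exists_circlePt_eq_angle hθ
  obtain ⟨n, rfl⟩ := exists_int_of_circlePt_eq hwθ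
  exact (h w (abs_le.1 hw.le)).add_int_mul_pi n

theorem eventually_exists_inDisc_perturbed {r M M' : ℝ} (hr : 0 < r) (hM : M' < M) :
    ∀ᶠ ε in 𝓝 (0 : ℝ), ∀ w ∈ Icc (-M') M',
      ∃ θ ∈ RationalParam.farSet f M, k.InDisc r θ (Φ ε w) := by
  refine isCompact_Icc.eventually_forall_of_forall_eventually fun w hw => ?_
  obtain ⟨c, hc, hcw⟩ := k.exists_arm_eq_smul_unitLift f w
  have h := k.eventually_exists_inDisc (k.deriv_unitLift_ne_zero (f.angle w)) hc hr
    ((RationalParam.isOpen_farSet f M).mem_nhds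
      (RationalParam.angle_mem_farSet f ((abs_le.2 hw).trans_lt hM)))
  have ht : Tendsto (fun z : ℝ × ℝ => Φ z.1 z.2) (𝓝 (0, w)) (𝓝 (c • k.unitLift (f.angle w))) := by
    rw [← hcw, ← hΦ₀]
    exact hΦ.continuous.tendsto (0, w)
  exact ht.eventually h

end RealRationalKnot

/-- The part |w| ≤ M of the first curve is compact and does not meet the compact second curve;
independence of the unit lifts survives small normal displacements. -/
theorem exists_disjoint_normalDisc {d₁ d₂ : ℕ} (k₁ : RationalParam d₁) (k₂ : RationalParam d₂)
    (f : ArmFrame) (h : ∀ w θ, k₁.pt (f.angle w) ≠ k₂.pt θ) (M : ℝ) :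
    ∃ R > 0, ∀ θ ∈ RationalParam.farSet f M, ∀ θ',
      Disjoint (k₁.normalDisc R θ) (k₂.normalDisc R θ') := by
  have hu₁ := k₁.contDiff_unitLift.continuous
  have hu₂ := k₂.contDiff_unitLift.continuous
  have hf := f.continuous_angle
  have h1 : ∀ᶠ y : E4 × E4 in 𝓝 (0, 0), ∀ p ∈ Icc (-M) M ×ˢ Icc 0 Real.pi,
      LinearIndependent ℝ ![k₁.unitLift (f.angle p.1) + y.1, k₂.unitLift p.2 + y.2] := by
    refine (isCompact_Icc.prod isCompact_Icc).eventually_forall_of_forall_eventually ?_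
    rintro ⟨w, θ⟩ -
    refine eventually_linearIndependent_pair (X := (E4 × E4) × (ℝ × ℝ))
      (x := ((0, 0), (w, θ))) (f := fun z => k₁.unitLift (f.angle z.2.1) + z.1.1)
      (g := fun z => k₂.unitLift z.2.2 + z.1.2) (by fun_prop) (by fun_prop) ?_
    rw [add_zero, add_zero, linearIndependent_pair_iff_span_ne (k₁.unitLift_ne_zero _)
      (k₂.unitLift_ne_zero _), RationalParam.unitLift, RationalParam.unitLift,
      span_singleton_smul (inv_ne_zero (k₁.norm_lift_ne_zero _)),
      span_singleton_smul (inv_ne_zero (k₂.norm_lift_ne_zero _)), ← k₁.submodule_pt,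
      ← k₂.submodule_pt]
    exact fun h' => h w θ (Projectivization.submodule_injective h')
  obtain ⟨R, hR, h1⟩ := Metric.eventually_nhds_iff.1 h1
  refine ⟨R, hR, fun θ hθ θ' => ?_⟩
  obtain ⟨w, hw, hwθ⟩ := f.exists_circlePt_eq_angle hθ
  obtain ⟨θ₁, hθ₁, n, rfl⟩ := RealRationalKnot.exists_mem_Icc_add_int_mul_pi θ'
  rw [k₁.normalDisc_congr hwθ, k₂.normalDisc_congr (circlePt_add_int_mul_pi θ₁ n)]
  rw [Set.disjoint_left]
  rintro q ⟨y, -, hyr, hq⟩ ⟨y', -, hyr', hq'⟩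
  have h2 := h1 (y := (y, y')) (by
    rw [Prod.dist_eq, max_lt_iff, dist_zero_right, dist_zero_right]
    exact ⟨hyr, hyr'⟩) (w, θ₁) ⟨abs_le.1 hw.le, hθ₁⟩
  exact (linearIndependent_pair_iff_span_ne (h2.ne_zero 0) (h2.ne_zero 1)).1 h2 (hq.symm.trans hq')

end

/-! ### Cube coordinates around the common point. -/

section
open Filter Topology Set

/-- Coordinates around a common point of two affine curves `P(1, x)`, `Q(1, y)`: the first two
coordinates describe a surface through the curves, the third one is a transverse direction. -/
noncomputable def cubeMap (P Q : ℝ → ℝ → E4) (e h : E4) (z : Fin 3 → ℝ) : E4 :=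
  neck P Q e (z 0) (z 1) + z 2 • h

section Chart

variable {P Q : ℝ → ℝ → E4} {e h : E4}

theorem contDiff_cubeMap (hP : ContDiff ℝ ω fun p : ℝ × ℝ => P p.1 p.2)
    (hQ : ContDiff ℝ ω fun p : ℝ × ℝ => Q p.1 p.2) : ContDiff ℝ ω (cubeMap P Q e h) := by
  have h1 : ContDiff ℝ ω fun z : Fin 3 → ℝ => P 1 (z 0) :=
    hP.comp (contDiff_const.prodMk (contDiff_apply ℝ ℝ 0))
  have h2 : ContDiff ℝ ω fun z : Fin 3 → ℝ => Q 1 (z 1) :=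
    hQ.comp (contDiff_const.prodMk (contDiff_apply ℝ ℝ 1))
  exact ((h1.add h2).sub contDiff_const).add ((contDiff_apply ℝ ℝ 2).smul contDiff_const)

theorem contDiff_one_left (hP : ContDiff ℝ ω fun p : ℝ × ℝ => P p.1 p.2) :
    ContDiff ℝ ω fun x => P 1 x :=
  hP.comp (contDiff_const.prodMk contDiff_id)

theorem continuous_deriv_one_left (hP : ContDiff ℝ ω fun p : ℝ × ℝ => P p.1 p.2) :
    Continuous (deriv fun x => P 1 x) :=
  (contDiff_one_left hP).continuous_deriv (by simp)

/-- The differential of `cubeMap`. -/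
noncomputable def cubeDeriv (P Q : ℝ → ℝ → E4) (h : E4) (z : Fin 3 → ℝ) :
    (Fin 3 → ℝ) →L[ℝ] E4 :=
  (ContinuousLinearMap.proj (R := ℝ) (φ := fun _ : Fin 3 => ℝ) 0).smulRight
      (deriv (fun x => P 1 x) (z 0)) +
    (ContinuousLinearMap.proj (R := ℝ) (φ := fun _ : Fin 3 => ℝ) 1).smulRight
      (deriv (fun x => Q 1 x) (z 1)) +
    (ContinuousLinearMap.proj (R := ℝ) (φ := fun _ : Fin 3 => ℝ) 2).smulRight h

theorem cubeDeriv_apply (z v : Fin 3 → ℝ) :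
    cubeDeriv P Q h z v = v 0 • deriv (fun x => P 1 x) (z 0) +
      v 1 • deriv (fun x => Q 1 x) (z 1) + v 2 • h := rfl

theorem hasFDerivAt_cubeMap (hP : ContDiff ℝ ω fun p : ℝ × ℝ => P p.1 p.2)
    (hQ : ContDiff ℝ ω fun p : ℝ × ℝ => Q p.1 p.2) (z : Fin 3 → ℝ) :
    HasFDerivAt (cubeMap P Q e h) (cubeDeriv P Q h z) z := by
  have hp : ∀ i : Fin 3, HasFDerivAt (fun z : Fin 3 → ℝ => z i)
      (ContinuousLinearMap.proj (R := ℝ) (φ := fun _ : Fin 3 => ℝ) i) z :=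
    fun i => hasFDerivAt_apply i z
  have h1 : HasFDerivAt (fun z : Fin 3 → ℝ => P 1 (z 0)) _ z :=
    (((contDiff_one_left hP).differentiable (by simp) (z 0)).hasDerivAt.hasFDerivAt).comp z (hp 0)
  have h2 : HasFDerivAt (fun z : Fin 3 → ℝ => Q 1 (z 1)) _ z :=
    (((contDiff_one_left hQ).differentiable (by simp) (z 1)).hasDerivAt.hasFDerivAt).comp z (hp 1)
  have h3 : HasFDerivAt (fun z : Fin 3 → ℝ => z 2 • h) _ z := (hp 2).smul_const h
  refine (((h1.add h2).sub_const e).add h3).congr_fderiv ?_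
  refine ContinuousLinearMap.ext fun v => ?_
  rw [cubeDeriv_apply]
  simp

/-- The frame formed by the values and the partial derivatives of `cubeMap`. -/
noncomputable def cubeFrame (P Q : ℝ → ℝ → E4) (e h : E4) (z : Fin 3 → ℝ) : Fin 4 → E4 :=
  ![cubeMap P Q e h z, deriv (fun x => P 1 x) (z 0), deriv (fun x => Q 1 x) (z 1), h]

theorem eq_zero_of_cubeFrame {z v : Fin 3 → ℝ} {c : ℝ}
    (hli : LinearIndependent ℝ (cubeFrame P Q e h z))
    (h0 : c • cubeMap P Q e h z + cubeDeriv P Q h z v = 0) : c = 0 ∧ v = 0 := by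
  rw [Fintype.linearIndependent_iff] at hli
  have := hli ![c, v 0, v 1, v 2] (by
    rw [← h0, cubeDeriv_apply]
    simp [Fin.sum_univ_four, cubeFrame]
    abel)
  refine ⟨by simpa using this 0, ?_⟩
  ext i
  fin_cases i
  · simpa using this 1
  · simpa using this 2
  · simpa using this 3

theorem eventually_linearIndependent_cubeFrame
    (hP : ContDiff ℝ ω fun p : ℝ × ℝ => P p.1 p.2) (hQ : ContDiff ℝ ω fun p : ℝ × ℝ => Q p.1 p.2)
    (hli : LinearIndependent ℝ (cubeFrame P Q e h 0)) :
    ∀ᶠ z in 𝓝 0, LinearIndependent ℝ (cubeFrame P Q e h z) := by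
  have hc : Continuous (cubeFrame P Q e h) := by
    refine continuous_pi fun i => ?_
    fin_cases i
    · exact (contDiff_cubeMap hP hQ).continuous
    · exact (continuous_deriv_one_left hP).comp (continuous_apply 0)
    · exact (continuous_deriv_one_left hQ).comp (continuous_apply 1)
    · exact continuous_const
  exact hc.continuousAt.eventually hli.eventually

theorem cubeMap_zero (hP : P 1 0 = e) (hQ : Q 1 0 = e) : cubeMap P Q e h 0 = e := by
  simp [cubeMap, neck, hP, hQ]

theorem exists_linearIndependent_cubeFrame (hPe : P 1 0 = e) (hQe : Q 1 0 = e)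
    (hli : LinearIndependent ℝ ![e, deriv (fun x => P 1 x) 0, deriv (fun x => Q 1 x) 0]) :
    ∃ h, LinearIndependent ℝ (cubeFrame P Q e h 0) := by
  obtain ⟨h, hh⟩ := exists_linearIndependent_snoc_of_lt_finrank (R := ℝ) hli (by simp)
  refine ⟨h, ?_⟩
  have : cubeFrame P Q e h 0 =
      Fin.snoc ![e, deriv (fun x => P 1 x) 0, deriv (fun x => Q 1 x) 0] h := by
    rw [cubeFrame, cubeMap_zero hPe hQe]
    ext i : 1
    fin_cases i <;> rfl
  rw [this]
  exact hh

/-- The inverse function theorem applies to (c, z) ↦ c X(z) at (1, 0), a map between spaces of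
dimension four whose differential is given by the frame. -/
theorem eventually_injective_cubeMap
    (hP : ContDiff ℝ ω fun p : ℝ × ℝ => P p.1 p.2) (hQ : ContDiff ℝ ω fun p : ℝ × ℝ => Q p.1 p.2)
    (hPe : P 1 0 = e) (hQe : Q 1 0 = e)
    (hli : LinearIndependent ℝ (cubeFrame P Q e h 0)) :
    ∀ᶠ p : (Fin 3 → ℝ) × (Fin 3 → ℝ) in 𝓝 (0, 0), ∀ c : ℝ,
      c • cubeMap P Q e h p.2 = cubeMap P Q e h p.1 → p.1 = p.2 := by
  have hX := contDiff_cubeMap (e := e) (h := h) hP hQ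
  have hXc := hX.continuous
  have he : e ≠ 0 := by
    have := hli.ne_zero 0
    rwa [cubeFrame, Matrix.cons_val_zero, cubeMap_zero hPe hQe] at this
  let Ψ : ℝ × (Fin 3 → ℝ) → E4 := fun p => p.1 • cubeMap P Q e h p.2
  have hΨ : ContDiff ℝ ω Ψ := contDiff_fst.smul (hX.comp contDiff_snd)
  have hs := hΨ.contDiffAt.hasStrictFDerivAt (x := (1, 0)) (by simp)
  have hd : ∀ v : ℝ × (Fin 3 → ℝ), fderiv ℝ Ψ (1, 0) v =
      v.1 • cubeMap P Q e h 0 + cubeDeriv P Q h 0 v.2 := by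
    intro v
    have h1 := (hasFDerivAt_fst (𝕜 := ℝ) (p := ((1, 0) : ℝ × (Fin 3 → ℝ)))).smul
      ((hasFDerivAt_cubeMap (e := e) (h := h) hP hQ (0 : Fin 3 → ℝ)).comp
        ((1, 0) : ℝ × (Fin 3 → ℝ)) hasFDerivAt_snd)
    change HasFDerivAt Ψ _ _ at h1
    rw [h1.fderiv]
    simp
    abel
  have hinj : Function.Injective (fderiv ℝ Ψ (1, 0)) := by
    rw [injective_iff_map_eq_zero]
    intro v hv
    rw [hd] at hv
    obtain ⟨h1, h2⟩ := eq_zero_of_cubeFrame hli hv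
    exact Prod.ext h1 h2
  let L : (ℝ × (Fin 3 → ℝ)) ≃L[ℝ] E4 :=
    (LinearEquiv.ofInjectiveOfFinrankEq (fderiv ℝ Ψ (1, 0)).toLinearMap hinj
      (by simp)).toContinuousLinearEquiv
  have hL : (L : (ℝ × (Fin 3 → ℝ)) →L[ℝ] E4) = fderiv ℝ Ψ (1, 0) := by
    exact ContinuousLinearMap.ext fun v => rfl
  rw [← hL] at hs
  have hinv := hs.eventually_left_inverse
  have hin : ContinuousAt (fun p : (Fin 3 → ℝ) × (Fin 3 → ℝ) => inner ℝ e (cubeMap P Q e h p.2))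
      (0, 0) := by fun_prop
  have hin' : ContinuousAt (fun p : (Fin 3 → ℝ) × (Fin 3 → ℝ) => inner ℝ e (cubeMap P Q e h p.1))
      (0, 0) := by fun_prop
  have hne : inner ℝ e (cubeMap P Q e h 0) ≠ (0 : ℝ) := by
    rw [cubeMap_zero hPe hQe]
    simpa using he
  -- The scalar c is arbitrary a priori. Pairing with e expresses it as a quotient that tends to 1,
  -- so (c, z) enters the domain of the local inverse.
  have t1 : Tendsto (fun p : (Fin 3 → ℝ) × (Fin 3 → ℝ) =>
      (inner ℝ e (cubeMap P Q e h p.1) / inner ℝ e (cubeMap P Q e h p.2), p.2)) (𝓝 (0, 0))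
      (𝓝 ((1 : ℝ), (0 : Fin 3 → ℝ))) := by
    have := (hin'.div hin hne).prodMk (continuousAt_snd (p := ((0 : Fin 3 → ℝ), (0 : Fin 3 → ℝ))))
    rw [ContinuousAt] at this
    have h1 : (1 : ℝ) = inner ℝ e (cubeMap P Q e h 0) / inner ℝ e (cubeMap P Q e h 0) :=
      (div_self hne).symm
    rw [h1]
    exact this
  have t2 : Tendsto (fun p : (Fin 3 → ℝ) × (Fin 3 → ℝ) => ((1 : ℝ), p.1)) (𝓝 (0, 0))
      (𝓝 ((1 : ℝ), (0 : Fin 3 → ℝ))) :=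
    (continuous_const.prodMk continuous_fst).tendsto _
  filter_upwards [t1.eventually hinv, t2.eventually hinv, hin.eventually_ne hne] with
    p h1 h2 h3 c hc
  have hcv : c = inner ℝ e (cubeMap P Q e h p.1) / inner ℝ e (cubeMap P Q e h p.2) := by
    rw [eq_div_iff h3, ← hc, real_inner_smul_right]
  rw [← hcv] at h1
  have h4 : Ψ (c, p.2) = Ψ (1, p.1) := by simp only [Ψ]; rw [hc, one_smul]
  rw [h4, h2] at h1
  exact congrArg Prod.snd h1

theorem isCoordinateCube_cubeMap
    (hP : ContDiff ℝ ω fun p : ℝ × ℝ => P p.1 p.2) (hQ : ContDiff ℝ ω fun p : ℝ × ℝ => Q p.1 p.2)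
    {δ η : ℝ} (hη : 0 < η) (hηδ : η < δ)
    (hframe : ∀ z : Fin 3 → ℝ, ‖z‖ < δ → LinearIndependent ℝ (cubeFrame P Q e h z))
    (hinj : ∀ z w : Fin 3 → ℝ, ‖z‖ < δ → ‖w‖ < δ → ∀ c : ℝ,
      c • cubeMap P Q e h w = cubeMap P Q e h z → z = w) :
    IsCoordinateCube {q | ∃ z ∈ openCube, q.submodule = Submodule.span ℝ {cubeMap P Q e h (η • z)}}
      (fun z => cubeMap P Q e h (η • z)) := by
  have hnorm : ∀ z ∈ openCube, ‖η • z‖ < δ := by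
    intro z hz
    rw [norm_smul, Real.norm_eq_abs, abs_of_pos hη]
    have : ‖z‖ < 1 := (pi_norm_lt_iff one_pos).2 hz
    nlinarith
  refine ⟨?_, ?_, ?_, rfl⟩
  · exact (((contDiff_cubeMap hP hQ).comp (contDiff_const_smul η)).of_le le_top).contDiffOn
  · intro z hz c v hv
    have hd : HasFDerivAt (fun z => cubeMap P Q e h (η • z))
        ((cubeDeriv P Q h (η • z)).comp (η • ContinuousLinearMap.id ℝ (Fin 3 → ℝ))) z :=
      (hasFDerivAt_cubeMap hP hQ (η • z)).comp z ((hasFDerivAt_id z).const_smul η)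
    rw [hd.fderiv] at hv
    obtain ⟨h1, h2⟩ := eq_zero_of_cubeFrame (hframe _ (hnorm z hz)) hv
    refine ⟨h1, ?_⟩
    simpa [hη.ne'] using h2
  · intro z hz w hw hs
    obtain ⟨c, -, hc⟩ := span_singleton_eq_iff.1 hs
    exact smul_right_injective _ hη.ne' (hinj _ _ (hnorm z hz) (hnorm w hw) c hc)

end Chart

end

/-! ### The glued curve as a polynomial map, and comparison of velocities. -/

section
open Filter Topology Set

theorem MvPolynomial.IsHomogeneous.aeval_mul_left {S σ : Type*} [CommRing S] [Algebra ℝ S]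
    {φ : MvPolynomial σ ℝ} {d : ℕ} (hφ : φ.IsHomogeneous d) (c : S) (v : σ → S) :
    MvPolynomial.aeval (fun i => c * v i) φ = c ^ d * MvPolynomial.aeval v φ := by
  rw [MvPolynomial.aeval_def, MvPolynomial.aeval_def, MvPolynomial.eval₂_eq,
    MvPolynomial.eval₂_eq, Finset.mul_sum]
  refine Finset.sum_congr rfl fun m hm => ?_
  have hd : ∑ i ∈ m.support, m i = d := by
    rw [← Finsupp.degree_apply, Finsupp.degree_eq_weight_one]
    exact hφ (MvPolynomial.mem_support_iff.mp hm)
  simp only [mul_pow, Finset.prod_mul_distrib]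
  rw [Finset.prod_pow_eq_pow_sum, hd]
  ring

section Forms

variable {d : ℕ}

/-- The form `φ` in the coordinates given by a frame. -/
noncomputable def framePoly (f : ArmFrame) (φ : MvPolynomial (Fin 2) ℝ) : MvPolynomial (Fin 2) ℝ :=
  MvPolynomial.C f.scale * MvPolynomial.aeval
    ![MvPolynomial.C (Real.cos f.base) * MvPolynomial.X 0 -
        MvPolynomial.C (f.sign * Real.sin f.base) * MvPolynomial.X 1,
      MvPolynomial.C (Real.sin f.base) * MvPolynomial.X 0 +
        MvPolynomial.C (f.sign * Real.cos f.base) * MvPolynomial.X 1] φ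

theorem isHomogeneous_framePoly (f : ArmFrame) {φ : MvPolynomial (Fin 2) ℝ}
    (hφ : φ.IsHomogeneous d) : (framePoly f φ).IsHomogeneous d := by
  have h := hφ.aeval (n := 1)
    (![MvPolynomial.C (Real.cos f.base) * MvPolynomial.X 0 -
        MvPolynomial.C (f.sign * Real.sin f.base) * MvPolynomial.X 1,
      MvPolynomial.C (Real.sin f.base) * MvPolynomial.X 0 +
        MvPolynomial.C (f.sign * Real.cos f.base) * MvPolynomial.X 1] :
      Fin 2 → MvPolynomial (Fin 2) ℝ) (by
      intro i
      fin_cases i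
      · exact (MvPolynomial.isHomogeneous_C_mul_X _ _).sub (MvPolynomial.isHomogeneous_C_mul_X _ _)
      · exact (MvPolynomial.isHomogeneous_C_mul_X _ _).add (MvPolynomial.isHomogeneous_C_mul_X _ _))
  rw [one_mul] at h
  exact h.C_mul _

theorem aeval_framePoly {S : Type*} [CommRing S] [Algebra ℝ S] (f : ArmFrame)
    (φ : MvPolynomial (Fin 2) ℝ) (s t : S) :
    MvPolynomial.aeval ![s, t] (framePoly f φ) = algebraMap ℝ S f.scale * MvPolynomial.aeval
      ![algebraMap ℝ S (Real.cos f.base) * s - algebraMap ℝ S (f.sign * Real.sin f.base) * t,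
        algebraMap ℝ S (Real.sin f.base) * s + algebraMap ℝ S (f.sign * Real.cos f.base) * t] φ := by
  rw [framePoly, map_mul, MvPolynomial.aeval_C, ← AlgHom.comp_apply, MvPolynomial.comp_aeval]
  congr 3
  ext i
  fin_cases i <;> simp

/-- The gluing of two forms, as a polynomial. -/
noncomputable def gluePoly (P Q : MvPolynomial (Fin 2) ℝ) (e : ℝ) (m n : ℕ) (a b : ℝ) :
    MvPolynomial (Fin 2) ℝ :=
  MvPolynomial.X 0 ^ m *
      MvPolynomial.aeval ![MvPolynomial.X 1, MvPolynomial.C a * MvPolynomial.X 0] Q +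
    MvPolynomial.X 1 ^ n *
      (MvPolynomial.aeval ![MvPolynomial.X 0, MvPolynomial.C b * MvPolynomial.X 1] P -
        MvPolynomial.C e * MvPolynomial.X 0 ^ m)

theorem isHomogeneous_gluePoly {P Q : MvPolynomial (Fin 2) ℝ} {m n : ℕ} (hP : P.IsHomogeneous m)
    (hQ : Q.IsHomogeneous n) (e a b : ℝ) : (gluePoly P Q e m n a b).IsHomogeneous (m + n) := by
  have h1 := hQ.aeval (n := 1) (![MvPolynomial.X 1, MvPolynomial.C a * MvPolynomial.X 0] :
    Fin 2 → MvPolynomial (Fin 2) ℝ) (by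
    intro i
    fin_cases i
    · exact MvPolynomial.isHomogeneous_X ℝ (1 : Fin 2)
    · exact MvPolynomial.isHomogeneous_C_mul_X a (0 : Fin 2))
  have h2 := hP.aeval (n := 1) (![MvPolynomial.X 0, MvPolynomial.C b * MvPolynomial.X 1] :
    Fin 2 → MvPolynomial (Fin 2) ℝ) (by
    intro i
    fin_cases i
    · exact MvPolynomial.isHomogeneous_X ℝ (0 : Fin 2)
    · exact MvPolynomial.isHomogeneous_C_mul_X b (1 : Fin 2))
  rw [one_mul] at h1 h2
  refine ((MvPolynomial.isHomogeneous_X_pow _ _).mul h1).add ?_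
  rw [add_comm m n]
  exact (MvPolynomial.isHomogeneous_X_pow _ _).mul
    (h2.sub (MvPolynomial.isHomogeneous_C_mul_X_pow _ _ _))

theorem aeval_gluePoly {S : Type*} [CommRing S] [Algebra ℝ S] (P Q : MvPolynomial (Fin 2) ℝ)
    (e : ℝ) (m n : ℕ) (a b : ℝ) (s t : S) :
    MvPolynomial.aeval ![s, t] (gluePoly P Q e m n a b) =
      s ^ m * MvPolynomial.aeval ![t, algebraMap ℝ S a * s] Q +
        t ^ n * (MvPolynomial.aeval ![s, algebraMap ℝ S b * t] P - s ^ m * algebraMap ℝ S e) := by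
  have h1 : ∀ (φ : MvPolynomial (Fin 2) ℝ) (g : Fin 2 → MvPolynomial (Fin 2) ℝ),
      MvPolynomial.aeval ![s, t] (MvPolynomial.aeval g φ) =
        MvPolynomial.aeval (fun i => MvPolynomial.aeval ![s, t] (g i)) φ := by
    intro φ g
    rw [← AlgHom.comp_apply, MvPolynomial.comp_aeval]
  have h2 : (fun i => MvPolynomial.aeval ![s, t]
      ((![MvPolynomial.X 1, MvPolynomial.C a * MvPolynomial.X 0] :
        Fin 2 → MvPolynomial (Fin 2) ℝ) i)) = ![t, algebraMap ℝ S a * s] := by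
    ext i; fin_cases i <;> simp
  have h3 : (fun i => MvPolynomial.aeval ![s, t]
      ((![MvPolynomial.X 0, MvPolynomial.C b * MvPolynomial.X 1] :
        Fin 2 → MvPolynomial (Fin 2) ℝ) i)) = ![s, algebraMap ℝ S b * t] := by
    ext i; fin_cases i <;> simp
  simp only [gluePoly, map_add, map_mul, map_sub, map_pow, h1, h2, h3, MvPolynomial.aeval_X,
    MvPolynomial.aeval_C]
  simp only [Matrix.cons_val_zero, Matrix.cons_val_one]
  ring

end Forms

namespace RationalParam

variable {d : ℕ} (k : RationalParam d) (f : ArmFrame)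

theorem arm_apply (s t : ℝ) (i : Fin 4) :
    k.arm f s t i = MvPolynomial.aeval ![s, t] (framePoly f (k.poly i)) := by
  rw [aeval_framePoly, arm]
  simp only [evalVec, PiLp.smul_apply, smul_eq_mul, Algebra.algebraMap_self_apply]
  congr 3
  ext i; fin_cases i <;> simp <;> ring

/-- The arm over an extension of the real numbers. -/
noncomputable def scalarArm (𝕜 : Type*) [CommRing 𝕜] [Algebra ℝ 𝕜] (s t : 𝕜) : Fin 4 → 𝕜 :=
  fun i => MvPolynomial.aeval ![s, t] (framePoly f (k.poly i))

theorem scalarArm_mul (𝕜 : Type*) [CommRing 𝕜] [Algebra ℝ 𝕜] (c s t : 𝕜) :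
    k.scalarArm f 𝕜 (c * s) (c * t) = c ^ d • k.scalarArm f 𝕜 s t := by
  ext i
  simp only [scalarArm, Pi.smul_apply, smul_eq_mul]
  rw [← (isHomogeneous_framePoly f (k.homogeneous i)).aeval_mul_left]
  congr 2
  ext i; fin_cases i <;> simp

theorem scalarArm_one_zero (𝕜 : Type*) [CommRing 𝕜] [Algebra ℝ 𝕜] :
    k.scalarArm f 𝕜 1 0 = fun i => algebraMap ℝ 𝕜 (k.arm f 1 0 i) := by
  ext i
  have h : (![1, 0] : Fin 2 → 𝕜) = algebraMap ℝ 𝕜 ∘ (![1, 0] : Fin 2 → ℝ) := by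
    ext i; fin_cases i <;> simp
  rw [scalarArm, arm_apply, h, MvPolynomial.aeval_algebraMap_apply]

theorem continuous_scalarArm :
    Continuous fun p : ℂ × ℂ => k.scalarArm f ℂ p.1 p.2 := by
  refine continuous_pi fun i => ?_
  have h := MvPolynomial.continuous_eval
    (MvPolynomial.map (algebraMap ℝ ℂ) (framePoly f (k.poly i)))
  have h2 : Continuous fun p : ℂ × ℂ => (![p.1, p.2] : Fin 2 → ℂ) := by
    refine continuous_pi fun i => ?_
    fin_cases i
    · exact continuous_fst
    · exact continuous_snd
  have h3 := h.comp h2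
  simp only [scalarArm, MvPolynomial.aeval_def, ← MvPolynomial.eval_map]
  exact h3

theorem scalarArm_ne_zero (h : k.NoComplexZero) {s t : ℂ} (hst : ¬ (s = 0 ∧ t = 0)) :
    k.scalarArm f ℂ s t ≠ 0 := by
  intro h0
  have hcs : ((Real.sin f.base : ℝ) : ℂ) ^ 2 + ((Real.cos f.base : ℝ) : ℂ) ^ 2 = 1 := by
    exact_mod_cast Real.sin_sq_add_cos_sq f.base
  have hss : (f.sign : ℂ) * f.sign = 1 := by exact_mod_cast f.sign_mul_self
  obtain ⟨i, hi⟩ := h ![((Real.cos f.base : ℝ) : ℂ) * s - ((f.sign * Real.sin f.base : ℝ) : ℂ) * t,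
    ((Real.sin f.base : ℝ) : ℂ) * s + ((f.sign * Real.cos f.base : ℝ) : ℂ) * t] (by
      intro hz
      have e0 := congrFun hz 0
      have e1 := congrFun hz 1
      simp only [Matrix.cons_val_zero, Matrix.cons_val_one, Pi.zero_apply] at e0 e1
      push_cast at e0 e1 hcs
      apply hst
      constructor
      -- The frame matrix is orthogonal; its transpose recovers s and t from their images.
      · linear_combination (Complex.cos f.base) * e0 + (Complex.sin f.base) * e1 - s * hcs
      · linear_combination (-(f.sign : ℂ) * Complex.sin f.base) * e0 +
          (f.sign * Complex.cos f.base) * e1 - t * hcs - t * (Complex.sin f.base ^ 2 +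
          Complex.cos f.base ^ 2) * (hss))
  apply hi
  have := congrFun h0 i
  rw [scalarArm, aeval_framePoly] at this
  have hne : (algebraMap ℝ ℂ) f.scale ≠ 0 := by simpa using f.scale_ne
  exact (mul_eq_zero.1 this).resolve_left hne

end RationalParam

section GluedParam

variable {d₁ d₂ : ℕ} (k₁ : RationalParam d₁) (k₂ : RationalParam d₂) (f₁ f₂ : ArmFrame)

/-- The gluing of two arms. -/
noncomputable def glueArm (a b s t : ℝ) : E4 :=
  glue (k₁.arm f₁) (k₂.arm f₂) (k₁.arm f₁ 1 0) d₁ d₂ a b s t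

theorem glueArm_apply (a b s t : ℝ) (i : Fin 4) :
    glueArm k₁ k₂ f₁ f₂ a b s t i = MvPolynomial.aeval ![s, t]
      (gluePoly (framePoly f₁ (k₁.poly i)) (framePoly f₂ (k₂.poly i)) (k₁.arm f₁ 1 0 i) d₁ d₂
        a b) := by
  rw [aeval_gluePoly, ← k₁.arm_apply, ← k₂.arm_apply]
  simp [glueArm, glue]

/-- The rational map obtained by gluing two arms. -/
noncomputable def gluedParam (a b : ℝ)
    (h : ∀ s t, ¬ (s = 0 ∧ t = 0) → glueArm k₁ k₂ f₁ f₂ a b s t ≠ 0) :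
    RationalParam (d₁ + d₂) where
  poly i := gluePoly (framePoly f₁ (k₁.poly i)) (framePoly f₂ (k₂.poly i)) (k₁.arm f₁ 1 0 i)
    d₁ d₂ a b
  homogeneous i := isHomogeneous_gluePoly (isHomogeneous_framePoly f₁ (k₁.homogeneous i))
    (isHomogeneous_framePoly f₂ (k₂.homogeneous i)) _ _ _
  no_common_zero v hv := by
    have h1 := h (v 0) (v 1) (by
      rintro ⟨h0, h1⟩
      exact hv (by ext i; fin_cases i <;> simp [h0, h1]))
    by_contra! h2
    apply h1
    ext i
    rw [glueArm_apply, MvPolynomial.aeval_eq_eval]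
    have hvv : ![v 0, v 1] = v := by ext i; fin_cases i <;> rfl
    rw [hvv]
    exact h2 i

variable {k₁ k₂ f₁ f₂} {a b : ℝ}
  (h : ∀ s t, ¬ (s = 0 ∧ t = 0) → glueArm k₁ k₂ f₁ f₂ a b s t ≠ 0)

theorem gluedParam_evalVec (s t : ℝ) :
    (gluedParam k₁ k₂ f₁ f₂ a b h).evalVec ![s, t] = glueArm k₁ k₂ f₁ f₂ a b s t := by
  ext i
  rw [glueArm_apply, MvPolynomial.aeval_eq_eval]
  rfl

theorem gluedParam_lift (θ : ℝ) :
    (gluedParam k₁ k₂ f₁ f₂ a b h).lift θ =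
      glueArm k₁ k₂ f₁ f₂ a b (Real.cos θ) (Real.sin θ) :=
  gluedParam_evalVec h _ _

theorem gluedParam_noComplexZero
    (hC : ∀ s t : ℂ, ¬ (s = 0 ∧ t = 0) →
      glue (k₁.scalarArm f₁ ℂ) (k₂.scalarArm f₂ ℂ) (k₁.scalarArm f₁ ℂ 1 0) d₁ d₂ a b s t ≠ 0) :
    (gluedParam k₁ k₂ f₁ f₂ a b h).NoComplexZero := by
  intro z hz
  have h1 := hC (z 0) (z 1) (by
    rintro ⟨h0, h1⟩
    exact hz (by ext i; fin_cases i <;> simp [h0, h1]))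
  by_contra! h2
  apply h1
  ext i
  have h3 := h2 i
  have hzz : z = ![z 0, z 1] := by ext i; fin_cases i <;> rfl
  rw [hzz, gluedParam, aeval_gluePoly] at h3
  rw [k₁.scalarArm_one_zero]
  simpa [glue, RationalParam.scalarArm] using h3

end GluedParam

/-- Derivatives of unit lifts are orthogonal to the lifts, so the component m' along the point
disappears. Normalization turns the factor m into its sign, and c remains. -/
theorem hasVelocityRatio_of_lift {d d' : ℕ} {k : RationalParam d} {k' : RationalParam d'}
    {ψ φ m m' c : ℝ} (hm : m ≠ 0) (hc : c ≠ 0) (h0 : k.lift ψ = m • k'.lift φ)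
    (h1 : deriv k.lift ψ = m' • k'.lift φ + (m * c) • deriv k'.lift φ) :
    HasVelocityRatio k ψ k' φ c := by
  have ham : |m| ≠ 0 := abs_ne_zero.2 hm
  have hl' := k'.norm_lift_ne_zero φ
  have hu : k.unitLift ψ = (m / |m|) • k'.unitLift φ := by
    rw [RationalParam.unitLift, RationalParam.unitLift, h0, norm_smul, smul_smul, smul_smul,
      Real.norm_eq_abs]
    congr 1
    field_simp
  have hmm : m / |m| = 1 ∨ m / |m| = -1 := by
    rcases lt_or_gt_of_ne hm with h | h
    · right; rw [abs_of_neg h, div_neg, div_self hm]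
    · left; rw [abs_of_pos h, div_self hm]
  refine ⟨?_, ?_, m / |m|, hmm, hu, ?_⟩
  · rw [← Projectivization.submodule_injective.eq_iff, RationalParam.submodule_pt,
      RationalParam.submodule_pt, h0, span_singleton_smul hm]
  · rw [RationalParam.tangentLine, h0, h1, span_pair_reparam _ _ hm (mul_ne_zero hm hc)]
    rfl
  · obtain ⟨g, hg⟩ := k.exists_deriv_lift ψ
    obtain ⟨g', hg'⟩ := k'.exists_deriv_lift φ
    rw [h1, hg', h0, norm_smul, Real.norm_eq_abs, hu, k'.lift_eq_norm_smul φ] at hg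
    have hn : ‖‖k'.lift φ‖ • k'.unitLift φ‖ = ‖k'.lift φ‖ := by rw [← k'.lift_eq_norm_smul]
    rw [hn] at hg
    obtain ⟨x, hx⟩ : ∃ x : ℝ, (|m| * ‖k'.lift φ‖) • deriv k.unitLift ψ =
        x • k'.unitLift φ + (m * c * ‖k'.lift φ‖) • deriv k'.unitLift φ := by
      refine ⟨m' * ‖k'.lift φ‖ + m * c * g' - g * (m / |m|), ?_⟩
      rw [← sub_eq_iff_eq_add'.2 hg]
      module
    have hi : inner ℝ (k'.unitLift φ) (deriv k.unitLift ψ) = 0 := by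
      have := k.inner_unitLift_deriv ψ
      rw [hu, real_inner_smul_left] at this
      exact (mul_eq_zero.1 this).resolve_left (div_ne_zero hm ham)
    have hx0 : x = 0 := by
      have := congrArg (inner ℝ (k'.unitLift φ)) hx
      rw [inner_add_right, real_inner_smul_right, real_inner_smul_right, real_inner_smul_right,
        hi, k'.inner_unitLift_self, k'.inner_unitLift_deriv] at this
      linarith
    rw [hx0, zero_smul, zero_add] at hx
    have hne : |m| * ‖k'.lift φ‖ ≠ 0 := mul_ne_zero ham hl'
    rw [← inv_smul_smul₀ hne (deriv k.unitLift ψ), hx, smul_smul, smul_smul]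
    congr 1
    field_simp

end

/-! ### Small parameters: the glued curve relative to discs and chart. -/

section
open Filter Topology Set

theorem contDiff_perturb {P Q : ℝ → ℝ → E4} (hP : ContDiff ℝ ω fun p : ℝ × ℝ => P p.1 p.2)
    (hQ : ContDiff ℝ ω fun p : ℝ × ℝ => Q p.1 p.2) (e : E4) (m : ℕ) :
    ContDiff ℝ ω fun p : ℝ × ℝ => perturb P Q e m p.1 p.2 := by
  have h1 : ContDiff ℝ ω fun p : ℝ × ℝ => P p.2 1 :=
    hP.comp (contDiff_snd.prodMk contDiff_const)
  have h2 : ContDiff ℝ ω fun p : ℝ × ℝ => Q 1 (p.1 * p.2) :=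
    hQ.comp (contDiff_const.prodMk (contDiff_fst.mul contDiff_snd))
  exact h1.add ((contDiff_snd.pow m).smul (h2.sub contDiff_const))

/-- `S` is the set of points of the gluing of the arms `P` and `Q` with parameter `ε`, described in
affine charts. -/
structure IsGluing (S : Set RP3) (P Q : ℝ → ℝ → E4) (e : E4) (m n : ℕ) (ε : ℝ) : Prop where
  regions : ∀ M > 0, ∀ q ∈ S,
    (∃ w, |w| ≤ M ∧ q.submodule = Submodule.span ℝ {perturb P Q e m ε w}) ∨
    (∃ w, |w| ≤ M ∧ q.submodule = Submodule.span ℝ {perturb Q P e n ε w}) ∨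
    ∃ x y, |x| < M⁻¹ ∧ |y| < M⁻¹ ∧ x * y = ε ∧ q.submodule = Submodule.span ℝ {neck P Q e x y}
  left : ∀ w q, q.submodule = Submodule.span ℝ {perturb P Q e m ε w} → q ∈ S
  right : ∀ w q, q.submodule = Submodule.span ℝ {perturb Q P e n ε w} → q ∈ S
  middle : ∀ x y q, x * y = ε → q.submodule = Submodule.span ℝ {neck P Q e x y} → q ∈ S

theorem IsGluing.symm {S : Set RP3} {P Q : ℝ → ℝ → E4} {e : E4} {m n : ℕ} {ε : ℝ}
    (h : IsGluing S P Q e m n ε) : IsGluing S Q P e n m ε where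
  regions M hM q hq := by
    rcases h.regions M hM q hq with h1 | h2 | ⟨x, y, hx, hy, hxy, h3⟩
    · exact Or.inr (Or.inl h1)
    · exact Or.inl h2
    · exact Or.inr (Or.inr ⟨y, x, hy, hx, by rw [mul_comm, hxy], by rw [neck_swap, h3]⟩)
  left := h.right
  right := h.left
  middle x y q hxy hq := h.middle y x q (by rw [mul_comm, hxy]) (by rw [hq, neck_swap])

section Side

variable {d₁ d₂ : ℕ} (k₁ : RealRationalKnot d₁) (k₂ : RealRationalKnot d₂) (f₁ f₂ : ArmFrame)

/-- Along the first curve, the glued curves with parameter `ε` meet the normal discs of radius `r`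
only in the perturbed first arm. -/
structure IsGoodSide (r M M' M'' ε : ℝ) : Prop where
  isSectionAt : ∀ θ ∈ RationalParam.farSet f₁ M', k₁.IsSectionAt r M
    (perturb (k₁.arm f₁) (k₂.arm f₂) (k₁.arm f₁ 1 0) d₁ ε) θ
  not_other : ∀ w, |w| ≤ M → ∀ θ ∈ RationalParam.farSet f₁ M',
    ¬ k₁.InDisc r θ (perturb (k₂.arm f₂) (k₁.arm f₁) (k₁.arm f₁ 1 0) d₂ ε w)
  not_neck : ∀ x y, |x| ≤ M⁻¹ → |y| ≤ M⁻¹ → x * y = ε → ∀ θ ∈ RationalParam.farSet f₁ M',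
    ¬ k₁.InDisc r θ (neck (k₁.arm f₁) (k₂.arm f₂) (k₁.arm f₁ 1 0) x y)
  exists_disc : ∀ w, |w| ≤ M'' → ∃ θ ∈ RationalParam.farSet f₁ M',
    k₁.InDisc r θ (perturb (k₁.arm f₁) (k₂.arm f₂) (k₁.arm f₁ 1 0) d₁ ε w)

theorem RationalParam.submodule_pt_arm_one_left {d : ℕ} (k : RationalParam d) (f : ArmFrame)
    (x : ℝ) : (k.pt (f.base + f.sign * Real.arctan x)).submodule =
      Submodule.span ℝ {k.arm f 1 x} := by
  rw [submodule_pt, arm_one_left, span_singleton_smul (scale_pow_ne_zero f x)]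

theorem RationalParam.span_arm_inv {d : ℕ} (k : RationalParam d) (f : ArmFrame)
    {x : ℝ} (hx : x ≠ 0) :
    Submodule.span ℝ {k.arm f x⁻¹ 1} = Submodule.span ℝ {k.arm f 1 x} := by
  rw [← span_singleton_smul (pow_ne_zero d hx) (k.arm f x⁻¹ 1), ← arm_mul, mul_inv_cancel₀ hx,
    mul_one]

/-- At ε = 0 the perturbed arms are the two original curves and the neck degenerates to the cross xy
= 0. One branch of the cross lies on the second curve, which avoids the discs in question; the other
lies on the first curve beyond the cut-off M > M'. -/
theorem eventually_isGoodSide (he : k₂.arm f₂ 1 0 = k₁.arm f₁ 1 0)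
    {r R M M' M'' : ℝ} (hr : 0 < r) (hrR : r < R) (hR : k₁.IsTubularRadius R)
    (hdisj : ∀ θ ∈ RationalParam.farSet f₁ M, ∀ θ',
      Disjoint (k₁.normalDisc R θ) (k₂.normalDisc R θ'))
    (hM'' : 0 < M'') (hM' : M'' < M') (hM : M' < M) :
    ∀ᶠ ε in 𝓝 (0 : ℝ), IsGoodSide k₁ k₂ f₁ f₂ r M M' M'' ε := by
  have hM0 : 0 < M := (hM''.trans hM').trans hM
  have hP := k₁.contDiff_arm f₁
  have hQ := k₂.contDiff_arm f₂
  have hΦ := contDiff_perturb hP hQ (k₁.arm f₁ 1 0) d₁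
  have hΦ₀ : ∀ w, perturb (k₁.arm f₁) (k₂.arm f₂) (k₁.arm f₁ 1 0) d₁ 0 w = k₁.arm f₁ w 1 :=
    fun w => perturb_zero he w
  have hother : ∀ w ∈ Icc (-M') M', ∀ v : E4, v ≠ 0 → ∀ θ',
      (k₂.pt θ').submodule = Submodule.span ℝ {v} → ¬ k₁.InClosedDisc r (f₁.angle w) v := by
    intro w hw v hv θ' hθ'
    exact k₁.not_inClosedDisc_of_disjoint
      (hdisj _ (RationalParam.angle_mem_farSet f₁ ((abs_le.2 hw).trans_lt hM)) θ')
      (k₂.pt_mem_normalDisc (hr.trans hrR) θ') hv hθ' hrR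
  have h1 := k₁.eventually_isSectionAt f₁ hΦ hΦ₀ hR hr hrR hM
  have h2 := k₁.eventually_exists_inDisc_perturbed f₁ hΦ hΦ₀ hr hM'
  have h3 := k₁.eventually_not_inDisc f₁ (isCompact_Icc (a := -M) (b := M))
    (contDiff_perturb hQ hP (k₁.arm f₁ 1 0) d₂).continuous (D := univ) isClosed_univ (r := r)
    (M := M') (by
      intro w _ _ w' hw'
      simp only [perturb_zero]
      exact hother w' hw' _ (k₂.arm_ne_zero f₂ (by simp)) _ (k₂.submodule_pt_angle f₂ w))
  have hcn : Continuous fun z : ℝ × (ℝ × ℝ) =>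
      neck (k₁.arm f₁) (k₂.arm f₂) (k₁.arm f₁ 1 0) z.2.1 z.2.2 :=
    (continuous_neck hP.continuous hQ.continuous).comp continuous_snd
  have h4 := k₁.eventually_not_inDisc f₁
    ((isCompact_Icc (a := -M⁻¹) (b := M⁻¹)).prod (isCompact_Icc (a := -M⁻¹) (b := M⁻¹)))
    hcn (D := {z | z.2.1 * z.2.2 = z.1}) (isClosed_eq (by fun_prop) (by fun_prop)) (r := r)
    (M := M') (by
      rintro ⟨x, y⟩ ⟨hx, hy⟩ hxy w hw
      simp only [mem_ofPred_eq, mul_eq_zero] at hxy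
      dsimp only
      rcases hxy with rfl | rfl
      · rw [neck_zero_left rfl]
        exact hother w hw _ (k₂.arm_ne_zero f₂ (by simp)) _ (k₂.submodule_pt_arm_one_left f₂ y)
      · rw [neck_zero_right he]
        refine k₁.not_inClosedDisc_of_disjoint (hR.2.1 (f₁.angle w)
          (f₁.base + f₁.sign * Real.arctan x) fun h => ?_)
          (k₁.pt_mem_normalDisc (hr.trans hrR) _) (k₁.arm_ne_zero f₁ (by simp))
          (k₁.submodule_pt_arm_one_left f₁ x) hrR
        -- For x = 0 the point is p. Otherwise its arm coordinate is w = 1/x, of absolute value at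
        -- least M > M'.
        by_cases hx0 : x = 0
        · subst hx0
          rw [Real.arctan_zero, mul_zero, add_zero] at h
          exact f₁.circlePt_angle_ne_base w h
        · have h5 : k₁.pt (f₁.base + f₁.sign * Real.arctan x) = k₁.pt (f₁.angle x⁻¹) := by
            rw [← Projectivization.submodule_injective.eq_iff, k₁.submodule_pt_arm_one_left,
              k₁.submodule_pt_angle, k₁.span_arm_inv f₁ hx0]
          rw [k₁.pt_eq_iff] at h5
          have h6 := RationalParam.circlePt_angle_injective f₁ (h.trans h5)
          have h7 : |w| ≤ M' := abs_le.2 hw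
          have h8 : |x| ≤ M⁻¹ := abs_le.2 hx
          rw [h6, abs_inv] at h7
          have h9 : M ≤ |x|⁻¹ := by
            rw [le_inv_comm₀ hM0 (abs_pos.2 hx0)]
            exact h8
          linarith)
  filter_upwards [h1, h2, h3, h4] with ε h1 h2 h3 h4
  exact ⟨h1, fun w hw => h3 w (abs_le.1 hw) trivial,
    fun x y hx hy hxy => h4 (x, y) ⟨abs_le.1 hx, abs_le.1 hy⟩ hxy, fun w hw => h2 w (abs_le.1 hw)⟩

variable {k₁ k₂ f₁ f₂}

theorem IsGoodSide.isSection {r M M' M'' ε : ℝ} (h : IsGoodSide k₁ k₂ f₁ f₂ r M M' M'' ε)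
    (hM : 0 < M) {S : Set RP3}
    (hS : IsGluing S (k₁.arm f₁) (k₂.arm f₂) (k₁.arm f₁ 1 0) d₁ d₂ ε) :
    k₁.IsSection r (RationalParam.farSet f₁ M') S := by
  refine k₁.isSection_of_isSectionAt (RationalParam.isOpen_farSet f₁ M') h.isSectionAt ?_
  intro θ hθ q
  constructor
  · rintro ⟨hq, hd⟩
    rcases hS.regions M hM q hq with ⟨w, hw, h1⟩ | ⟨w, hw, h1⟩ | ⟨x, y, hx, hy, hxy, h1⟩
    · exact ⟨w, hw, (k₁.mem_normalDisc_iff h1).1 hd, h1⟩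
    · exact absurd ((k₁.mem_normalDisc_iff h1).1 hd) (h.not_other w hw θ hθ)
    · exact absurd ((k₁.mem_normalDisc_iff h1).1 hd) (h.not_neck x y hx.le hy.le hxy θ hθ)
  · rintro ⟨w, -, hd, h1⟩
    exact ⟨hS.left w q h1, (k₁.mem_normalDisc_iff h1).2 hd⟩

end Side

section ChartChoice

variable {d₁ d₂ : ℕ} (k₁ : RealRationalKnot d₁) (k₂ : RealRationalKnot d₂) (f₁ f₂ : ArmFrame)

/-- If w were in the plane of e and v, the two planes would coincide. Here the planes represent the
tangent lines at p. -/
theorem linearIndependent_triple {e v w : E4} (hv : LinearIndependent ℝ ![e, v])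
    (hw : LinearIndependent ℝ ![e, w])
    (hne : Submodule.span ℝ {e, v} ≠ Submodule.span ℝ {e, w}) :
    LinearIndependent ℝ ![e, v, w] := by
  have hmem : w ∉ Submodule.span ℝ {e, v} := by
    intro hmem
    obtain ⟨a, b, rfl⟩ := Submodule.mem_span_pair.1 hmem
    apply hne
    have hb : b ≠ 0 := by
      rintro rfl
      rw [LinearIndependent.pair_iff] at hw
      have := hw a (-1) (by module)
      norm_num at this
    have := span_pair_reparam e v (c := 1) (d := a) one_ne_zero hb
    rw [one_smul] at this
    exact this.symm
  have hmem' : w ∉ Submodule.span ℝ {v, e} := by rwa [Set.pair_comm]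
  have := LinearIndependent.finSnoc hv (x := w) (by simpa using hmem')
  have e1 : (Fin.snoc ![e, v] w : Fin 3 → E4) = ![e, v, w] := by
    ext i : 1
    fin_cases i <;> rfl
  rwa [e1] at this

theorem exists_chart_radius {P Q : ℝ → ℝ → E4} {e : E4}
    (hP : ContDiff ℝ ω fun p : ℝ × ℝ => P p.1 p.2) (hQ : ContDiff ℝ ω fun p : ℝ × ℝ => Q p.1 p.2)
    (hPe : P 1 0 = e) (hQe : Q 1 0 = e)
    (hli : LinearIndependent ℝ ![e, deriv (fun x => P 1 x) 0, deriv (fun x => Q 1 x) 0]) :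
    ∃ h, ∃ δ > 0,
      (∀ z : Fin 3 → ℝ, ‖z‖ < δ → LinearIndependent ℝ (cubeFrame P Q e h z)) ∧
      ∀ z w : Fin 3 → ℝ, ‖z‖ < δ → ‖w‖ < δ → ∀ c : ℝ,
        c • cubeMap P Q e h w = cubeMap P Q e h z → z = w := by
  obtain ⟨h, hh⟩ := exists_linearIndependent_cubeFrame hPe hQe hli
  obtain ⟨δ₁, hδ₁, h1⟩ := Metric.eventually_nhds_iff.1
    (eventually_linearIndependent_cubeFrame hP hQ hh)
  obtain ⟨δ₂, hδ₂, h2⟩ := Metric.eventually_nhds_iff.1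
    (eventually_injective_cubeMap hP hQ hPe hQe hh)
  refine ⟨h, min δ₁ δ₂, lt_min hδ₁ hδ₂, fun z hz => h1 ?_, fun z w hz hw => h2 (y := (z, w)) ?_⟩
  · rw [dist_zero_right]
    exact hz.trans_le (min_le_left _ _)
  · rw [Prod.dist_eq, max_lt_iff, dist_zero_right, dist_zero_right]
    exact ⟨hz.trans_le (min_le_right _ _), hw.trans_le (min_le_right _ _)⟩

/-- The arm |w| ≤ M is compact and avoids p, hence avoids a small cube around p. Inside such a cube
only the neck has to be considered. -/
theorem eventually_linearIndependent_arm_cubeMap (k : RealRationalKnot d₁) (f : ArmFrame)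
    {X : (Fin 3 → ℝ) → E4} (hX : Continuous X) (hX₀ : X 0 = k.arm f 1 0) (M : ℝ) :
    ∀ᶠ z in 𝓝 (0 : Fin 3 → ℝ), ∀ w ∈ Icc (-M) M, LinearIndependent ℝ ![k.arm f w 1, X z] := by
  refine isCompact_Icc.eventually_forall_of_forall_eventually fun w _ => ?_
  have hc := (k.contDiff_arm f).continuous
  have h1 : Continuous fun p : (Fin 3 → ℝ) × ℝ => k.arm f p.2 1 :=
    Continuous.comp (g := fun p : ℝ × ℝ => k.arm f p.1 p.2)
      (f := fun p : (Fin 3 → ℝ) × ℝ => (p.2, (1 : ℝ))) hc (continuous_snd.prodMk continuous_const)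
  have h2 : Continuous fun p : (Fin 3 → ℝ) × ℝ => X p.1 := hX.comp continuous_fst
  refine eventually_linearIndependent_pair (x := ((0 : Fin 3 → ℝ), w)) h1.continuousAt
    h2.continuousAt ?_
  change LinearIndependent ℝ ![k.arm f w 1, X 0]
  rw [hX₀, linearIndependent_pair_iff_span_ne (k.arm_ne_zero f (by simp))
    (k.arm_ne_zero f (by simp)), ← k.submodule_pt_angle, ← k.submodule_pt_arm_one_left,
    Real.arctan_zero, mul_zero, add_zero]
  intro h
  exact f.circlePt_angle_ne_base w (k.pt_eq_iff.1 (Projectivization.submodule_injective h))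

theorem eventually_linearIndependent_perturb_cubeMap {P Q : ℝ → ℝ → E4} {e : E4} {m : ℕ}
    (hP : ContDiff ℝ ω fun p : ℝ × ℝ => P p.1 p.2) (hQ : ContDiff ℝ ω fun p : ℝ × ℝ => Q p.1 p.2)
    (hQe : Q 1 0 = e) {X : (Fin 3 → ℝ) → E4} (hX : Continuous X) {M η : ℝ}
    (h : ∀ z : Fin 3 → ℝ, ‖z‖ ≤ η → ∀ w, |w| ≤ M → LinearIndependent ℝ ![P w 1, X z]) :
    ∀ᶠ ε in 𝓝 (0 : ℝ), ∀ z : Fin 3 → ℝ, ‖z‖ ≤ η → ∀ w, |w| ≤ M →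
      LinearIndependent ℝ ![perturb P Q e m ε w, X z] := by
  have h1 : ∀ᶠ ε in 𝓝 (0 : ℝ), ∀ p ∈ Metric.closedBall (0 : Fin 3 → ℝ) η ×ˢ Icc (-M) M,
      LinearIndependent ℝ ![perturb P Q e m ε p.2, X p.1] := by
    refine ((isCompact_closedBall _ _).prod isCompact_Icc).eventually_forall_of_forall_eventually ?_
    rintro ⟨z, w⟩ ⟨hz, hw⟩
    have hc := (contDiff_perturb hP hQ e m).continuous
    have h1 : Continuous fun p : ℝ × ((Fin 3 → ℝ) × ℝ) => perturb P Q e m p.1 p.2.2 :=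
      hc.comp (continuous_fst.prodMk (continuous_snd.comp continuous_snd))
    refine eventually_linearIndependent_pair
      (f := fun p : ℝ × ((Fin 3 → ℝ) × ℝ) => perturb P Q e m p.1 p.2.2)
      (g := fun p => X p.2.1) h1.continuousAt (by fun_prop) ?_
    dsimp only
    rw [perturb_zero hQe]
    exact h z (by simpa using hz) w (abs_le.2 hw)
  filter_upwards [h1] with ε h1 z hz w hw
  exact h1 (z, w) ⟨by simpa using hz, abs_le.1 hw⟩

theorem eventually_linearIndependent_perturb_deriv (k : RealRationalKnot d₁) (f : ArmFrame)
    {Q : ℝ → ℝ → E4} {e : E4} {m : ℕ} (hQ : ContDiff ℝ ω fun p : ℝ × ℝ => Q p.1 p.2)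
    (hQe : Q 1 0 = e) (M : ℝ) :
    ∀ᶠ ε in 𝓝 (0 : ℝ), ∀ w, |w| ≤ M → LinearIndependent ℝ
      ![perturb (k.arm f) Q e m ε w, deriv (perturb (k.arm f) Q e m ε) w] := by
  have hΦ := contDiff_perturb (k.contDiff_arm f) hQ e m
  -- As a partial derivative of the joint map, the derivative in w is continuous in (ε, w).
  have hd : ∀ ε w, deriv (perturb (k.arm f) Q e m ε) w =
      fderiv ℝ (fun p : ℝ × ℝ => perturb (k.arm f) Q e m p.1 p.2) (ε, w) (0, 1) := by
    intro ε w
    have h1 := ((hΦ.differentiable (by simp)) (ε, w)).hasFDerivAt.comp_hasDerivAt w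
      ((hasDerivAt_const w ε).prodMk (hasDerivAt_id w))
    exact h1.deriv
  have hc : Continuous fun p : ℝ × ℝ =>
      fderiv ℝ (fun p : ℝ × ℝ => perturb (k.arm f) Q e m p.1 p.2) p (0, 1) :=
    (hΦ.continuous_fderiv (by simp)).clm_apply continuous_const
  have h1 : ∀ᶠ ε in 𝓝 (0 : ℝ), ∀ w ∈ Icc (-M) M, LinearIndependent ℝ
      ![perturb (k.arm f) Q e m ε w, deriv (perturb (k.arm f) Q e m ε) w] := by
    refine isCompact_Icc.eventually_forall_of_forall_eventually fun w _ => ?_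
    simp only [hd]
    refine eventually_linearIndependent_pair
      (f := fun p : ℝ × ℝ => perturb (k.arm f) Q e m p.1 p.2)
      (g := fun p : ℝ × ℝ =>
        fderiv ℝ (fun p : ℝ × ℝ => perturb (k.arm f) Q e m p.1 p.2) (p.1, p.2) (0, 1))
      hΦ.continuous.continuousAt hc.continuousAt ?_
    dsimp only
    have h0 : perturb (k.arm f) Q e m 0 = fun w => k.arm f w 1 :=
      funext fun w => perturb_zero hQe w
    rw [← hd, h0]
    exact k.linearIndependent_arm_one_right f w
  filter_upwards [h1] with ε h1 w hw using h1 w (abs_le.1 hw)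

end ChartChoice

end

/-! ### Derivatives of the glued curve in the three charts. -/

section
open Filter Topology Set

section GlueArm

variable {d₁ d₂ : ℕ} {k₁ : RationalParam d₁} {k₂ : RationalParam d₂} {f₁ f₂ : ArmFrame} {a b : ℝ}

theorem glueArm_eq_left (hb : b ≠ 0) {t : ℝ} (ht : t ≠ 0) (s : ℝ) :
    glueArm k₁ k₂ f₁ f₂ a b s t = (t ^ d₂ * (b * t) ^ d₁) •
      perturb (k₁.arm f₁) (k₂.arm f₂) (k₁.arm f₁ 1 0) d₁ (a * b) (s / (b * t)) :=
  glue_eq_smul_perturb (k₁.arm_mul f₁) (k₂.arm_mul f₂) hb ht s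

theorem glueArm_eq_right (ha : a ≠ 0) {s : ℝ} (hs : s ≠ 0) (t : ℝ) :
    glueArm k₁ k₂ f₁ f₂ a b s t = (s ^ d₁ * (a * s) ^ d₂) •
      perturb (k₂.arm f₂) (k₁.arm f₁) (k₁.arm f₁ 1 0) d₂ (a * b) (t / (a * s)) :=
  glue_eq_smul_perturb' (k₁.arm_mul f₁) (k₂.arm_mul f₂) ha hs t

theorem glueArm_eq_neck {s t : ℝ} (hs : s ≠ 0) (ht : t ≠ 0) :
    glueArm k₁ k₂ f₁ f₂ a b s t = (s ^ d₁ * t ^ d₂) •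
      neck (k₁.arm f₁) (k₂.arm f₂) (k₁.arm f₁ 1 0) (b * t / s) (a * s / t) :=
  glue_eq_smul_neck (k₁.arm_mul f₁) (k₂.arm_mul f₂) hs ht

theorem glueArm_swap (he : k₂.arm f₂ 1 0 = k₁.arm f₁ 1 0) (s t : ℝ) :
    glueArm k₁ k₂ f₁ f₂ a b s t = glueArm k₂ k₁ f₂ f₁ b a t s := by
  rw [glueArm, glueArm, he, glue_swap]

theorem span_glueArm_left (hb : b ≠ 0) {t : ℝ} (ht : t ≠ 0) (s : ℝ) :
    Submodule.span ℝ {glueArm k₁ k₂ f₁ f₂ a b s t} = Submodule.span ℝ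
      {perturb (k₁.arm f₁) (k₂.arm f₂) (k₁.arm f₁ 1 0) d₁ (a * b) (s / (b * t))} := by
  rw [glueArm_eq_left hb ht, span_singleton_smul (by simp [hb, ht])]

theorem span_glueArm_right (ha : a ≠ 0) {s : ℝ} (hs : s ≠ 0) (t : ℝ) :
    Submodule.span ℝ {glueArm k₁ k₂ f₁ f₂ a b s t} = Submodule.span ℝ
      {perturb (k₂.arm f₂) (k₁.arm f₁) (k₁.arm f₁ 1 0) d₂ (a * b) (t / (a * s))} := by
  rw [glueArm_eq_right ha hs, span_singleton_smul (by simp [ha, hs])]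

theorem span_glueArm_neck {s t : ℝ} (hs : s ≠ 0) (ht : t ≠ 0) :
    Submodule.span ℝ {glueArm k₁ k₂ f₁ f₂ a b s t} = Submodule.span ℝ
      {neck (k₁.arm f₁) (k₂.arm f₂) (k₁.arm f₁ 1 0) (b * t / s) (a * s / t)} := by
  rw [glueArm_eq_neck hs ht, span_singleton_smul (by simp [hs, ht])]

theorem mem_image_gluedParam
    (h : ∀ s t, ¬ (s = 0 ∧ t = 0) → glueArm k₁ k₂ f₁ f₂ a b s t ≠ 0) {q : RP3} {s t : ℝ}
    (hst : ¬ (s = 0 ∧ t = 0))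
    (hq : q.submodule = Submodule.span ℝ {glueArm k₁ k₂ f₁ f₂ a b s t}) :
    q ∈ (gluedParam k₁ k₂ f₁ f₂ a b h).image := by
  obtain ⟨R, θ, hR, rfl, rfl⟩ := exists_polar hst
  rw [RationalParam.image_eq_range_pt]
  refine ⟨θ, ?_⟩
  rw [← Projectivization.submodule_injective.eq_iff, hq, RationalParam.submodule_pt,
    gluedParam_lift, glueArm, glueArm, glue_smul (k₁.arm_mul f₁) (k₂.arm_mul f₂),
    span_singleton_smul (pow_ne_zero _ hR)]

theorem isGluing_image (ha : a ≠ 0) (hb : b ≠ 0)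
    (h : ∀ s t, ¬ (s = 0 ∧ t = 0) → glueArm k₁ k₂ f₁ f₂ a b s t ≠ 0) :
    IsGluing (gluedParam k₁ k₂ f₁ f₂ a b h).image (k₁.arm f₁) (k₂.arm f₂) (k₁.arm f₁ 1 0) d₁ d₂
      (a * b) where
  regions M hM q hq := by
    rw [RationalParam.image_eq_range_pt] at hq
    obtain ⟨θ, rfl⟩ := hq
    rw [RationalParam.submodule_pt, gluedParam_lift]
    have hne : ¬ (Real.cos θ = 0 ∧ Real.sin θ = 0) := by
      rintro ⟨h0, h1⟩
      exact RationalParam.cos_sin_ne_zero θ (by rw [h0, h1]; ext i; fin_cases i <;> rfl)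
    rcases gluing_regions a b hne M hM with ⟨ht, h1⟩ | ⟨hs, h1⟩ | ⟨hs, ht, hx, hy⟩
    · exact Or.inl ⟨_, h1, span_glueArm_left hb ht _⟩
    · exact Or.inr (Or.inl ⟨_, h1, span_glueArm_right ha hs _⟩)
    · refine Or.inr (Or.inr ⟨_, _, hx, hy, ?_, span_glueArm_neck hs ht⟩)
      field_simp
  left w q hq := by
    refine mem_image_gluedParam h (s := b * w) (t := 1) (by simp) ?_
    rw [span_glueArm_left hb one_ne_zero, mul_one, mul_div_cancel_left₀ _ hb]
    exact hq
  right w q hq := by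
    refine mem_image_gluedParam h (s := 1) (t := a * w) (by simp) ?_
    rw [span_glueArm_right ha one_ne_zero, mul_one, mul_div_cancel_left₀ _ ha]
    exact hq
  middle x y q hxy hq := by
    have hx : x ≠ 0 := by
      rintro rfl
      rw [zero_mul] at hxy
      exact mul_ne_zero ha hb hxy.symm
    -- For [s : t] = [b : x] the neck coordinates are bt/s = x and as/t = ab/x = y.
    refine mem_image_gluedParam h (s := b) (t := x) (by simp [hb]) ?_
    rw [span_glueArm_neck hb hx, mul_div_cancel_left₀ _ hb, ← hxy, mul_div_cancel_left₀ _ hx]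
    exact hq

theorem exists_deriv_eq_of_eventuallyEq {V : Type*} [NormedAddCommGroup V] [NormedSpace ℝ V]
    {L M : ℝ → V} {c g : ℝ → ℝ} {g' θ : ℝ}
    (hL : ∀ᶠ t in 𝓝 θ, L t = c t • M (g t)) (hc : DifferentiableAt ℝ c θ)
    (hg : HasDerivAt g g' θ) (hM : DifferentiableAt ℝ M (g θ)) :
    ∃ c' : ℝ, deriv L θ = c' • M (g θ) + (c θ * g') • deriv M (g θ) := by
  refine ⟨deriv c θ, ?_⟩
  rw [Filter.EventuallyEq.deriv_eq hL]
  exact (hasDerivAt_smul_comp hM.hasDerivAt hc.hasDerivAt hg).deriv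

theorem differentiable_perturb (P Q : ℝ → ℝ → E4)
    (hP : ContDiff ℝ ω fun p : ℝ × ℝ => P p.1 p.2)
    (hQ : ContDiff ℝ ω fun p : ℝ × ℝ => Q p.1 p.2) (e : E4) (m : ℕ) (ε : ℝ) :
    Differentiable ℝ (perturb P Q e m ε) := by
  have h := (contDiff_perturb hP hQ e m).comp (contDiff_const.prodMk contDiff_id :
    ContDiff ℝ ω fun w : ℝ => (ε, w))
  exact h.differentiable (by simp)

variable (h : ∀ s t, ¬ (s = 0 ∧ t = 0) → glueArm k₁ k₂ f₁ f₂ a b s t ≠ 0)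

theorem exists_deriv_gluedParam_left (hb : b ≠ 0) {θ : ℝ} (hθ : Real.sin θ ≠ 0) :
    ∃ c' : ℝ, deriv (gluedParam k₁ k₂ f₁ f₂ a b h).lift θ =
      c' • perturb (k₁.arm f₁) (k₂.arm f₂) (k₁.arm f₁ 1 0) d₁ (a * b)
          (Real.cos θ / (b * Real.sin θ)) +
        (Real.sin θ ^ d₂ * (b * Real.sin θ) ^ d₁ * (-1 / (b * Real.sin θ ^ 2))) •
          deriv (perturb (k₁.arm f₁) (k₂.arm f₂) (k₁.arm f₁ 1 0) d₁ (a * b))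
            (Real.cos θ / (b * Real.sin θ)) := by
  refine exists_deriv_eq_of_eventuallyEq
    (c := fun θ => Real.sin θ ^ d₂ * (b * Real.sin θ) ^ d₁)
    (g := fun θ => Real.cos θ / (b * Real.sin θ)) ?_ (by fun_prop) ?_
    (differentiable_perturb _ _ (k₁.contDiff_arm f₁) (k₂.contDiff_arm f₂) _ _ _ _)
  · filter_upwards [Real.continuous_sin.continuousAt.eventually_ne hθ] with t ht
    rw [gluedParam_lift, glueArm_eq_left hb ht]
  · have h1 := (Real.hasDerivAt_cos θ).div ((Real.hasDerivAt_sin θ).const_mul b)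
      (mul_ne_zero hb hθ)
    refine h1.congr_deriv ?_
    have := Real.sin_sq_add_cos_sq θ
    field_simp
    linear_combination -this

theorem exists_deriv_gluedParam_right (ha : a ≠ 0) {θ : ℝ} (hθ : Real.cos θ ≠ 0) :
    ∃ c' : ℝ, deriv (gluedParam k₁ k₂ f₁ f₂ a b h).lift θ =
      c' • perturb (k₂.arm f₂) (k₁.arm f₁) (k₁.arm f₁ 1 0) d₂ (a * b)
          (Real.sin θ / (a * Real.cos θ)) +
        (Real.cos θ ^ d₁ * (a * Real.cos θ) ^ d₂ * (1 / (a * Real.cos θ ^ 2))) •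
          deriv (perturb (k₂.arm f₂) (k₁.arm f₁) (k₁.arm f₁ 1 0) d₂ (a * b))
            (Real.sin θ / (a * Real.cos θ)) := by
  refine exists_deriv_eq_of_eventuallyEq
    (c := fun θ => Real.cos θ ^ d₁ * (a * Real.cos θ) ^ d₂)
    (g := fun θ => Real.sin θ / (a * Real.cos θ)) ?_ (by fun_prop) ?_
    (differentiable_perturb _ _ (k₂.contDiff_arm f₂) (k₁.contDiff_arm f₁) _ _ _ _)
  · filter_upwards [Real.continuous_cos.continuousAt.eventually_ne hθ] with t ht
    rw [gluedParam_lift, glueArm_eq_right ha ht]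
  · have h1 := (Real.hasDerivAt_sin θ).div ((Real.hasDerivAt_cos θ).const_mul a)
      (mul_ne_zero ha hθ)
    refine h1.congr_deriv ?_
    have := Real.sin_sq_add_cos_sq θ
    field_simp
    linear_combination this

/-- In cube coordinates the curve is x ↦ (x, ab/x, 0), with velocity (1, -ab/x², 0) ≠ 0.
Independence of the frame turns this into independence of point and derivative. -/
theorem linearIndependent_gluedParam_neck (ha : a ≠ 0) (hb : b ≠ 0) {θ : ℝ} {v : E4}
    (hs : Real.cos θ ≠ 0) (ht : Real.sin θ ≠ 0)
    (hli : LinearIndependent ℝ (cubeFrame (k₁.arm f₁) (k₂.arm f₂) (k₁.arm f₁ 1 0) v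
      ![b * Real.sin θ / Real.cos θ, a * Real.cos θ / Real.sin θ, 0])) :
    LinearIndependent ℝ ![(gluedParam k₁ k₂ f₁ f₂ a b h).lift θ,
      deriv (gluedParam k₁ k₂ f₁ f₂ a b h).lift θ] := by
  set x := b * Real.sin θ / Real.cos θ with hx
  have hx0 : x ≠ 0 := div_ne_zero (mul_ne_zero hb ht) hs
  have hy : a * Real.cos θ / Real.sin θ = a * b / x := by rw [hx]; field_simp
  have hP := contDiff_one_left (k₁.contDiff_arm f₁)
  have hQ := contDiff_one_left (k₂.contDiff_arm f₂)
  have hN : HasDerivAt (fun x => neck (k₁.arm f₁) (k₂.arm f₂) (k₁.arm f₁ 1 0) x (a * b / x))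
      (deriv (fun x => k₁.arm f₁ 1 x) x +
        (-(a * b) / x ^ 2) • deriv (fun x => k₂.arm f₂ 1 x) (a * b / x)) x := by
    have h1 := (hP.differentiable (by simp) x).hasDerivAt
    have h2 := (hQ.differentiable (by simp) (a * b / x)).hasDerivAt
    have h3 : HasDerivAt (fun x => a * b / x) (-(a * b) / x ^ 2) x := by
      have := (hasDerivAt_const x (a * b)).div (hasDerivAt_id x) hx0
      refine this.congr_deriv ?_
      simp
    exact (h1.add (h2.scomp x h3)).sub_const _
  obtain ⟨c', hc'⟩ := exists_deriv_eq_of_eventuallyEq (θ := θ)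
    (L := (gluedParam k₁ k₂ f₁ f₂ a b h).lift)
    (M := fun x => neck (k₁.arm f₁) (k₂.arm f₂) (k₁.arm f₁ 1 0) x (a * b / x))
    (c := fun θ => Real.cos θ ^ d₁ * Real.sin θ ^ d₂)
    (g := fun θ => b * Real.sin θ / Real.cos θ) (g' := b / Real.cos θ ^ 2) (by
      filter_upwards [Real.continuous_cos.continuousAt.eventually_ne hs,
        Real.continuous_sin.continuousAt.eventually_ne ht] with t hs ht
      rw [gluedParam_lift, glueArm_eq_neck hs ht]
      congr 2
      field_simp) (by fun_prop) (by
      have h1 := ((Real.hasDerivAt_sin θ).const_mul b).div (Real.hasDerivAt_cos θ) hs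
      refine h1.congr_deriv ?_
      have := Real.sin_sq_add_cos_sq θ
      field_simp
      linear_combination this) hN.differentiableAt
  rw [hc', gluedParam_lift, glueArm_eq_neck hs ht, ← hx, hy, hN.deriv]
  refine linearIndependent_pair_reparam ?_ (by simp [hs, ht]) (by simp [hs, ht, hb])
  rw [hy] at hli
  rw [LinearIndependent.pair_iff]
  intro s t hst
  have h0 := eq_zero_of_cubeFrame (c := s) (v := ![t, t * (-(a * b) / x ^ 2), 0]) hli (by
    rw [← hst, cubeDeriv_apply, cubeMap]
    simp only [Matrix.cons_val_zero, Matrix.cons_val_one, Matrix.cons_val]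
    module)
  exact ⟨h0.1, by simpa using congrFun h0.2 0⟩

end GlueArm

/-- Both factors of w^m (Q(1, εw) - e) vanish at w = 0, so their product has zero derivative there.
-/
theorem hasDerivAt_perturb_zero {P Q : ℝ → ℝ → E4} {e : E4} {m : ℕ} (hm : m ≠ 0)
    (hP : ContDiff ℝ ω fun p : ℝ × ℝ => P p.1 p.2) (hQ : ContDiff ℝ ω fun p : ℝ × ℝ => Q p.1 p.2)
    (hQe : Q 1 0 = e) (ε : ℝ) :
    deriv (perturb P Q e m ε) 0 = deriv (fun w => P w 1) 0 := by
  have h1 : Differentiable ℝ fun w => P w 1 :=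
    (hP.comp (contDiff_id.prodMk contDiff_const : ContDiff ℝ ω fun w : ℝ => (w, (1 : ℝ)))
      ).differentiable (by simp)
  have h2 : Differentiable ℝ fun w => Q 1 (ε * w) - e :=
    ((hQ.comp (contDiff_const.prodMk (contDiff_const.mul contDiff_id) :
      ContDiff ℝ ω fun w : ℝ => ((1 : ℝ), ε * w))).sub contDiff_const).differentiable (by simp)
  have h3 := (h1 0).hasDerivAt.add ((hasDerivAt_pow m (0 : ℝ)).smul (h2 0).hasDerivAt)
  have h4 := h3.deriv
  change deriv (perturb P Q e m ε) 0 = _ at h4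
  rw [h4]
  simp [hQe, hm]

section Velocity

variable {d₁ d₂ : ℕ} {k₁ : RealRationalKnot d₁} {k₂ : RealRationalKnot d₂} {f₁ f₂ : ArmFrame}
  {a b : ℝ}
  (h : ∀ s t, ¬ (s = 0 ∧ t = 0) →
    glueArm k₁.toRationalParam k₂.toRationalParam f₁ f₂ a b s t ≠ 0)

include h

/-- At θ = π/2 the coordinate cos θ/(b sin θ) has derivative -1/b, while the angle of the frame
decreases with w for sign 1. The two signs cancel and leave the positive factor b⁻¹. -/
theorem hasVelocityRatio_left (he : k₂.arm f₂ 1 0 = k₁.arm f₁ 1 0) (hb : b ≠ 0)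
    (hf : f₁.sign = 1) :
    HasVelocityRatio (gluedParam k₁.toRationalParam k₂.toRationalParam f₁ f₂ a b h)
      (Real.pi / 2) k₁.toRationalParam (f₁.angle 0) b⁻¹ := by
  obtain ⟨c', hc'⟩ := exists_deriv_gluedParam_left h hb (θ := Real.pi / 2) (by simp)
  obtain ⟨c'', hc''⟩ := k₁.exists_hasDerivAt_arm_one_right f₁ 0
  have hl : (gluedParam k₁.toRationalParam k₂.toRationalParam f₁ f₂ a b h).lift (Real.pi / 2) =
      _ • _ := (gluedParam_lift h _).trans (glueArm_eq_left hb (by simp) _)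
  have h0 : perturb (k₁.arm f₁) (k₂.arm f₂) (k₁.arm f₁ 1 0) d₁ (a * b) 0 = k₁.arm f₁ 0 1 := by
    simp [perturb, k₁.degree_ne_zero]
  rw [Real.cos_pi_div_two, Real.sin_pi_div_two, mul_one, zero_div, h0, k₁.arm_one_right,
    smul_smul] at hl
  rw [Real.cos_pi_div_two, Real.sin_pi_div_two, mul_one, zero_div, h0, k₁.arm_one_right,
    hasDerivAt_perturb_zero k₁.degree_ne_zero (k₁.contDiff_arm f₁) (k₂.contDiff_arm f₂) he,
    hc''.deriv, hf] at hc'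
  refine hasVelocityRatio_of_lift ?_ (inv_ne_zero hb) hl (m' := c' * (f₁.scale * √(1 + 0 ^ 2) ^ d₁)
    + 1 ^ d₂ * b ^ d₁ * (-1 / (b * 1 ^ 2)) * c'') ?_
  · simp [hb, f₁.scale_ne]
  · rw [hc', smul_add, smul_smul, smul_smul, smul_smul, ← add_assoc, ← add_smul]
    congr 2
    field_simp
    norm_num

/-- At θ = 0 the coordinate sin θ/(a cos θ) increases. This is why the second frame needs the
opposite sign. -/
theorem hasVelocityRatio_right (ha : a ≠ 0)
    (hf : f₂.sign = -1) :
    HasVelocityRatio (gluedParam k₁.toRationalParam k₂.toRationalParam f₁ f₂ a b h)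
      0 k₂.toRationalParam (f₂.angle 0) a⁻¹ := by
  obtain ⟨c', hc'⟩ := exists_deriv_gluedParam_right h ha (θ := 0) (by simp)
  obtain ⟨c'', hc''⟩ := k₂.exists_hasDerivAt_arm_one_right f₂ 0
  have hl : (gluedParam k₁.toRationalParam k₂.toRationalParam f₁ f₂ a b h).lift 0 =
      _ • _ := (gluedParam_lift h _).trans (glueArm_eq_right ha (by simp) _)
  have h0 : perturb (k₂.arm f₂) (k₁.arm f₁) (k₁.arm f₁ 1 0) d₂ (a * b) 0 = k₂.arm f₂ 0 1 := by
    simp [perturb, k₂.degree_ne_zero]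
  rw [Real.cos_zero, Real.sin_zero, mul_one, zero_div, h0, k₂.arm_one_right,
    smul_smul] at hl
  rw [Real.cos_zero, Real.sin_zero, mul_one, zero_div, h0, k₂.arm_one_right,
    hasDerivAt_perturb_zero k₂.degree_ne_zero (k₂.contDiff_arm f₂) (k₁.contDiff_arm f₁) rfl,
    hc''.deriv, hf] at hc'
  refine hasVelocityRatio_of_lift ?_ (inv_ne_zero ha) hl (m' := c' * (f₂.scale * √(1 + 0 ^ 2) ^ d₂)
    + 1 ^ d₁ * a ^ d₂ * (1 / (a * 1 ^ 2)) * c'') ?_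
  · simp [ha, f₂.scale_ne]
  · rw [hc', smul_add, smul_smul, smul_smul, smul_smul, ← add_assoc, ← add_smul]
    congr 2
    field_simp
    norm_num

end Velocity

end

/-! ### The hyperbola, the tubes and injectivity. -/

section
open Filter Topology Set

section Hyperbola

theorem cubeMap_apply (P Q : ℝ → ℝ → E4) (e v : E4) (z : Fin 3 → ℝ) :
    cubeMap P Q e v z = neck P Q e (z 0) (z 1) + z 2 • v := rfl

theorem cubeMap_eq_neck (P Q : ℝ → ℝ → E4) (e v : E4) (x y : ℝ) :
    cubeMap P Q e v ![x, y, 0] = neck P Q e x y := by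
  simp [cubeMap]

theorem norm_vec_lt {x y δ : ℝ} (hx : |x| < δ) (hy : |y| < δ) : ‖(![x, y, 0] : Fin 3 → ℝ)‖ < δ := by
  have hδ := (abs_nonneg x).trans_lt hx
  rw [pi_norm_lt_iff hδ]
  intro i
  fin_cases i
  · exact hx
  · exact hy
  · simpa using hδ

variable {d₁ d₂ : ℕ} {k₁ : RealRationalKnot d₁} {k₂ : RealRationalKnot d₂} {f₁ f₂ : ArmFrame}

/-- All curves are cut at δ⁻¹. The independence hypotheses keep the arms out of the cube, and the
remaining pieces have coordinates below δ, where `cubeMap` is injective modulo scalars. So the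
coordinates can be compared, even though the cube only has size η < δ. -/
theorem isHyperbolaSmoothing_of_isGluing (he : k₂.arm f₂ 1 0 = k₁.arm f₁ 1 0) {v : E4} {δ η ε : ℝ}
    (hη : 0 < η) (hηδ : η < δ)
    (hframe : ∀ z : Fin 3 → ℝ, ‖z‖ < δ →
      LinearIndependent ℝ (cubeFrame (k₁.arm f₁) (k₂.arm f₂) (k₁.arm f₁ 1 0) v z))
    (hinj : ∀ z w : Fin 3 → ℝ, ‖z‖ < δ → ‖w‖ < δ → ∀ c : ℝ,
      c • cubeMap (k₁.arm f₁) (k₂.arm f₂) (k₁.arm f₁ 1 0) v w =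
        cubeMap (k₁.arm f₁) (k₂.arm f₂) (k₁.arm f₁ 1 0) v z → z = w)
    (h₁ : ∀ z : Fin 3 → ℝ, ‖z‖ ≤ η → ∀ w, |w| ≤ δ⁻¹ → LinearIndependent ℝ
      ![k₁.arm f₁ w 1, cubeMap (k₁.arm f₁) (k₂.arm f₂) (k₁.arm f₁ 1 0) v z])
    (h₂ : ∀ z : Fin 3 → ℝ, ‖z‖ ≤ η → ∀ w, |w| ≤ δ⁻¹ → LinearIndependent ℝ
      ![k₂.arm f₂ w 1, cubeMap (k₁.arm f₁) (k₂.arm f₂) (k₁.arm f₁ 1 0) v z])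
    (hp₁ : ∀ z : Fin 3 → ℝ, ‖z‖ ≤ η → ∀ w, |w| ≤ δ⁻¹ → LinearIndependent ℝ
      ![perturb (k₁.arm f₁) (k₂.arm f₂) (k₁.arm f₁ 1 0) d₁ ε w,
        cubeMap (k₁.arm f₁) (k₂.arm f₂) (k₁.arm f₁ 1 0) v z])
    (hp₂ : ∀ z : Fin 3 → ℝ, ‖z‖ ≤ η → ∀ w, |w| ≤ δ⁻¹ → LinearIndependent ℝ
      ![perturb (k₂.arm f₂) (k₁.arm f₁) (k₁.arm f₁ 1 0) d₂ ε w,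
        cubeMap (k₁.arm f₁) (k₂.arm f₂) (k₁.arm f₁ 1 0) v z])
    (hε : 0 < ε) (hεη : ε < η ^ 2) {S : Set RP3}
    (hS : IsGluing S (k₁.arm f₁) (k₂.arm f₂) (k₁.arm f₁ 1 0) d₁ d₂ ε) :
    IsHyperbolaSmoothing (k₁.pt f₁.base)
      {q | ∃ z ∈ openCube, q.submodule = Submodule.span ℝ
        {cubeMap (k₁.arm f₁) (k₂.arm f₂) (k₁.arm f₁ 1 0) v (η • z)}}
      k₁.image k₂.image S := by
  have hδ : 0 < δ := hη.trans hηδ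
  set X := cubeMap (k₁.arm f₁) (k₂.arm f₂) (k₁.arm f₁ 1 0) v with hX
  have hinj' : ∀ z w : Fin 3 → ℝ, ‖z‖ < δ → ‖w‖ < δ →
      Submodule.span ℝ {X z} = Submodule.span ℝ {X w} → z = w := by
    intro z w hz hw h
    obtain ⟨c, -, hc⟩ := span_singleton_eq_iff.1 h
    exact hinj z w hz hw c hc
  have hcontra : ∀ {u w : E4}, LinearIndependent ℝ ![u, w] →
      Submodule.span ℝ {w} = Submodule.span ℝ {u} → False := fun hli h =>
    (linearIndependent_pair_iff_span_ne (hli.ne_zero 0) (hli.ne_zero 1)).1 hli h.symm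
  have hnorm : ∀ z ∈ openCube, ‖η • z‖ ≤ η := by
    intro z hz
    rw [norm_smul, Real.norm_eq_abs, abs_of_pos hη]
    have : ‖z‖ < 1 := (pi_norm_lt_iff one_pos).2 hz
    nlinarith
  -- The cube is scaled by η, which turns xy = ε into the hyperbola with constant ε/η².
  refine ⟨fun z => X (η • z), isCoordinateCube_cubeMap (k₁.contDiff_arm f₁) (k₂.contDiff_arm f₂)
    hη hηδ hframe hinj, ?_, ε / η ^ 2, (by positivity), ?_, ?_⟩
  · beta_reduce
    rw [smul_zero, hX, cubeMap_zero rfl he, ← k₁.submodule_pt_arm_one_left, Real.arctan_zero,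
      mul_zero, add_zero]
  · rw [abs_of_pos (by positivity), div_lt_one (by positivity)]
    exact hεη
  · intro z hz q hq
    beta_reduce at hq
    have hzη := hnorm z hz
    have hzδ := hzη.trans_lt hηδ
    refine ⟨⟨?_, ?_⟩, ⟨?_, ?_⟩, ⟨?_, ?_⟩⟩
    · intro hq₁
      rcases k₁.exists_of_mem_image f₁ hq₁ (inv_pos.2 hδ) with ⟨w, hw, h⟩ | ⟨x, hx, h⟩
      · exact (hcontra (h₁ _ hzη w hw) (hq.symm.trans h)).elim
      · rw [inv_inv] at hx
        have hx' : k₁.arm f₁ 1 x = X ![x, 0, 0] := by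
          rw [hX, cubeMap_eq_neck, neck_zero_right he]
        rw [hq, hx'] at h
        have := hinj' _ _ hzδ (norm_vec_lt hx (by simpa using hδ)) h
        have e1 := congrFun this 1
        have e2 := congrFun this 2
        simpa [hη.ne'] using And.intro e1 e2
    · rintro ⟨hz1, hz2⟩
      refine k₁.mem_image_of_arm f₁ (s := 1) (t := η * z 0) (by simp) ?_
      rw [hq, hX, cubeMap_apply]
      simp only [Pi.smul_apply, smul_eq_mul, hz1, hz2, mul_zero, zero_smul, add_zero]
      rw [neck_zero_right he]
    · intro hq₂
      rcases k₂.exists_of_mem_image f₂ hq₂ (inv_pos.2 hδ) with ⟨w, hw, h⟩ | ⟨y, hy, h⟩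
      · exact (hcontra (h₂ _ hzη w hw) (hq.symm.trans h)).elim
      · rw [inv_inv] at hy
        have hy' : k₂.arm f₂ 1 y = X ![0, y, 0] := by
          rw [hX, cubeMap_eq_neck, neck_zero_left rfl]
        rw [hq, hy'] at h
        have := hinj' _ _ hzδ (norm_vec_lt (by simpa using hδ) hy) h
        have e1 := congrFun this 0
        have e2 := congrFun this 2
        simpa [hη.ne'] using And.intro e1 e2
    · rintro ⟨hz0, hz2⟩
      refine k₂.mem_image_of_arm f₂ (s := 1) (t := η * z 1) (by simp) ?_
      rw [hq, hX, cubeMap_apply]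
      simp only [Pi.smul_apply, smul_eq_mul, hz0, hz2, mul_zero, zero_smul, add_zero]
      rw [neck_zero_left rfl]
    · intro hqS
      rcases hS.regions _ (inv_pos.2 hδ) q hqS with ⟨w, hw, h⟩ | ⟨w, hw, h⟩ | ⟨x, y, hx, hy, hxy, h⟩
      · exact (hcontra (hp₁ _ hzη w hw) (hq.symm.trans h)).elim
      · exact (hcontra (hp₂ _ hzη w hw) (hq.symm.trans h)).elim
      · rw [inv_inv] at hx hy
        rw [hq, ← cubeMap_eq_neck _ _ _ v] at h
        have := hinj' _ _ hzδ (norm_vec_lt hx hy) h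
        have e0 : η * z 0 = x := by simpa using congrFun this 0
        have e1 : η * z 1 = y := by simpa using congrFun this 1
        have e2 := congrFun this 2
        refine ⟨?_, by simpa [hη.ne'] using e2⟩
        rw [eq_div_iff (by positivity), ← hxy, ← e0, ← e1]
        ring
    · rintro ⟨hz01, hz2⟩
      refine hS.middle (η * z 0) (η * z 1) q ?_ ?_
      · rw [eq_div_iff (by positivity)] at hz01
        rw [← hz01]; ring
      · rw [hq, hX, cubeMap_apply]
        simp [hz2]

end Hyperbola

section Outside

variable {d₁ d₂ : ℕ} {k₁ : RealRationalKnot d₁} {k₂ : RealRationalKnot d₂} {f₁ f₂ : ArmFrame}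

theorem mem_cube_of_neck {v : E4} {η x y : ℝ} (hη : 0 < η) {P Q : ℝ → ℝ → E4} {e : E4} {q : RP3}
    (hx : |x| < η) (hy : |y| < η) (hq : q.submodule = Submodule.span ℝ {neck P Q e x y}) :
    q ∈ {q : RP3 | ∃ z ∈ openCube, q.submodule = Submodule.span ℝ {cubeMap P Q e v (η • z)}} := by
  have h : η • (![x / η, y / η, 0] : Fin 3 → ℝ) = ![x, y, 0] := by
    ext i; fin_cases i
    · simp [mul_div_cancel₀ _ hη.ne']
    · simp [mul_div_cancel₀ _ hη.ne']
    · simp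
  refine ⟨![x / η, y / η, 0], ?_, ?_⟩
  · exact (pi_norm_lt_iff one_pos).1 (norm_vec_lt
      (by rwa [abs_div, abs_of_pos hη, div_lt_one hη])
      (by rwa [abs_div, abs_of_pos hη, div_lt_one hη]))
  · rw [h, cubeMap_eq_neck, hq]

/-- With the cut-off η⁻¹, the neck of the glued curve lies in the cube and its arms lie in the
tubes. Points of the original curves that are not far have |x| ≤ M'⁻¹ < η and also lie in the cube.
-/
theorem isSectionOfUnionOutside_of_isGoodSide (he : k₂.arm f₂ 1 0 = k₁.arm f₁ 1 0) {v : E4}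
    {r M M' η ε : ℝ} (hη : 0 < η) (hM' : η⁻¹ < M') (hM : M' < M)
    (ht₁ : k₁.IsTubularRadius r) (ht₂ : k₂.IsTubularRadius r)
    (hs₁ : IsGoodSide k₁ k₂ f₁ f₂ r M M' η⁻¹ ε) (hs₂ : IsGoodSide k₂ k₁ f₂ f₁ r M M' η⁻¹ ε)
    (hdisj : ∀ θ ∈ RationalParam.farSet f₁ M', ∀ θ',
      Disjoint (k₁.normalDisc r θ) (k₂.normalDisc r θ')) {S : Set RP3}
    (hS : IsGluing S (k₁.arm f₁) (k₂.arm f₂) (k₁.arm f₁ 1 0) d₁ d₂ ε) :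
    IsSectionOfUnionOutside k₁.toRationalParam k₂.toRationalParam r
      {q | ∃ z ∈ openCube, q.submodule = Submodule.span ℝ
        {cubeMap (k₁.arm f₁) (k₂.arm f₂) (k₁.arm f₁ 1 0) v (η • z)}} S := by
  have hM'0 : 0 < M' := (inv_pos.2 hη).trans hM'
  have hM0 : 0 < M := hM'0.trans hM
  have hη' : M'⁻¹ < η := inv_lt_of_inv_lt₀ hη hM'
  have hS' : IsGluing S (k₂.arm f₂) (k₁.arm f₁) (k₂.arm f₂ 1 0) d₂ d₁ ε := by
    rw [he]; exact hS.symm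
  refine ⟨ht₁, ht₂, RationalParam.farSet f₁ M', RationalParam.farSet f₂ M',
    RationalParam.isOpen_farSet _ _, RationalParam.isOpen_farSet _ _, ?_, ?_, ?_, ?_,
    hs₁.isSection hM0 hS, hs₂.isSection hM0 hS'⟩
  · intro θ hθ
    by_contra hfar
    obtain ⟨x, hx, hq⟩ := k₁.exists_arm_of_not_lt f₁ hM'0 hfar
    refine hθ (mem_cube_of_neck hη (hx.trans_lt hη') (y := 0) (by simpa using hη) ?_)
    rw [hq, neck_zero_right he]
  · intro θ hθ
    by_contra hfar
    obtain ⟨y, hy, hq⟩ := k₂.exists_arm_of_not_lt f₂ hM'0 hfar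
    refine hθ (mem_cube_of_neck hη (x := 0) (by simpa using hη) (hy.trans_lt hη') ?_)
    rw [hq, neck_zero_left rfl]
  · rw [Set.disjoint_left]
    intro q hq hq'
    simp only [RationalParam.tube, mem_iUnion] at hq hq'
    obtain ⟨θ, hθ, hq⟩ := hq
    obtain ⟨θ', -, hq'⟩ := hq'
    exact Set.disjoint_left.1 (hdisj θ hθ θ') hq hq'
  · rintro q ⟨hqS, hqU⟩
    simp only [RationalParam.tube, mem_union, mem_iUnion]
    rcases hS.regions _ (inv_pos.2 hη) q hqS with ⟨w, hw, h⟩ | ⟨w, hw, h⟩ | ⟨x, y, hx, hy, -, h⟩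
    · obtain ⟨θ, hθ, hd⟩ := hs₁.exists_disc w hw
      exact Or.inl ⟨θ, hθ, (k₁.mem_normalDisc_iff h).2 hd⟩
    · obtain ⟨θ, hθ, hd⟩ := hs₂.exists_disc w hw
      rw [he] at hd
      exact Or.inr ⟨θ, hθ, (k₂.mem_normalDisc_iff h).2 hd⟩
    · rw [inv_inv] at hx hy
      exact absurd (mem_cube_of_neck hη hx hy h) hqU

end Outside

section Injective

variable {d₁ d₂ : ℕ} {k₁ : RealRationalKnot d₁} {k₂ : RealRationalKnot d₂} {f₁ f₂ : ArmFrame}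
  {a b : ℝ}

theorem RationalParam.inDisc_congr_span {d : ℕ} (k : RationalParam d) {r θ : ℝ} {v w : E4}
    (h : Submodule.span ℝ {v} = Submodule.span ℝ {w}) : k.InDisc r θ v ↔ k.InDisc r θ w := by
  obtain ⟨c, hc, rfl⟩ := span_singleton_eq_iff.1 h
  exact k.inDisc_smul_iff hc

theorem IsGoodSide.region_of_inDisc {r M M' M'' : ℝ} (ha : a ≠ 0) (hb : b ≠ 0) (hM : 0 < M)
    (hs : IsGoodSide k₁ k₂ f₁ f₂ r M M' M'' (a * b)) {θ : ℝ}
    (hθ : θ ∈ RationalParam.farSet f₁ M') {s t : ℝ} (hst : ¬ (s = 0 ∧ t = 0))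
    (hd : k₁.InDisc r θ (glueArm k₁.toRationalParam k₂.toRationalParam f₁ f₂ a b s t)) :
    t ≠ 0 ∧ |s / (b * t)| ≤ M ∧ k₁.InDisc r θ
      (perturb (k₁.arm f₁) (k₂.arm f₂) (k₁.arm f₁ 1 0) d₁ (a * b) (s / (b * t))) := by
  rcases gluing_regions a b hst M hM with ⟨ht, h⟩ | ⟨h0, h⟩ | ⟨h0, ht, hx, hy⟩
  · exact ⟨ht, h, (k₁.inDisc_congr_span (span_glueArm_left hb ht s)).1 hd⟩
  · exact absurd ((k₁.inDisc_congr_span (span_glueArm_right ha h0 t)).1 hd)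
      (hs.not_other _ h θ hθ)
  · refine absurd ((k₁.inDisc_congr_span (span_glueArm_neck h0 ht)).1 hd)
      (hs.not_neck _ _ hx.le hy.le ?_ θ hθ)
    field_simp

theorem IsGoodSide.eq_of_inDisc {r M M' M'' : ℝ} (ha : a ≠ 0) (hb : b ≠ 0) (hM : 0 < M)
    (hs : IsGoodSide k₁ k₂ f₁ f₂ r M M' M'' (a * b)) {θ : ℝ}
    (hθ : θ ∈ RationalParam.farSet f₁ M') {s t s' t' : ℝ} (hst : ¬ (s = 0 ∧ t = 0))
    (hst' : ¬ (s' = 0 ∧ t' = 0))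
    (hd : k₁.InDisc r θ (glueArm k₁.toRationalParam k₂.toRationalParam f₁ f₂ a b s t))
    (hd' : k₁.InDisc r θ (glueArm k₁.toRationalParam k₂.toRationalParam f₁ f₂ a b s' t')) :
    s * t' = s' * t := by
  obtain ⟨ht, h1, h2⟩ := hs.region_of_inDisc ha hb hM hθ hst hd
  obtain ⟨ht', h1', h2'⟩ := hs.region_of_inDisc ha hb hM hθ hst' hd'
  obtain ⟨σ, -, hσ⟩ := hs.isSectionAt θ hθ
  obtain ⟨w, -, -, -, hw⟩ := hσ.self_of_nhds
  have h3 := (hw _ h1 h2).trans (hw _ h1' h2').symm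
  rw [div_eq_div_iff (mul_ne_zero hb ht) (mul_ne_zero hb ht')] at h3
  apply mul_left_cancel₀ hb
  linear_combination h3

/-- If one of the two parameters lies on an arm, the common point is in a far normal disc, which the
glued curve meets with only one parameter. If both lie on the neck, injectivity of the chart
applies. -/
theorem glueArm_injective (he : k₂.arm f₂ 1 0 = k₁.arm f₁ 1 0) {v : E4} {r M M' δ η : ℝ}
    (ha : a ≠ 0) (hb : b ≠ 0) (hM : 0 < M) (hη : 0 < η) (hηδ : η < δ)
    (hinj : ∀ z w : Fin 3 → ℝ, ‖z‖ < δ → ‖w‖ < δ → ∀ c : ℝ,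
      c • cubeMap (k₁.arm f₁) (k₂.arm f₂) (k₁.arm f₁ 1 0) v w =
        cubeMap (k₁.arm f₁) (k₂.arm f₂) (k₁.arm f₁ 1 0) v z → z = w)
    (hs₁ : IsGoodSide k₁ k₂ f₁ f₂ r M M' η⁻¹ (a * b))
    (hs₂ : IsGoodSide k₂ k₁ f₂ f₁ r M M' η⁻¹ (a * b))
    {s t s' t' : ℝ} (hst : ¬ (s = 0 ∧ t = 0)) (hst' : ¬ (s' = 0 ∧ t' = 0))
    (hspan : Submodule.span ℝ
      {glueArm k₁.toRationalParam k₂.toRationalParam f₁ f₂ a b s t} = Submodule.span ℝ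
      {glueArm k₁.toRationalParam k₂.toRationalParam f₁ f₂ a b s' t'}) :
    s * t' = s' * t := by
  have case₁ : ∀ θ ∈ RationalParam.farSet f₁ M',
      k₁.InDisc r θ (glueArm k₁.toRationalParam k₂.toRationalParam f₁ f₂ a b s t) →
      s * t' = s' * t := fun θ hθ hd =>
    hs₁.eq_of_inDisc ha hb hM hθ hst hst' hd ((k₁.inDisc_congr_span hspan).1 hd)
  have case₂ : ∀ θ ∈ RationalParam.farSet f₂ M',
      k₂.InDisc r θ (glueArm k₁.toRationalParam k₂.toRationalParam f₁ f₂ a b s t) →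
      s * t' = s' * t := by
    intro θ hθ hd
    have hd' := (k₂.inDisc_congr_span hspan).1 hd
    -- Exchanging the curves also exchanges s with t and a with b.
    rw [glueArm_swap he] at hd hd'
    rw [mul_comm a b] at hs₂
    have := hs₂.eq_of_inDisc hb ha hM hθ (fun h => hst h.symm) (fun h => hst' h.symm) hd hd'
    linear_combination -this
  have left : ∀ {s t}, Submodule.span ℝ
      {glueArm k₁.toRationalParam k₂.toRationalParam f₁ f₂ a b s t} = Submodule.span ℝ
      {glueArm k₁.toRationalParam k₂.toRationalParam f₁ f₂ a b s' t'} →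
      t ≠ 0 → |s / (b * t)| ≤ η⁻¹ → ∃ θ ∈ RationalParam.farSet f₁ M',
      k₁.InDisc r θ (glueArm k₁.toRationalParam k₂.toRationalParam f₁ f₂ a b s' t') := by
    intro s t hspan ht h
    obtain ⟨θ, hθ, hd⟩ := hs₁.exists_disc _ h
    exact ⟨θ, hθ, (k₁.inDisc_congr_span ((span_glueArm_left hb ht s).symm.trans hspan)).1 hd⟩
  have right : ∀ {s t}, Submodule.span ℝ
      {glueArm k₁.toRationalParam k₂.toRationalParam f₁ f₂ a b s t} = Submodule.span ℝ
      {glueArm k₁.toRationalParam k₂.toRationalParam f₁ f₂ a b s' t'} →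
      s ≠ 0 → |t / (a * s)| ≤ η⁻¹ → ∃ θ ∈ RationalParam.farSet f₂ M',
      k₂.InDisc r θ (glueArm k₁.toRationalParam k₂.toRationalParam f₁ f₂ a b s' t') := by
    intro s t hspan hs h
    obtain ⟨θ, hθ, hd⟩ := hs₂.exists_disc _ h
    rw [he] at hd
    exact ⟨θ, hθ, (k₂.inDisc_congr_span ((span_glueArm_right ha hs t).symm.trans hspan)).1 hd⟩
  have fin₁ : (∃ θ ∈ RationalParam.farSet f₁ M',
      k₁.InDisc r θ (glueArm k₁.toRationalParam k₂.toRationalParam f₁ f₂ a b s' t')) →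
      s * t' = s' * t := fun ⟨θ, hθ, hd⟩ => case₁ θ hθ ((k₁.inDisc_congr_span hspan).2 hd)
  have fin₂ : (∃ θ ∈ RationalParam.farSet f₂ M',
      k₂.InDisc r θ (glueArm k₁.toRationalParam k₂.toRationalParam f₁ f₂ a b s' t')) →
      s * t' = s' * t := fun ⟨θ, hθ, hd⟩ => case₂ θ hθ ((k₂.inDisc_congr_span hspan).2 hd)
  rcases gluing_regions a b hst η⁻¹ (inv_pos.2 hη) with ⟨ht, h⟩ | ⟨hs, h⟩ | ⟨hs, ht, hx, hy⟩
  · exact fin₁ (left hspan ht h)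
  · exact fin₂ (right hspan hs h)
  rcases gluing_regions a b hst' η⁻¹ (inv_pos.2 hη) with ⟨ht', h⟩ | ⟨hs', h⟩ | ⟨hs', ht', hx', hy'⟩
  · exact fin₁ (left rfl ht' h)
  · exact fin₂ (right rfl hs' h)
  rw [inv_inv] at hx hy hx' hy'
  rw [span_glueArm_neck hs ht, span_glueArm_neck hs' ht', ← cubeMap_eq_neck _ _ _ v,
    ← cubeMap_eq_neck _ _ _ v] at hspan
  obtain ⟨c, -, hc⟩ := span_singleton_eq_iff.1 hspan
  have := hinj _ _ (norm_vec_lt (hx.trans hηδ) (hy.trans hηδ))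
    (norm_vec_lt (hx'.trans hηδ) (hy'.trans hηδ)) c hc
  have e0 : b * t / s = b * t' / s' := by simpa using congrFun this 0
  rw [div_eq_div_iff hs hs'] at e0
  apply mul_left_cancel₀ hb
  linear_combination -e0

theorem gluedParam_injective
    (h : ∀ s t, ¬ (s = 0 ∧ t = 0) →
      glueArm k₁.toRationalParam k₂.toRationalParam f₁ f₂ a b s t ≠ 0)
    (hinj : ∀ s t s' t' : ℝ, ¬ (s = 0 ∧ t = 0) → ¬ (s' = 0 ∧ t' = 0) →
      Submodule.span ℝ {glueArm k₁.toRationalParam k₂.toRationalParam f₁ f₂ a b s t} =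
        Submodule.span ℝ {glueArm k₁.toRationalParam k₂.toRationalParam f₁ f₂ a b s' t'} →
      s * t' = s' * t) :
    Function.Injective (gluedParam k₁.toRationalParam k₂.toRationalParam f₁ f₂ a b h).map := by
  intro x y hxy
  obtain ⟨θ, rfl⟩ := circlePt_surjective x
  obtain ⟨θ', rfl⟩ := circlePt_surjective y
  have hne : ∀ θ : ℝ, ¬ (Real.cos θ = 0 ∧ Real.sin θ = 0) := by
    rintro θ ⟨h0, h1⟩
    exact RationalParam.cos_sin_ne_zero θ (by rw [h0, h1]; ext i; fin_cases i <;> rfl)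
  have h1 := congrArg Projectivization.submodule hxy
  change (RationalParam.pt _ θ).submodule = (RationalParam.pt _ θ').submodule at h1
  rw [RationalParam.submodule_pt, RationalParam.submodule_pt, gluedParam_lift,
    gluedParam_lift] at h1
  have h2 := hinj _ _ _ _ (hne θ) (hne θ') h1
  rw [circlePt_eq_iff, Real.sin_sub]
  linarith

theorem gluedParam_immersion {v : E4} {δ : ℝ} (ha : a ≠ 0) (hb : b ≠ 0) (hδ : 0 < δ)
    (h : ∀ s t, ¬ (s = 0 ∧ t = 0) →
      glueArm k₁.toRationalParam k₂.toRationalParam f₁ f₂ a b s t ≠ 0)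
    (hframe : ∀ z : Fin 3 → ℝ, ‖z‖ < δ →
      LinearIndependent ℝ (cubeFrame (k₁.arm f₁) (k₂.arm f₂) (k₁.arm f₁ 1 0) v z))
    (hi₁ : ∀ w, |w| ≤ δ⁻¹ → LinearIndependent ℝ
      ![perturb (k₁.arm f₁) (k₂.arm f₂) (k₁.arm f₁ 1 0) d₁ (a * b) w,
        deriv (perturb (k₁.arm f₁) (k₂.arm f₂) (k₁.arm f₁ 1 0) d₁ (a * b)) w])
    (hi₂ : ∀ w, |w| ≤ δ⁻¹ → LinearIndependent ℝ
      ![perturb (k₂.arm f₂) (k₁.arm f₁) (k₁.arm f₁ 1 0) d₂ (a * b) w,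
        deriv (perturb (k₂.arm f₂) (k₁.arm f₁) (k₁.arm f₁ 1 0) d₂ (a * b)) w]) (θ : ℝ) :
    LinearIndependent ℝ
      ![(gluedParam k₁.toRationalParam k₂.toRationalParam f₁ f₂ a b h).lift θ,
        deriv (gluedParam k₁.toRationalParam k₂.toRationalParam f₁ f₂ a b h).lift θ] := by
  have hne : ¬ (Real.cos θ = 0 ∧ Real.sin θ = 0) := by
    rintro ⟨h0, h1⟩
    exact RationalParam.cos_sin_ne_zero θ (by rw [h0, h1]; ext i; fin_cases i <;> rfl)
  rcases gluing_regions a b hne δ⁻¹ (inv_pos.2 hδ) with ⟨ht, hw⟩ | ⟨hs, hw⟩ | ⟨hs, ht, hx, hy⟩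
  · obtain ⟨c', hc'⟩ := exists_deriv_gluedParam_left h hb ht
    rw [hc', gluedParam_lift, glueArm_eq_left hb ht]
    exact linearIndependent_pair_reparam (hi₁ _ hw) (by simp [hb, ht]) (by simp [hb, ht])
  · obtain ⟨c', hc'⟩ := exists_deriv_gluedParam_right h ha hs
    rw [hc', gluedParam_lift, glueArm_eq_right ha hs]
    exact linearIndependent_pair_reparam (hi₂ _ hw) (by simp [ha, hs]) (by simp [ha, hs])
  · rw [inv_inv] at hx hy
    exact linearIndependent_gluedParam_neck h ha hb hs ht (hframe _ (norm_vec_lt hx hy))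

end Injective

end

/-! ### Choice of the constants and conclusion. -/

section
open Filter Topology Set

variable {d₁ d₂ : ℕ}

/-- The scale of the second frame makes the two vectors over p equal; the opposite signs make both
velocity factors positive. -/
theorem exists_armFrames (k₁ : RationalParam d₁) (k₂ : RationalParam d₂) {τ₁ τ₂ : ℝ}
    (h : k₁.pt τ₁ = k₂.pt τ₂) :
    ∃ f₁ f₂ : ArmFrame, f₁.base = τ₁ ∧ f₂.base = τ₂ ∧ f₁.sign = 1 ∧ f₂.sign = -1 ∧
      k₂.arm f₂ 1 0 = k₁.arm f₁ 1 0 := by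
  have h1 := congrArg Projectivization.submodule h
  rw [RationalParam.submodule_pt, RationalParam.submodule_pt] at h1
  obtain ⟨c, hc, h2⟩ := span_singleton_eq_iff.1 h1
  refine ⟨⟨τ₁, 1, 1, Or.inl rfl, one_ne_zero⟩, ⟨τ₂, -1, c, Or.inr rfl, hc⟩, rfl, rfl, rfl, rfl, ?_⟩
  rw [RationalParam.arm_one_left, RationalParam.arm_one_left]
  simp [h2]

theorem eventually_mem_of_isOpenSet {X : (Fin 3 → ℝ) → E4} (hX : Continuous X) {W : Set RP3}
    (hW : RP3.IsOpenSet W) {p : RP3} (hp : p ∈ W) (hp₀ : p.submodule = Submodule.span ℝ {X 0}) :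
    ∀ᶠ z in 𝓝 (0 : Fin 3 → ℝ), ∀ q : RP3, q.submodule = Submodule.span ℝ {X z} → q ∈ W := by
  have key : ∀ q : RP3, ∀ v : E4, q.submodule = Submodule.span ℝ {v} →
      ∃ hv : v ≠ 0, q = Projectivization.mk ℝ v hv := by
    intro q v hq
    have hv : v ≠ 0 := by
      rintro rfl
      have h := q.finrank_submodule
      rw [hq, Submodule.span_zero_singleton, finrank_bot] at h
      exact zero_ne_one h
    refine ⟨hv, Projectivization.submodule_injective ?_⟩
    rw [hq, Projectivization.submodule_mk]
  obtain ⟨h0, rfl⟩ := key p _ hp₀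
  filter_upwards [hX.continuousAt.eventually (hW.mem_nhds ⟨h0, hp⟩)] with z hz q hq
  obtain ⟨_, rfl⟩ := key q _ hq
  exact hz.2

section Glue

variable (k₁ : RationalParam d₁) (k₂ : RationalParam d₂) {f₁ f₂ : ArmFrame}

theorem eventually_glueArm_ne_zero (he : k₂.arm f₂ 1 0 = k₁.arm f₁ 1 0) :
    ∀ᶠ ε in 𝓝 (0 : ℝ), ∀ a b : ℝ, a ≠ 0 → b ≠ 0 → a * b = ε →
      ∀ s t, ¬ (s = 0 ∧ t = 0) → glueArm k₁ k₂ f₁ f₂ a b s t ≠ 0 :=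
  eventually_glue_ne_zero (k₁.contDiff_arm f₁).continuous (k₂.contDiff_arm f₂).continuous
    (k₁.arm_mul f₁) (k₂.arm_mul f₂) (fun _ _ => k₁.arm_ne_zero f₁) (fun _ _ => k₂.arm_ne_zero f₂)
    rfl he

theorem eventually_glue_scalarArm_ne_zero (he : k₂.arm f₂ 1 0 = k₁.arm f₁ 1 0) :
    ∀ᶠ ε in 𝓝 (0 : ℝ), k₁.NoComplexZero → k₂.NoComplexZero →
      ∀ a b : ℝ, a ≠ 0 → b ≠ 0 → a * b = ε → ∀ s t : ℂ, ¬ (s = 0 ∧ t = 0) →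
      glue (k₁.scalarArm f₁ ℂ) (k₂.scalarArm f₂ ℂ) (k₁.scalarArm f₁ ℂ 1 0) d₁ d₂ (a : ℂ) (b : ℂ) s t
        ≠ 0 := by
  by_cases h : k₁.NoComplexZero ∧ k₂.NoComplexZero
  swap
  · exact Eventually.of_forall fun _ h₁ h₂ => absurd ⟨h₁, h₂⟩ h
  have h1 := eventually_glue_ne_zero (k₁.continuous_scalarArm f₁) (k₂.continuous_scalarArm f₂)
    (k₁.scalarArm_mul f₁ ℂ) (k₂.scalarArm_mul f₂ ℂ) (fun _ _ => k₁.scalarArm_ne_zero f₁ h.1)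
    (fun _ _ => k₂.scalarArm_ne_zero f₂ h.2) rfl
    (by rw [RationalParam.scalarArm_one_zero, RationalParam.scalarArm_one_zero, he])
  have h2 : Tendsto (fun ε : ℝ => (ε : ℂ)) (𝓝 0) (𝓝 0) := by
    simpa using Complex.continuous_ofReal.tendsto 0
  filter_upwards [h2.eventually h1] with ε hε _ _ a b ha hb hab
  exact hε a b (by exact_mod_cast ha) (by exact_mod_cast hb) (by exact_mod_cast hab)

end Glue

/-- The product of a and b is dictated by the smallness conditions, but their ratio is free. This
freedom realizes the prescribed velocity ratio. -/
theorem exists_pos_mul_eq {ε ρ : ℝ} (hε : 0 < ε) (hρ : 0 < ρ) :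
    ∃ a b : ℝ, 0 < a ∧ 0 < b ∧ a = ρ * b ∧ a * b = ε := by
  have hb : 0 < √(ε / ρ) := by positivity
  refine ⟨ρ * √(ε / ρ), √(ε / ρ), by positivity, hb, rfl, ?_⟩
  rw [mul_assoc, Real.mul_self_sqrt (by positivity), mul_div_cancel₀ _ hρ.ne']

section Knot

variable {k₁ : RealRationalKnot d₁} {k₂ : RealRationalKnot d₂} {f₁ f₂ : ArmFrame}

theorem linearIndependent_arm_derivs (he : k₂.arm f₂ 1 0 = k₁.arm f₁ 1 0)
    (hne : k₁.tangentLine f₁.base ≠ k₂.tangentLine f₂.base) :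
    LinearIndependent ℝ ![k₁.arm f₁ 1 0, deriv (fun x => k₁.arm f₁ 1 x) 0,
      deriv (fun x => k₂.arm f₂ 1 x) 0] := by
  have h₂ := k₂.linearIndependent_arm_one_left f₂ 0
  have h₃ := k₂.span_arm_one_left_zero f₂
  rw [he] at h₂ h₃
  refine linearIndependent_triple (k₁.linearIndependent_arm_one_left f₁ 0) h₂ ?_
  rwa [h₃, k₁.span_arm_one_left_zero f₁]

theorem exists_gluing_knot (he : k₂.arm f₂ 1 0 = k₁.arm f₁ 1 0)
    (hf₁ : f₁.sign = 1) (hf₂ : f₂.sign = -1)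
    (hne : k₁.tangentLine f₁.base ≠ k₂.tangentLine f₂.base)
    (hsep₁ : ∀ w θ, k₁.pt (f₁.angle w) ≠ k₂.pt θ) (hsep₂ : ∀ w θ, k₂.pt (f₂.angle w) ≠ k₁.pt θ)
    {W : Set RP3} (hW : RP3.IsOpenSet W) (hpW : k₁.pt f₁.base ∈ W) {r₀ ρ : ℝ} (hr₀ : 0 < r₀)
    (hρ : 0 < ρ) :
    ∃ k : RealRationalKnot (d₁ + d₂),
      (∃ U : Set RP3, U ⊆ W ∧
        (∃ r : ℝ, r < r₀ ∧
          IsSectionOfUnionOutside k₁.toRationalParam k₂.toRationalParam r U k.image) ∧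
        IsHyperbolaSmoothing (k₁.pt f₁.base) U k₁.image k₂.image k.image) ∧
      (∃ ψ₁ ψ₂ c₁ c₂ : ℝ, 0 < c₁ ∧ 0 < c₂ ∧ c₁ = ρ * c₂ ∧
        HasVelocityRatio k.toRationalParam ψ₁ k₁.toRationalParam (f₁.angle 0) c₁ ∧
        HasVelocityRatio k.toRationalParam ψ₂ k₂.toRationalParam (f₂.angle 0) c₂) ∧
      (k₁.NoComplexZero → k₂.NoComplexZero → k.NoComplexZero) := by
  have hP := k₁.contDiff_arm f₁
  have hQ := k₂.contDiff_arm f₂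
  obtain ⟨v, δ, hδ, hframe, hinj⟩ := exists_chart_radius hP hQ rfl he
    (linearIndependent_arm_derivs he hne)
  have hX : Continuous (cubeMap (k₁.arm f₁) (k₂.arm f₂) (k₁.arm f₁ 1 0) v) :=
    (contDiff_cubeMap hP hQ).continuous
  have hX₀ : cubeMap (k₁.arm f₁) (k₂.arm f₂) (k₁.arm f₁ 1 0) v 0 = k₁.arm f₁ 1 0 :=
    cubeMap_zero rfl he
  obtain ⟨η₀, hη₀, hball⟩ := Metric.eventually_nhds_iff.1
    (((eventually_linearIndependent_arm_cubeMap k₁ f₁ hX hX₀ δ⁻¹).and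
      (eventually_linearIndependent_arm_cubeMap k₂ f₂ hX (hX₀.trans he.symm) δ⁻¹)).and
      (eventually_mem_of_isOpenSet hX hW hpW (by
        rw [hX₀, ← k₁.submodule_pt_arm_one_left, Real.arctan_zero, mul_zero, add_zero])))
  -- The cube of size η has to lie in W, avoid both arms cut at δ⁻¹, and lie strictly inside the
  -- region where the chart is injective.
  obtain ⟨η, hη, hη'⟩ := exists_between (lt_min hη₀ hδ)
  have hηδ : η < δ := hη'.trans_le (min_le_right _ _)
  have hball' : ∀ z : Fin 3 → ℝ, ‖z‖ ≤ η → _ := fun z hz =>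
    hball (y := z) (by rw [dist_zero_right]; exact hz.trans_lt (hη'.trans_le (min_le_left _ _)))
  have h₁ : ∀ z : Fin 3 → ℝ, ‖z‖ ≤ η → ∀ w, |w| ≤ δ⁻¹ → LinearIndependent ℝ
      ![k₁.arm f₁ w 1, cubeMap (k₁.arm f₁) (k₂.arm f₂) (k₁.arm f₁ 1 0) v z] :=
    fun z hz w hw => (hball' z hz).1.1 w (abs_le.1 hw)
  have h₂ : ∀ z : Fin 3 → ℝ, ‖z‖ ≤ η → ∀ w, |w| ≤ δ⁻¹ → LinearIndependent ℝ
      ![k₂.arm f₂ w 1, cubeMap (k₁.arm f₁) (k₂.arm f₂) (k₁.arm f₁ 1 0) v z] :=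
    fun z hz w hw => (hball' z hz).1.2 w (abs_le.1 hw)
  have hη0 : 0 < η⁻¹ := inv_pos.2 hη
  -- Three nested cut-offs are used. Arms up to η⁻¹ cover everything outside the cube, the discs
  -- reach to M', and intersections with them are sought for parameters up to M.
  obtain ⟨M', hM''⟩ := exists_gt η⁻¹
  obtain ⟨M, hM'⟩ := exists_gt M'
  have hM0 : 0 < M := (hη0.trans hM'').trans hM'
  obtain ⟨R₁, hR₁⟩ := k₁.exists_isTubularRadius
  obtain ⟨R₂, hR₂⟩ := k₂.exists_isTubularRadius
  obtain ⟨R₃, hR₃, hdisj₁⟩ := exists_disjoint_normalDisc _ _ f₁ hsep₁ M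
  obtain ⟨R₄, hR₄, hdisj₂⟩ := exists_disjoint_normalDisc _ _ f₂ hsep₂ M
  obtain ⟨R, hR, hRmin⟩ : ∃ R, 0 < R ∧ R ≤ min (min R₁ R₂) (min R₃ R₄) :=
    ⟨_, lt_min (lt_min hR₁.1 hR₂.1) (lt_min hR₃ hR₄), le_rfl⟩
  obtain ⟨⟨hRR₁, hRR₂⟩, hRR₃, hRR₄⟩ := (le_min_iff.trans (and_congr le_min_iff le_min_iff)).1 hRmin
  obtain ⟨r, hr, hr'⟩ := exists_between (lt_min hR hr₀)
  obtain ⟨hrR, hrr₀⟩ := lt_min_iff.1 hr'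
  have hd₁ : ∀ θ ∈ RationalParam.farSet f₁ M, ∀ θ',
      Disjoint (k₁.normalDisc R θ) (k₂.normalDisc R θ') := fun θ hθ θ' =>
    (hdisj₁ θ hθ θ').mono (k₁.normalDisc_mono hRR₃ θ) (k₂.normalDisc_mono hRR₃ θ')
  have hd₂ : ∀ θ ∈ RationalParam.farSet f₂ M, ∀ θ',
      Disjoint (k₂.normalDisc R θ) (k₁.normalDisc R θ') := fun θ hθ θ' =>
    (hdisj₂ θ hθ θ').mono (k₂.normalDisc_mono hRR₄ θ) (k₁.normalDisc_mono hRR₄ θ')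
  have hd : ∀ θ ∈ RationalParam.farSet f₁ M', ∀ θ',
      Disjoint (k₁.normalDisc r θ) (k₂.normalDisc r θ') := fun θ hθ θ' =>
    (hd₁ θ (lt_of_lt_of_le hθ (mul_le_mul_of_nonneg_right hM'.le (abs_nonneg _))) θ').mono (k₁.normalDisc_mono hrR.le θ)
      (k₂.normalDisc_mono hrR.le θ')
  have hev := (eventually_isGoodSide k₁ k₂ f₁ f₂ he hr hrR (hR₁.mono hR hRR₁) hd₁ hη0 hM'' hM').and
    ((eventually_isGoodSide k₂ k₁ f₂ f₁ he.symm hr hrR (hR₂.mono hR hRR₂) hd₂ hη0 hM'' hM').and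
    ((eventually_linearIndependent_perturb_cubeMap (m := d₁) hP hQ he hX h₁).and
    ((eventually_linearIndependent_perturb_cubeMap (m := d₂) hQ hP rfl hX h₂).and
    ((eventually_linearIndependent_perturb_deriv (m := d₁) k₁ f₁ hQ he δ⁻¹).and
    ((eventually_linearIndependent_perturb_deriv (m := d₂) k₂ f₂ hP rfl δ⁻¹).and
    ((eventually_glueArm_ne_zero k₁.toRationalParam k₂.toRationalParam he).and
    ((eventually_glue_scalarArm_ne_zero k₁.toRationalParam k₂.toRationalParam he).and
    (eventually_lt_nhds (pow_pos hη 2)))))))))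
  -- Everything but ε has been fixed, and finitely many conditions hold for all small ε; a positive
  -- one is selected.
  obtain ⟨ε, ⟨hs₁, hs₂, hp₁, hp₂, hi₁, hi₂, hg, hgC, hεη⟩, hε⟩ :=
    ((hev.filter_mono nhdsWithin_le_nhds).and (self_mem_nhdsWithin (s := Ioi (0 : ℝ)))).exists
  obtain ⟨a, b, ha, hb, hab, rfl⟩ := exists_pos_mul_eq hε hρ
  have h := hg a b ha.ne' hb.ne' rfl
  have hS := isGluing_image ha.ne' hb.ne' h
  refine ⟨⟨gluedParam k₁.toRationalParam k₂.toRationalParam f₁ f₂ a b h,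
    gluedParam_injective h fun s t s' t' hst hst' =>
      glueArm_injective he ha.ne' hb.ne' hM0 hη hηδ hinj hs₁ hs₂ hst hst',
    gluedParam_immersion ha.ne' hb.ne' hδ h hframe hi₁ hi₂⟩,
    ⟨_, ?_, ⟨r, hrr₀, isSectionOfUnionOutside_of_isGoodSide he hη hM'' hM'
      (hR₁.mono hr (hrR.le.trans hRR₁)) (hR₂.mono hr (hrR.le.trans hRR₂)) hs₁ hs₂ hd hS⟩,
      isHyperbolaSmoothing_of_isGluing he hη hηδ hframe hinj h₁ h₂ hp₁ hp₂ hε hεη hS⟩,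
    ⟨Real.pi / 2, 0, b⁻¹, a⁻¹, inv_pos.2 hb, inv_pos.2 ha, ?_,
      hasVelocityRatio_left h he hb.ne' hf₁, hasVelocityRatio_right h ha.ne' hf₂⟩,
    fun hC₁ hC₂ => gluedParam_noComplexZero h (hgC hC₁ hC₂ a b ha.ne' hb.ne' rfl)⟩
  · rintro q ⟨z, hz, hq⟩
    refine (hball' (η • z) ?_).2 q hq
    rw [norm_smul, Real.norm_eq_abs, abs_of_pos hη]
    have hz' : ‖z‖ < 1 := (pi_norm_lt_iff one_pos).2 hz
    exact mul_le_of_le_one_right hη.le hz'.le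
  -- The velocity factors are 1/b and 1/a, with a = ρb.
  · rw [hab]
    field_simp

end Knot

end

theorem mainTheorem9 {d₁ d₂ : ℕ} (k₁ : RealRationalKnot d₁) (k₂ : RealRationalKnot d₂) (p : RP3)
    (hmeet : k₁.image ∩ k₂.image = {p})
    (htransverse : ∀ τ₁ τ₂ : ℝ, k₁.pt τ₁ = p → k₂.pt τ₂ = p →
      k₁.tangentLine τ₁ ≠ k₂.tangentLine τ₂) :
    ∃ φ₁ φ₂ : ℝ, k₁.pt φ₁ ≠ p ∧ k₂.pt φ₂ ≠ p ∧
      ∀ W : Set RP3, RP3.IsOpenSet W → p ∈ W → ∀ r₀ : ℝ, 0 < r₀ → ∀ ρ : ℝ, 0 < ρ →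
        ∃ k : RealRationalKnot (d₁ + d₂),
          (∃ U : Set RP3, U ⊆ W ∧
            (∃ r : ℝ, r < r₀ ∧
              IsSectionOfUnionOutside k₁.toRationalParam k₂.toRationalParam r U k.image) ∧
            IsHyperbolaSmoothing p U k₁.image k₂.image k.image) ∧
          (∃ ψ₁ ψ₂ c₁ c₂ : ℝ, 0 < c₁ ∧ 0 < c₂ ∧ c₁ = ρ * c₂ ∧
            HasVelocityRatio k.toRationalParam ψ₁ k₁.toRationalParam φ₁ c₁ ∧
            HasVelocityRatio k.toRationalParam ψ₂ k₂.toRationalParam φ₂ c₂) ∧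
          (k₁.NoComplexZero → k₂.NoComplexZero → k.NoComplexZero) := by
  have hp : p ∈ k₁.image ∩ k₂.image := hmeet ▸ Set.mem_singleton p
  rw [k₁.image_eq_range_pt, k₂.image_eq_range_pt] at hp hmeet
  obtain ⟨⟨τ₁, hτ₁⟩, τ₂, hτ₂⟩ := hp
  obtain ⟨f₁, f₂, rfl, rfl, hf₁, hf₂, he⟩ :=
    exists_armFrames k₁.toRationalParam k₂.toRationalParam (hτ₁.trans hτ₂.symm)
  have hne₁ : ∀ w, k₁.pt (f₁.angle w) ≠ p := fun w h =>
    f₁.circlePt_angle_ne_base w (k₁.pt_eq_iff.1 (h.trans hτ₁.symm))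
  have hne₂ : ∀ w, k₂.pt (f₂.angle w) ≠ p := fun w h =>
    f₂.circlePt_angle_ne_base w (k₂.pt_eq_iff.1 (h.trans hτ₂.symm))
  have hmem : ∀ θ θ', k₁.pt θ = k₂.pt θ' → k₁.pt θ = p := fun θ θ' h =>
    (Set.ext_iff.1 hmeet _).1 ⟨⟨θ, rfl⟩, θ', h.symm⟩
  -- The points w = 0 are a quarter turn of the angle away from p, and are fixed before W, r₀ and ρ.
  refine ⟨f₁.angle 0, f₂.angle 0, hne₁ 0, hne₂ 0, fun W hW hpW r₀ hr₀ ρ hρ => ?_⟩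
  subst hτ₁
  exact exists_gluing_knot he hf₁ hf₂ (htransverse _ _ rfl hτ₂)
    (fun w θ h => hne₁ w (hmem _ _ h)) (fun w θ h => hne₂ w (h.trans (hmem _ _ h.symm)))
    hW hpW hr₀ hρ
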